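/- **Conventions.** A *closed connected surface* is a connected compact polyhedron with a triangulation in which the link of every vertex is a circle. A *regular $3$-colored graph* $\Gamma$ is a finite loopless $3$-regular multigraph with a proper edge-coloring by the colors $0,1,2$; $g_{ij}$ is the number of its cycles with alternating colors $i,j$. Let $|\mathcal K(\Gamma)|$ be the space obtained by taking one triangle with vertices labeled $0,1,2$ for each vertex of $\Gamma$ and, for each edge $uv$ of color $j$, identifying the sides opposite to the vertices labeled $j$ of the triangles of $u$ and $v$, respecting labels. $\Gamma$ is a *gem* of (represents) $K$ if $|\mathcal K(\Gamma)|$ is homeomorphic to $K$. The regular genus of $\Gamma$ is $\rho(\Gamma)=1-\tfrac12\left(g_{01}+g_{12}+g_{02}-\tfrac12|V(\Gamma)|\right)$, and a gem $\Gamma$ of $K$ is *genus-minimal* if $\rho(\Gamma)\le\rho(\Gamma')$ for every regular $3$-colored graph $\Gamma'$ that represents $K$. An embedding of $\Gamma$ in a surface is *regular* if its regions are open discs, each bounded by a two-colored cycle, with exactly one region for each two-colored cycle. A gem $\Gamma$ of $K$ that is regularly embedded in a closed connected surface $S$ is *semi-equivelar of type $(f_0,f_1,f_2)$* if at every vertex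 the cycle of the three faces consists of an $f_0$-gon, an $f_1$-gon and an $f_2$-gon (up to rotation and reflection of the cycle); $(q^3)$ abbreviates $(q,q,q)$. **Theorem.** Every closed connected surface $K$ admits a semi-equivelar gem that is genus-minimal, regularly embedded in $K$ itself, and has no $2$-gons among its faces. Explicitly, with gems that are genus-minimal and regularly embedded in the surface itself: 1. $\mathbb S^2$ has a semi-equivelar gem of type $(4^3)$; 2. for every $n\ge 1$, $\#_n(\mathbb S^1\times\mathbb S^1)$ has a semi-equivelar gem of type $((4n+2)^3)$; 3. for every $n\ge 1$, $\#_n\,\mathbb{RP}^2$ has a semi-equivelar gem of type $((2n+2)^3)$. -/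

import Mathlib

noncomputable section

/-! ### Closed connected surfaces (in the piecewise linear category) -/

/-- The set of faces of the link of a vertex `v` in a simplicial complex. -/
def AbstractSimplicialComplex.linkFaces {V : Type} [DecidableEq V]
    (X : AbstractSimplicialComplex V) (v : V) : Set (Finset V) :=
  {s | s.Nonempty ∧ v ∉ s ∧ insert v s ∈ X.faces}

/-- A set of faces is a polygonal circle: it consists of the vertices and the edges of a cycle
with `m ≥ 3` distinct vertices. These are exactly the triangulations of the circle. -/
def IsPolygonalCircle {V : Type} [DecidableEq V] (L : Set (Finset V)) : Prop :=
  ∃ m : ℕ, 3 ≤ m ∧ ∃ f : ZMod m → V, Function.Injective f ∧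
    ∀ s : Finset V, s ∈ L ↔ (∃ i, s = {f i}) ∨ (∃ i, s = {f i, f (i + 1)})

/-- All vertex links are circles. -/
def AbstractSimplicialComplex.IsClosedSurface {V : Type} [DecidableEq V]
    (X : AbstractSimplicialComplex V) : Prop :=
  ∀ v : V, IsPolygonalCircle (X.linkFaces v)

/-- The geometric realization of a finite simplicial complex, by barycentric coordinates. -/
def AbstractSimplicialComplex.Realization {V : Type} [Fintype V]
    (X : AbstractSimplicialComplex V) : Type :=
  {x : V → ℝ // (∀ v, 0 ≤ x v) ∧ ∑ v, x v = 1 ∧ ∃ s ∈ X.faces, ∀ v, v ∉ s → x v = 0}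

instance {V : Type} [Fintype V] (X : AbstractSimplicialComplex V) :
    TopologicalSpace X.Realization :=
  instTopologicalSpaceSubtype (X := V → ℝ)

/-- `X` triangulates the space `K`. -/
def AbstractSimplicialComplex.Triangulates {V : Type} [Fintype V]
    (X : AbstractSimplicialComplex V) (K : Type*) [TopologicalSpace K] : Prop :=
  Nonempty (X.Realization ≃ₜ K)

/-- A closed connected surface: a connected compact polyhedron with a (finite) triangulation in
which the link of every vertex is a circle. -/
def IsClosedConnectedSurface (K : Type*) [TopologicalSpace K] : Prop :=
  ConnectedSpace K ∧
    ∃ (V : Type) (_ : Fintype V) (_ : DecidableEq V) (X : AbstractSimplicialComplex V),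
      X.IsClosedSurface ∧ X.Triangulates K

/-! ### Connected sums -/

/-- `Z` is obtained from `X` and `Y` by removing an (open) triangle `σ` of `X` and an (open)
triangle `τ` of `Y` and by gluing the rest along a bijection between the boundaries of the two
triangles; `a` and `b` are the inclusions of the two pieces. -/
def AbstractSimplicialComplex.IsConnectedSum {V W U : Type}
    (X : AbstractSimplicialComplex V) (Y : AbstractSimplicialComplex W)
    (Z : AbstractSimplicialComplex U) : Prop :=
  ∃ (a : V ↪ U) (b : W ↪ U) (σ : Finset V) (τ : Finset W),
    σ ∈ X.faces ∧ σ.card = 3 ∧ τ ∈ Y.faces ∧ τ.card = 3 ∧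
    σ.map a = τ.map b ∧
    Set.range a ∩ Set.range b = ↑(σ.map a) ∧
    ∀ u : Finset U, u ∈ Z.faces ↔
      (∃ s ∈ X.faces, s ≠ σ ∧ u = s.map a) ∨ (∃ t ∈ Y.faces, t ≠ τ ∧ u = t.map b)

/-- The space `K` is a connected sum `A # B` of closed surfaces. -/
def IsConnectedSum (A B K : Type*) [TopologicalSpace A] [TopologicalSpace B]
    [TopologicalSpace K] : Prop :=
  ∃ (V W U : Type) (_ : Fintype V) (_ : Fintype W) (_ : Fintype U)
    (_ : DecidableEq V) (_ : DecidableEq W)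
    (X : AbstractSimplicialComplex V) (Y : AbstractSimplicialComplex W)
    (Z : AbstractSimplicialComplex U),
    X.IsClosedSurface ∧ Y.IsClosedSurface ∧ X.Triangulates A ∧ Y.Triangulates B ∧
      X.IsConnectedSum Y Z ∧ Z.Triangulates K

/-- The standard 2-sphere. -/
abbrev TwoSphere : Type := Metric.sphere (0 : EuclideanSpace ℝ (Fin 3)) 1

/-- The torus `S¹ × S¹`. -/
abbrev Torus : Type := Circle × Circle

/-- The real projective plane: the 2-sphere with antipodal points identified. -/
abbrev ProjectivePlane : Type := Quot (fun x y : TwoSphere => y = -x)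

/-- `K` is homeomorphic to `#ₙ T`, the connected sum of `n` copies of `T`
(by convention the sphere, for `n = 0`). -/
def IsConnectedSumPower (T : Type) [TopologicalSpace T] :
    ℕ → (K : Type) → [TopologicalSpace K] → Prop
  | 0, K, _ => Nonempty (K ≃ₜ TwoSphere)
  | 1, K, _ => Nonempty (K ≃ₜ T)
  | n + 2, K, _ => ∃ (A : Type) (_ : TopologicalSpace A),
      IsConnectedSumPower T (n + 1) A ∧ IsConnectedSum A T K

/-! ### Regular colored graphs and gems -/

/-- A finite regular `(d+1)`-colored graph: a loopless `(d+1)`-regular multigraph with a proper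
edge-coloring by the colors `0, …, d`. Every vertex `v` lies on exactly one edge of each color
`c`, so the graph is given by its vertex set and by the vertex `adj c v` at the other end of that
edge. Edges of distinct colors may be parallel. -/
structure ColoredGraph (d : ℕ) where
  V : Type
  finite_V : Finite V
  adj : Fin (d + 1) → V → V
  adj_adj : ∀ c v, adj c (adj c v) = v
  adj_ne : ∀ c v, adj c v ≠ v

namespace ColoredGraph

variable {d : ℕ} (Γ : ColoredGraph d)

/-- Two vertices are equivalent if they lie in the same connected component of the subgraph
`Γ_C` formed by all vertices and the edges with colors in `C`. -/
def compSetoid (C : Set (Fin (d + 1))) : Setoid Γ.V :=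
  Relation.EqvGen.setoid (fun u v => ∃ c ∈ C, v = Γ.adj c u)

/-- The connected components of `Γ_C`. -/
abbrev Comp (C : Set (Fin (d + 1))) : Type := Quotient (Γ.compSetoid C)

/-- The component of `Γ_C` through the vertex `v`. -/
def comp (C : Set (Fin (d + 1))) (v : Γ.V) : Γ.Comp C := Quotient.mk (Γ.compSetoid C) v

/-- The length of the cycle with alternating colors `i`, `j` through `v` (its number of vertices,
which is its number of edges). -/
def cycleLength (i j : Fin (d + 1)) (v : Γ.V) : ℕ :=
  Nat.card {w : Γ.V // Γ.comp {i, j} w = Γ.comp {i, j} v}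

/-- The geometric carrier of `𝒦(Γ)`: one `d`-simplex with vertices labeled `0, …, d` for each
vertex of `Γ`; for every edge `uv` of color `c`, the faces of the simplices of `u` and `v`
opposite to the vertices labeled `c` are identified, respecting labels. -/
def Carrier : Type :=
  Quot (fun p q : (Σ _ : Γ.V, stdSimplex ℝ (Fin (d + 1))) =>
    q.2 = p.2 ∧ ∃ c, q.1 = Γ.adj c p.1 ∧ p.2.1 c = 0)

instance : TopologicalSpace Γ.Carrier :=
  inferInstanceAs (TopologicalSpace (Quot _))

/-- `Γ` is a gem of `M`. -/
def Represents (M : Type*) [TopologicalSpace M] : Prop := Nonempty (Γ.Carrier ≃ₜ M)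

/-! ### Regular genus -/

/-- `χ_ε(Γ)` for the cyclic permutation `ε = (ε₀, …, ε_d)` of the colors. The index `i + 1` is
cyclic, as addition in `Fin (d + 1)` is modulo `d + 1`. -/
def eulerChar (ε : Equiv.Perm (Fin (d + 1))) : ℚ :=
  ∑ i : Fin (d + 1), (Nat.card (Γ.Comp {ε i, ε (i + 1)}) : ℚ) + (1 - d) * (Nat.card Γ.V / 2)

/-- `ρ_ε(Γ) = 1 - χ_ε(Γ) / 2`. -/
def genusAt (ε : Equiv.Perm (Fin (d + 1))) : ℚ := 1 - Γ.eulerChar ε / 2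

/-- The regular genus `ρ(Γ)`, the minimum of the `ρ_ε(Γ)`. -/
def regularGenus : ℚ :=
  (Finset.univ : Finset (Equiv.Perm (Fin (d + 1)))).inf' Finset.univ_nonempty Γ.genusAt

/-- `Γ` is genus-minimal for the `d`-manifold `M`: it represents `M`, and `ρ(Γ)` is the regular
genus of `M`, the minimum of `ρ(Γ')` over all the regular `(d+1)`-colored graphs `Γ'` that
represent `M`. -/
def IsGenusMinimal (M : Type*) [TopologicalSpace M] : Prop :=
  Γ.Represents M ∧
    IsLeast {r : ℚ | ∃ Γ' : ColoredGraph d, Γ'.Represents M ∧ Γ'.regularGenus = r} Γ.regularGenus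

/-! ### Regular embeddings and semi-equivelar gems -/

/-- A regular embedding of `Γ` into a surface `S` with respect to the cyclic permutation `ε`:
the graph is drawn on `S` without crossings, and its regions are open discs, one for each `i` and
each cycle with alternating colors `ε i`, `ε (i + 1)`, bounded by that cycle. -/
structure RegularEmbedding (ε : Equiv.Perm (Fin (d + 1))) (S : Type*) [TopologicalSpace S] where
  /-- the positions of the vertices -/
  pt : Γ.V → S
  pt_injective : Function.Injective pt
  /-- `arc c v` is the edge of color `c` at `v`, run through from `v` to `adj c v` -/
  arc : Fin (d + 1) → Γ.V → C(unitInterval, S)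
  arc_zero : ∀ c v, arc c v 0 = pt v
  arc_symm : ∀ c v t, arc c (Γ.adj c v) t = arc c v (unitInterval.symm t)
  arc_injective : ∀ c v, Function.Injective (arc c v)
  /-- an interior point of an edge lies on no other edge (and so is no vertex) -/
  arc_disjoint : ∀ c v c' v' (t t' : unitInterval), t ≠ 0 → t ≠ 1 → arc c v t = arc c' v' t' →
    c' = c ∧ (v' = v ∨ v' = Γ.adj c v)
  /-- the closed faces -/
  disc : (i : Fin (d + 1)) → Γ.Comp {ε i, ε (i + 1)} → C(Metric.closedBall (0 : ℂ) 1, S)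
  disc_injective : ∀ i q, Function.Injective (disc i q)
  /-- the boundary of a face is its cycle -/
  disc_boundary : ∀ i q, disc i q '' {z | ‖(z : ℂ)‖ = 1} =
    ⋃ (v : Γ.V) (_ : Γ.comp {ε i, ε (i + 1)} v = q) (c : Fin (d + 1))
      (_ : c = ε i ∨ c = ε (i + 1)), Set.range (arc c v)
  /-- open faces do not meet the graph -/
  disc_interior : ∀ i q (z : Metric.closedBall (0 : ℂ) 1), ‖(z : ℂ)‖ < 1 →
    ∀ c v, disc i q z ∉ Set.range (arc c v)
  /-- distinct open faces are disjoint -/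
  disc_disjoint : ∀ i q i' q' (z z' : Metric.closedBall (0 : ℂ) 1), ‖(z : ℂ)‖ < 1 →
    ‖(z' : ℂ)‖ < 1 → disc i q z = disc i' q' z' →
    (⟨i, q⟩ : Σ i, Γ.Comp {ε i, ε (i + 1)}) = ⟨i', q'⟩
  /-- the faces cover the surface -/
  disc_cover : ∀ x : S, ∃ i q, x ∈ Set.range (disc i q)

/-- In a regular embedding with respect to `ε`, the face-cycle at `v` consists of the faces with
colors `ε i`, `ε (i + 1)` through `v`, in the cyclic order of the `i`. It has type `f` if these
faces are `f 0`-, …, `f d`-gons, up to the choice of the first face and of the direction. -/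
def FaceCycleHasType (ε : Equiv.Perm (Fin (d + 1))) (v : Γ.V) (f : Fin (d + 1) → ℕ) : Prop :=
  ∃ k : Fin (d + 1),
    (∀ i, Γ.cycleLength (ε i) (ε (i + 1)) v = f (k + i)) ∨
    (∀ i, Γ.cycleLength (ε i) (ε (i + 1)) v = f (k - i))

/-- `Γ` is an `f`-type semi-equivelar gem of `M`, embedded regularly on the surface `S`. -/
def IsSemiEquivelarGem (M S : Type*) [TopologicalSpace M] [TopologicalSpace S]
    (f : Fin (d + 1) → ℕ) : Prop :=
  Γ.Represents M ∧ IsClosedConnectedSurface S ∧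
    ∃ ε : Equiv.Perm (Fin (d + 1)), Nonempty (Γ.RegularEmbedding ε S) ∧
      ∀ v, Γ.FaceCycleHasType ε v f

end ColoredGraph

end

/-!
The theorem follows from two facts about regular 3-colored graphs.

*Every gem is genus-minimal.* For a graph with three colors, the number `χ_ε` is the number of
two-colored cycles minus half the number of vertices. It does not depend on `ε`, and it is a
topological invariant of the carrier: `euler_carrier` shows that it equals `2 b₀ - b₁`, where `b₀`
and `b₁` are the dimensions of the Alexander–Spanier cohomology with coefficients modulo two. The
proof computes the first cohomology from triples of functions on the vertices of the graph, the
primitives of a cocycle on the open stars of the three kinds of vertices of the complex, and counts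
dimensions; the functions that are constant on the edges of one color are their own orthogonal
complement, which takes the place of Poincaré duality. Hence `Represents.isGenusMinimal`.

*Every connected surface with a gem has a gem with only one cycle for each pair of colors.* If an
edge of color `c` joins distinct cycles of the other two colors, then it can be canceled: its ends
are deleted and the loose ends of equal colors are joined. The carrier does not change
(`nonempty_cancel_homeomorph`). Indeed, the triangles along a two-colored cycle form a disc, which
is mapped to a half disc such that the outer side of one triangle becomes the diameter. If this
triangle is left out, the rest of the disc still is a half disc, with the same arc. So the two discs
at the ends of the edge, glued along the diameter, are homeomorphic to what is left of them, glued
along the diameter. After finitely many cancellations all vertices are on one cycle for each pair of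
colors (`exists_isContracted`), and all faces are `n`-gons for the number `n` of vertices. As there
are three faces, `n = 6 - 2 χ`.

Every graph is regularly embedded in its carrier, as the dual graph of the triangulation, with the
dual cells of the vertices as its faces (`regularEmbedding`). So a contracted gem is semi-equivelar
of type `(n, n, n)`. If `n = 2`, then the graph of the cube is a gem of the same space, since it
contracts to the only graph with two vertices; its faces are quadrangles
(`exists_semiEquivelar`).

It remains to find a gem of each surface and to compute `χ`. A triangulated surface has the gem
whose vertices are the triangles of the barycentric subdivision (`flagGraph_represents`), so that
`χ` can be obtained by counting faces of the triangulation. Then `χ (A # B) = χ A + χ B - 2`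
(`IsConnectedSum.euler_eq`), where the connected sum need not be shown to be a surface in the sense
of circular links: it suffices that every edge is on two triangles and that the triangles around a
vertex are connected across edges. Explicit gems of the sphere (the cube), of the projective plane
(the quotient of the cube by the antipodal map) and of the torus (the barycentric subdivision of a
square) yield the values `χ = 0` for the torus and `χ = 1` for the projective plane.
-/

section

open Topology Set

/-! ### Alexander–Spanier cohomology with coefficients modulo two -/

namespace AlexanderSpanier

/-- `g` is a primitive of `f` near the diagonal: `f` is the coboundary of `g` there. -/
def IsPrimitive {K : Type*} [TopologicalSpace K] (f : K → K → ZMod 2) (g : K → ZMod 2) : Prop :=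
  ∀ x, ∃ U ∈ 𝓝 x, ∀ a ∈ U, ∀ b ∈ U, f a b = g a + g b

/-- The 1-cocycles: functions on `K × K`, not necessarily continuous, that satisfy the cocycle
identity near the diagonal. -/
def Z1 (K : Type*) [TopologicalSpace K] : Submodule (ZMod 2) (K → K → ZMod 2) where
  carrier := {f | ∀ x, ∃ U ∈ 𝓝 x, ∀ a ∈ U, ∀ b ∈ U, ∀ c ∈ U, f a b + f b c = f a c}
  zero_mem' := fun x => ⟨univ, Filter.univ_mem, by simp⟩
  add_mem' := by
    intro f f' hf hf' x
    obtain ⟨U, hU, h⟩ := hf x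
    obtain ⟨U', hU', h'⟩ := hf' x
    refine ⟨U ∩ U', Filter.inter_mem hU hU', fun a ha b hb c hc => ?_⟩
    simp only [Pi.add_apply]
    rw [← h a ha.1 b hb.1 c hc.1, ← h' a ha.2 b hb.2 c hc.2]
    ring
  smul_mem' := by
    intro r f hf x
    obtain ⟨U, hU, h⟩ := hf x
    refine ⟨U, hU, fun a ha b hb c hc => ?_⟩
    simp only [Pi.smul_apply, smul_eq_mul]
    rw [← h a ha b hb c hc]
    ring

/-- The 1-coboundaries: functions on `K × K` that have a primitive near the diagonal. -/
def B1 (K : Type*) [TopologicalSpace K] : Submodule (ZMod 2) (K → K → ZMod 2) where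
  carrier := {f | ∃ g, IsPrimitive f g}
  zero_mem' := ⟨0, fun x => ⟨univ, Filter.univ_mem, by simp⟩⟩
  add_mem' := by
    rintro f f' ⟨g, hg⟩ ⟨g', hg'⟩
    refine ⟨g + g', fun x => ?_⟩
    obtain ⟨U, hU, h⟩ := hg x
    obtain ⟨U', hU', h'⟩ := hg' x
    refine ⟨U ∩ U', Filter.inter_mem hU hU', fun a ha b hb => ?_⟩
    simp only [Pi.add_apply]
    rw [h a ha.1 b hb.1, h' a ha.2 b hb.2]
    ring
  smul_mem' := by
    rintro r f ⟨g, hg⟩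
    refine ⟨r • g, fun x => ?_⟩
    obtain ⟨U, hU, h⟩ := hg x
    refine ⟨U, hU, fun a ha b hb => ?_⟩
    simp only [Pi.smul_apply, smul_eq_mul]
    rw [h a ha b hb]
    ring

/-- The locally constant functions with values in `ZMod 2`. -/
def H0 (K : Type*) [TopologicalSpace K] : Submodule (ZMod 2) (K → ZMod 2) where
  carrier := {g | IsLocallyConstant g}
  zero_mem' := IsLocallyConstant.const 0
  add_mem' := fun hf hg => hf.add hg
  smul_mem' := fun r _ hf => hf.comp (fun y => r • y)

/-- The first Alexander–Spanier cohomology of `K` with coefficients in `ZMod 2`. -/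
abbrev H1 (K : Type*) [TopologicalSpace K] : Type _ := Z1 K ⧸ (B1 K).submoduleOf (Z1 K)

/-- For a closed surface this is its Euler characteristic: by Poincaré duality modulo two,
`b₂ = b₀`, so that `b₀ - b₁ + b₂ = 2 b₀ - b₁`. -/
noncomputable def euler (K : Type*) [TopologicalSpace K] : ℤ :=
  2 * (Module.finrank (ZMod 2) (H0 K) : ℤ) - Module.finrank (ZMod 2) (H1 K)

section
variable {K L D : Type*} [TopologicalSpace K] [TopologicalSpace L] [TopologicalSpace D]

theorem add_self_zmod (a : ZMod 2) : a + a = 0 := CharTwo.add_self_eq_zero a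

theorem diag_eq_zero {f : K → K → ZMod 2} (hf : f ∈ Z1 K) (x : K) : f x x = 0 := by
  obtain ⟨U, hU, h⟩ := hf x
  have hx := mem_of_mem_nhds hU
  simpa using h x hx x hx x hx

theorem pullback_mem_Z1 {f : L → L → ZMod 2} (hf : f ∈ Z1 L) {φ : K → L} (hφ : Continuous φ) :
    (fun a b => f (φ a) (φ b)) ∈ Z1 K := by
  intro x
  obtain ⟨U, hU, h⟩ := hf (φ x)
  exact ⟨φ ⁻¹' U, hφ.continuousAt hU, fun a ha b hb c hc => h _ ha _ hb _ hc⟩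

theorem IsPrimitive.pullback {f : L → L → ZMod 2} {g : L → ZMod 2} (h : IsPrimitive f g)
    {φ : K → L} (hφ : Continuous φ) : IsPrimitive (fun a b => f (φ a) (φ b)) (g ∘ φ) := by
  intro x
  obtain ⟨U, hU, h⟩ := h (φ x)
  exact ⟨φ ⁻¹' U, hφ.continuousAt hU, fun a ha b hb => h _ ha _ hb⟩

/-- A primitive on `D` that is constant on the fibers of a closed map `π : D → K` descends. -/
theorem IsPrimitive.descend {f : K → K → ZMod 2} (hf : f ∈ Z1 K) {π : D → K}
    (hc : IsClosedMap π) (hs : Function.Surjective π) {g : K → ZMod 2}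
    (h : IsPrimitive (fun a b => f (π a) (π b)) (g ∘ π)) : IsPrimitive f g := by
  intro x
  have key : ∀ᶠ y in 𝓝 x, ∀ d ∈ π ⁻¹' {y}, f (π d) x = g (π d) + g x := by
    refine hc.eventually_nhds_fiber (p := fun d => f (π d) x = g (π d) + g x) x ?_
    intro d hd
    obtain ⟨U, hU, h⟩ := h d
    filter_upwards [hU] with d' hd'
    have hdx : π d = x := hd
    simpa only [Function.comp_apply, hdx] using h d' hd' d (mem_of_mem_nhds hU)
  obtain ⟨U, hU, hcoc⟩ := hf x
  refine ⟨_, Filter.inter_mem hU key, fun a ha b hb => ?_⟩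
  obtain ⟨d, rfl⟩ := hs a
  obtain ⟨d', rfl⟩ := hs b
  have h1 := ha.2 d rfl
  have h2 := hb.2 d' rfl
  have h3 := hcoc _ ha.1 _ hb.1 x (mem_of_mem_nhds hU)
  rw [h1, h2] at h3
  linear_combination h3 - add_self_zmod (g (π d'))

/-- The map induced on cocycles by a continuous map. -/
def pullbackZ1 (φ : K → L) (hφ : Continuous φ) : Z1 L →ₗ[ZMod 2] Z1 K where
  toFun f := ⟨fun a b => f.1 (φ a) (φ b), pullback_mem_Z1 f.2 hφ⟩
  map_add' _ _ := rfl
  map_smul' _ _ := rfl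

/-- The map induced on cohomology by a continuous map. -/
def pullbackH1 (φ : K → L) (hφ : Continuous φ) : H1 L →ₗ[ZMod 2] H1 K :=
  Submodule.mapQ _ _ (pullbackZ1 φ hφ) (by
    rintro f ⟨g, hg⟩
    exact ⟨g ∘ φ, hg.pullback hφ⟩)

theorem euler_congr (e : K ≃ₜ L) : euler K = euler L := by
  have h1 : Module.finrank (ZMod 2) (H1 L) = Module.finrank (ZMod 2) (H1 K) := by
    refine LinearEquiv.finrank_eq (LinearEquiv.ofLinearMap (pullbackH1 e e.continuous)
      (pullbackH1 e.symm e.symm.continuous) ?_ ?_) <;>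
    · refine Submodule.linearMap_qext _ (LinearMap.ext fun f => ?_)
      refine congrArg (Submodule.Quotient.mk) (Subtype.ext (funext fun a => funext fun b => ?_))
      simp [pullbackZ1]
  have h0 : Module.finrank (ZMod 2) (H0 L) = Module.finrank (ZMod 2) (H0 K) := by
    refine LinearEquiv.finrank_eq
      { toFun := fun g => ⟨g.1 ∘ e, g.2.comp_continuous e.continuous⟩
        invFun := fun g => ⟨g.1 ∘ e.symm, g.2.comp_continuous e.symm.continuous⟩
        map_add' := fun _ _ => rfl
        map_smul' := fun _ _ => rfl
        left_inv := fun g => Subtype.ext (funext fun x => by simp)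
        right_inv := fun g => Subtype.ext (funext fun x => by simp) }
  rw [euler, euler, h0, h1]

end

/-- A compact convex set has no cohomology in degree one: a primitive is found by adding up the
values of the cocycle along a fine subdivision of the segments from a base point. -/
theorem exists_primitive_of_convex {E : Type*} [NormedAddCommGroup E] [NormedSpace ℝ E] {s : Set E}
    (hs : Convex ℝ s) (hk : IsCompact s) {f : s → s → ZMod 2} (hf : f ∈ Z1 s) :
    ∃ g, IsPrimitive f g := by
  rcases s.eq_empty_or_nonempty with rfl | ⟨x0, hx0⟩
  · exact ⟨0, fun x => x.2.elim⟩
  have : CompactSpace s := isCompact_iff_compactSpace.1 hk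
  choose U hU hUf using hf
  obtain ⟨δ, hδ, hleb⟩ := lebesgue_number_lemma_of_metric (s := (univ : Set s)) isCompact_univ
    (c := fun x => interior (U x)) (fun x => isOpen_interior)
    (fun x _ => mem_iUnion.2 ⟨x, mem_interior_iff_mem_nhds.2 (hU x)⟩)
  obtain ⟨C, hC⟩ := hk.isBounded.exists_norm_le
  -- segments from `x0` have length at most `2 * C`, so that `N` steps are shorter than `δ / 2`
  obtain ⟨N, hN⟩ := exists_nat_gt (2 * (2 * C) / δ)
  have hC0 : 0 ≤ C := (norm_nonneg _).trans (hC x0 hx0)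
  have hN0 : (0 : ℝ) < N := lt_of_le_of_lt (by positivity) hN
  have hpt : ∀ (x : s) (k : ℕ), x0 + (min 1 ((k : ℝ) / N)) • ((x : E) - x0) ∈ s := fun x k =>
    hs.add_smul_sub_mem hx0 x.2 ⟨le_min zero_le_one (by positivity), min_le_left _ _⟩
  -- the point after `k` of the `N` steps from `x0` to `x`
  let P : s → ℕ → s := fun x k => ⟨_, hpt x k⟩
  have hP0 : ∀ x, P x 0 = ⟨x0, hx0⟩ := fun x => Subtype.ext (by simp [P])
  have hPN : ∀ x, P x N = x := fun x => Subtype.ext (by simp [P, div_self hN0.ne'])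
  have hstep : ∀ x k, dist (P x k) (P x (k + 1)) < δ / 2 := by
    intro x k
    rw [Subtype.dist_eq, dist_eq_norm]
    have e : (x0 + (min 1 ((k : ℝ) / N)) • ((x : E) - x0)) -
        (x0 + (min 1 (((k + 1 : ℕ) : ℝ) / N)) • ((x : E) - x0)) =
        (min 1 ((k : ℝ) / N) - min 1 (((k + 1 : ℕ) : ℝ) / N)) • ((x : E) - x0) := by
      rw [sub_smul]; abel
    change ‖(x0 + (min 1 ((k : ℝ) / N)) • ((x : E) - x0)) -
        (x0 + (min 1 (((k + 1 : ℕ) : ℝ) / N)) • ((x : E) - x0))‖ < δ / 2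
    rw [e, norm_smul, Real.norm_eq_abs]
    have h1 : |min 1 ((k : ℝ) / N) - min 1 (((k + 1 : ℕ) : ℝ) / N)| ≤ 1 / N := by
      refine (abs_min_sub_min_le_max _ _ _ _).trans ?_
      rw [sub_self, abs_zero, Nat.cast_add, Nat.cast_one, ← sub_div, abs_div]
      simp
    have h2 : ‖(x : E) - x0‖ ≤ 2 * C := by
      refine (norm_sub_le _ _).trans ?_
      linarith [hC x x.2, hC x0 hx0]
    have h3 : |min 1 ((k : ℝ) / N) - min 1 (((k + 1 : ℕ) : ℝ) / N)| * ‖(x : E) - x0‖ ≤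
        1 / N * (2 * C) := mul_le_mul h1 h2 (norm_nonneg _) (by positivity)
    refine h3.trans_lt ?_
    rw [div_lt_iff₀ hδ] at hN
    rw [one_div, inv_mul_lt_iff₀ hN0]
    linarith
  have hclose : ∀ x y k, dist (P x k) (P y k) ≤ dist x y := by
    intro x y k
    rw [Subtype.dist_eq, dist_eq_norm, Subtype.dist_eq, dist_eq_norm]
    have e : (x0 + (min 1 ((k : ℝ) / N)) • ((x : E) - x0)) -
        (x0 + (min 1 ((k : ℝ) / N)) • ((y : E) - x0)) =
        (min 1 ((k : ℝ) / N)) • ((x : E) - y) := by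
      rw [smul_sub, smul_sub, smul_sub]; abel
    change ‖(x0 + (min 1 ((k : ℝ) / N)) • ((x : E) - x0)) -
        (x0 + (min 1 ((k : ℝ) / N)) • ((y : E) - x0))‖ ≤ _
    rw [e, norm_smul, Real.norm_eq_abs, abs_of_nonneg (le_min zero_le_one (by positivity))]
    exact mul_le_of_le_one_left (norm_nonneg _) (min_le_left _ _)
  have hcoc : ∀ p a b c : s, dist a p < δ → dist b p < δ → dist c p < δ →
      f a b + f b c = f a c := by
    intro p a b c ha hb hc
    obtain ⟨i, hi⟩ := hleb p (mem_univ _)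
    exact hUf i a (interior_subset (hi ha)) b (interior_subset (hi hb)) c (interior_subset (hi hc))
  refine ⟨fun x => ∑ k ∈ Finset.range N, f (P x (k + 1)) (P x k), fun z => ?_⟩
  refine ⟨Metric.ball z (δ / 4), Metric.ball_mem_nhds z (by positivity), fun x hx y hy => ?_⟩
  have hxy : dist x y < δ / 2 := by
    refine (dist_triangle_right x y z).trans_lt ?_
    rw [Metric.mem_ball] at hx hy
    linarith
  -- the cocycle identity on the narrow quadrangles between two neighboring segments
  have tele : ∀ n, (∑ k ∈ Finset.range n, f (P x (k + 1)) (P x k)) +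
      ∑ k ∈ Finset.range n, f (P y (k + 1)) (P y k) = f (P x n) (P y n) + f (P x 0) (P y 0) := by
    intro n
    induction n with
    | zero => simp [add_self_zmod]
    | succ n ih =>
      rw [Finset.sum_range_succ, Finset.sum_range_succ]
      have d1 := hstep x n
      have d2 := hstep y n
      have d3 := hclose x y n
      have d4 := hclose x y (n + 1)
      have p0 : dist (P x n) (P x n) < δ := by simpa using hδ
      have p1 : dist (P x (n + 1)) (P x n) < δ := by rw [dist_comm]; linarith
      have p2 : dist (P y n) (P x n) < δ := by rw [dist_comm]; linarith
      have p3 : dist (P y (n + 1)) (P x n) < δ :=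
        (dist_triangle _ (P y n) _).trans_lt (by
          rw [dist_comm, dist_comm (P y n) (P x n)]; linarith)
      have c1 := hcoc (P x n) _ _ _ p1 p3 p2
      have c2 := hcoc (P x n) _ _ _ p1 p0 p2
      linear_combination ih + c2 - c1 + add_self_zmod (f (P y (n + 1)) (P y n))
  have := tele N
  rw [hPN, hPN, hP0, hP0, diag_eq_zero (fun x => ⟨U x, hU x, hUf x⟩), add_zero] at this
  exact this.symm

end AlexanderSpanier

open AlexanderSpanier

/-! ### The carrier of a colored graph -/

namespace ColoredGraph

section
variable {d : ℕ} (Γ : ColoredGraph d)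

instance : Finite Γ.V := Γ.finite_V

theorem comp_adj {C : Set (Fin (d + 1))} {c : Fin (d + 1)} (hc : c ∈ C) (v : Γ.V) :
    Γ.comp C (Γ.adj c v) = Γ.comp C v :=
  (Quotient.sound (Relation.EqvGen.rel _ _ ⟨c, hc, rfl⟩)).symm

variable {Γ}

theorem eq_of_comp_eq {C : Set (Fin (d + 1))} {α : Sort*} (F : Γ.V → α)
    (hF : ∀ c ∈ C, ∀ v, F (Γ.adj c v) = F v) {u v : Γ.V} (h : Γ.comp C u = Γ.comp C v) :
    F u = F v := by
  have h' : Relation.EqvGen _ u v := Quotient.exact h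
  induction h' with
  | rel x y hxy =>
    obtain ⟨c, hc, rfl⟩ := hxy
    exact (hF c hc x).symm
  | refl => rfl
  | symm x y hxy ih => exact (ih (Quotient.sound hxy)).symm
  | trans x y z hxy hyz ih1 ih2 => exact (ih1 (Quotient.sound hxy)).trans (ih2 (Quotient.sound hyz))

theorem comp_mono {C C' : Set (Fin (d + 1))} (hC : C ⊆ C') {u v : Γ.V}
    (h : Γ.comp C u = Γ.comp C v) : Γ.comp C' u = Γ.comp C' v :=
  eq_of_comp_eq (Γ.comp C') (fun _ hc w => Γ.comp_adj (hC hc) w) h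

/-- The colors opposite to which the point `p` of the simplex lies. -/
def zeros (p : stdSimplex ℝ (Fin (d + 1))) : Set (Fin (d + 1)) := {c | p.1 c = 0}

variable (Γ) in
/-- The point with barycentric coordinates `p` in the simplex of `v`. -/
def point (v : Γ.V) (p : stdSimplex ℝ (Fin (d + 1))) : Γ.Carrier := Quot.mk _ ⟨v, p⟩

variable (Γ) in
/-- The quotient map onto the carrier. -/
def proj (x : Σ _ : Γ.V, stdSimplex ℝ (Fin (d + 1))) : Γ.Carrier := Quot.mk _ x

theorem point_surjective (x : Γ.Carrier) : ∃ v p, x = Γ.point v p := by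
  induction x using Quot.ind with
  | mk a => exact ⟨a.1, a.2, rfl⟩

theorem point_adj {c : Fin (d + 1)} {p : stdSimplex ℝ (Fin (d + 1))} (hp : p.1 c = 0) (v : Γ.V) :
    Γ.point (Γ.adj c v) p = Γ.point v p :=
  (Quot.sound ⟨rfl, c, rfl, hp⟩ : Quot.mk _ (⟨v, p⟩ : Σ _ : Γ.V, _) = Quot.mk _ _).symm

theorem point_eq_iff {u v : Γ.V} {p q : stdSimplex ℝ (Fin (d + 1))} :
    Γ.point u p = Γ.point v q ↔ p = q ∧ Γ.comp (zeros p) u = Γ.comp (zeros p) v := by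
  constructor
  · intro h
    let F : Γ.Carrier → Σ r : stdSimplex ℝ (Fin (d + 1)), Γ.Comp (zeros r) :=
      Quot.lift (fun x => ⟨x.2, Γ.comp (zeros x.2) x.1⟩) (by
        rintro ⟨u, p⟩ ⟨v, q⟩ ⟨h, c, hc, h0⟩
        dsimp only at h hc h0 ⊢
        subst h hc
        rw [Γ.comp_adj (show c ∈ zeros q from h0)])
    have := congrArg F h
    obtain ⟨h1, h2⟩ := Sigma.mk.inj_iff.1 this
    subst h1
    exact ⟨rfl, eq_of_heq h2⟩
  · rintro ⟨rfl, h⟩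
    exact eq_of_comp_eq (fun w => Γ.point w p) (fun c hc w => point_adj hc w) h

theorem continuous_point (v : Γ.V) : Continuous (Γ.point v) :=
  continuous_quot_mk.comp continuous_sigmaMk

/-- Functions on the carrier are given by compatible functions on the simplices. -/
def carrierLift {X : Type*} (f : Γ.V → stdSimplex ℝ (Fin (d + 1)) → X)
    (h : ∀ v c p, p.1 c = 0 → f (Γ.adj c v) p = f v p) : Γ.Carrier → X :=
  Quot.lift (fun x => f x.1 x.2) (by
    rintro ⟨u, p⟩ ⟨v, q⟩ ⟨h1, c, hc, h0⟩
    dsimp only at h1 hc h0 ⊢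
    subst h1 hc
    exact (h u c q h0).symm)

theorem continuous_carrierLift {X : Type*} [TopologicalSpace X]
    {f : Γ.V → stdSimplex ℝ (Fin (d + 1)) → X}
    (h : ∀ v c p, p.1 c = 0 → f (Γ.adj c v) p = f v p) (hf : ∀ v, Continuous (f v)) :
    Continuous (carrierLift f h) :=
  continuous_quot_lift _ (continuous_sigma hf)

instance : CompactSpace Γ.Carrier :=
  inferInstanceAs (CompactSpace (Quot _))

/-- For a set `C` of colors and a component `q` of `Γ_C`, the product of the coordinates outside
of `C` on the simplices of `q`, extended by zero. -/
noncomputable def bump (x : Σ C : Set (Fin (d + 1)), Γ.Comp C) (v : Γ.V)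
    (p : stdSimplex ℝ (Fin (d + 1))) : ℝ := by
  classical
  exact if Γ.comp x.1 v = x.2 then ∏ c with c ∉ x.1, p.1 c else 0

theorem bump_adj (x : Σ C : Set (Fin (d + 1)), Γ.Comp C) (v : Γ.V) (c : Fin (d + 1))
    (p : stdSimplex ℝ (Fin (d + 1))) (hp : p.1 c = 0) : bump x (Γ.adj c v) p = bump x v p := by
  classical
  by_cases hc : c ∈ x.1
  · rw [bump, bump, Γ.comp_adj hc]
  · have : ∏ c with c ∉ x.1, p.1 c = 0 := Finset.prod_eq_zero (i := c) (by simpa using hc) hp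
    simp [bump, this]

instance : T2Space Γ.Carrier := by
  classical
  let F : Γ.Carrier → (stdSimplex ℝ (Fin (d + 1))) × ((Σ C : Set (Fin (d + 1)), Γ.Comp C) → ℝ) :=
    carrierLift (fun v p => (p, fun x => bump x v p)) (fun v c p hp => by
      ext1
      · rfl
      · funext x; exact bump_adj x v c p hp)
  have hF : Continuous F := by
    refine continuous_carrierLift _ fun v => continuous_id.prodMk (continuous_pi fun x => ?_)
    unfold bump
    split_ifs
    · exact continuous_finsetProd _ fun c _ => (continuous_apply c).comp continuous_subtype_val
    · exact continuous_const
  refine T2Space.of_injective_continuous (f := F) (fun a b hab => ?_) hF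
  obtain ⟨u, p, rfl⟩ := point_surjective a
  obtain ⟨v, q, rfl⟩ := point_surjective b
  have h1 : p = q := congrArg Prod.fst hab
  subst h1
  refine point_eq_iff.2 ⟨rfl, ?_⟩
  have h2 : bump ⟨zeros p, Γ.comp (zeros p) u⟩ u p = bump ⟨zeros p, Γ.comp (zeros p) u⟩ v p :=
    congrFun (congrArg Prod.snd hab) _
  by_contra hne
  rw [bump, bump, if_pos rfl, if_neg (Ne.symm hne), Finset.prod_eq_zero_iff] at h2
  obtain ⟨_, hc, h0⟩ := h2
  exact (Finset.mem_filter.1 hc).2 h0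

theorem isClosedMap_proj : IsClosedMap Γ.proj :=
  Continuous.isClosedMap continuous_quot_mk

theorem proj_surjective : Function.Surjective Γ.proj := Quot.mk_surjective

/-- A Hausdorff space that is covered by images of the simplices of `Γ`, such that points of
distinct simplices have the same image exactly if they are identified in the carrier, is
homeomorphic to the carrier. -/
theorem nonempty_carrier_homeomorph {K : Type*} [TopologicalSpace K] [T2Space K]
    (κ : Γ.V → stdSimplex ℝ (Fin (d + 1)) → K) (hκ : ∀ v, Continuous (κ v))
    (hsurj : ∀ x, ∃ v p, κ v p = x) (hadj : ∀ v c p, p.1 c = 0 → κ (Γ.adj c v) p = κ v p)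
    (hinj : ∀ u v p q, κ u p = κ v q → p = q ∧ Γ.comp (zeros p) u = Γ.comp (zeros p) v) :
    Nonempty (Γ.Carrier ≃ₜ K) := by
  have hb : Function.Bijective (carrierLift κ hadj) := by
    constructor
    · intro a b hab
      obtain ⟨u, p, rfl⟩ := point_surjective a
      obtain ⟨v, q, rfl⟩ := point_surjective b
      exact point_eq_iff.2 (hinj u v p q hab)
    · intro x
      obtain ⟨v, p, h⟩ := hsurj x
      exact ⟨Γ.point v p, h⟩
  exact ⟨Continuous.homeoOfEquivCompactToT2 (f := Equiv.ofBijective _ hb)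
    (continuous_carrierLift hadj hκ)⟩

theorem nonempty_carrier_homeomorph_of_equiv {Γ' : ColoredGraph d} (e : Γ.V ≃ Γ'.V)
    (he : ∀ c v, e (Γ.adj c v) = Γ'.adj c (e v)) : Nonempty (Γ.Carrier ≃ₜ Γ'.Carrier) := by
  refine nonempty_carrier_homeomorph (fun v p => Γ'.point (e v) p) (fun v => continuous_point _)
    (fun x => ?_) (fun v c p hp => ?_) (fun u v p q h => ?_)
  · obtain ⟨v, p, rfl⟩ := point_surjective x
    exact ⟨e.symm v, p, by simp⟩
  · rw [he, point_adj hp]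
  · obtain ⟨h1, h2⟩ := point_eq_iff.1 h
    refine ⟨h1, ?_⟩
    have := eq_of_comp_eq (fun w => Γ.comp (zeros p) (e.symm w)) (fun c hc w => by
      have : e.symm (Γ'.adj c w) = Γ.adj c (e.symm w) := by
        rw [Equiv.symm_apply_eq, he, Equiv.apply_symm_apply]
      rw [this, Γ.comp_adj hc]) h2
    simpa using this

/-- The simplex of a graph vertex is connected, so the components of the graph are seen by the
locally constant functions on the carrier. -/
theorem comp_univ_eq [PreconnectedSpace Γ.Carrier] (u v : Γ.V) :
    Γ.comp univ u = Γ.comp univ v := by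
  have hc : IsLocallyConstant (carrierLift (fun w (_ : stdSimplex ℝ (Fin (d + 1))) =>
      Γ.comp univ w) (fun w c p _ => Γ.comp_adj (mem_univ c) w)) := by
    intro s
    refine isOpen_coinduced.2 (isOpen_sigma_iff.2 fun w => ?_)
    by_cases hw : Γ.comp univ w ∈ s
    · convert isOpen_univ
      exact eq_univ_of_forall fun _ => hw
    · convert isOpen_empty
      exact eq_empty_of_forall_notMem fun _ => hw
  let p : stdSimplex ℝ (Fin (d + 1)) := ⟨_, single_mem_stdSimplex ℝ 0⟩
  exact hc.apply_eq_of_isPreconnected isPreconnected_univ (mem_univ (Γ.point u p))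
    (mem_univ (Γ.point v p))

end

end ColoredGraph

/-! ### Linear algebra of the coboundary maps of a colored graph -/

namespace ColoredGraph

variable (Γ : ColoredGraph 2)

noncomputable instance : Fintype Γ.V := Fintype.ofFinite Γ.V

/-- The functions on the vertices that are constant on the components of `Γ_C`. -/
def inv (C : Set (Fin 3)) : Submodule (ZMod 2) (Γ.V → ZMod 2) where
  carrier := {g | ∀ c ∈ C, ∀ v, g (Γ.adj c v) = g v}
  zero_mem' := fun _ _ _ => rfl
  add_mem' := fun {a b} ha hb c hc v => by simp [ha c hc v, hb c hc v]
  smul_mem' := fun r a ha c hc v => by simp [ha c hc v]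

variable {Γ}

theorem eq_of_mem_inv {C : Set (Fin 3)} {g : Γ.V → ZMod 2} (hg : g ∈ Γ.inv C) {u v : Γ.V}
    (h : Γ.comp C u = Γ.comp C v) : g u = g v := eq_of_comp_eq g hg h

variable (Γ)

theorem finrank_inv (C : Set (Fin 3)) :
    Module.finrank (ZMod 2) (Γ.inv C) = Nat.card (Γ.Comp C) := by
  classical
  have := Fintype.ofFinite (Γ.Comp C)
  let e : (Γ.Comp C → ZMod 2) ≃ₗ[ZMod 2] Γ.inv C :=
    { toFun := fun g => ⟨fun v => g (Γ.comp C v), fun c hc v => congrArg g (Γ.comp_adj hc v)⟩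
      invFun := fun g => Quotient.lift g.1 (fun u v h => eq_of_mem_inv g.2 (Quotient.sound h))
      map_add' := fun _ _ => rfl
      map_smul' := fun _ _ => rfl
      left_inv := fun g => funext fun q => by
        induction q using Quotient.ind
        rfl
      right_inv := fun g => rfl }
  rw [← e.finrank_eq, Module.finrank_fintype_fun_eq_card, Nat.card_eq_fintype_card]

theorem finrank_fun : Module.finrank (ZMod 2) (Γ.V → ZMod 2) = Nat.card Γ.V := by
  rw [Module.finrank_fintype_fun_eq_card, Nat.card_eq_fintype_card]

/-- The orthogonal complement with respect to the standard bilinear form. -/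
noncomputable def perp (W : Submodule (ZMod 2) (Γ.V → ZMod 2)) :
    Submodule (ZMod 2) (Γ.V → ZMod 2) :=
  LinearMap.BilinForm.orthogonal (dotProductBilin (ZMod 2) (ZMod 2)) W

theorem finrank_add_finrank_perp (W : Submodule (ZMod 2) (Γ.V → ZMod 2)) :
    Module.finrank (ZMod 2) W + Module.finrank (ZMod 2) (Γ.perp W) = Nat.card Γ.V := by
  classical
  have hB : LinearMap.BilinForm.Nondegenerate
      (dotProductBilin (m := Γ.V) (ZMod 2) (ZMod 2) : LinearMap.BilinForm (ZMod 2) _) := by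
    constructor
    · intro x hx
      funext v
      simpa [dotProductBilin] using hx (Pi.single v 1)
    · intro x hx
      funext v
      simpa [dotProductBilin] using hx (Pi.single v 1)
  rw [perp, LinearMap.BilinForm.finrank_orthogonal hB, ← finrank_fun]
  have := Submodule.finrank_le W
  omega

/-- The functions on the edges of one color form their own orthogonal complement. -/
theorem perp_inv_singleton (c : Fin 3) : Γ.perp (Γ.inv {c}) = Γ.inv {c} := by
  classical
  ext φ
  constructor
  · intro h c' hc v
    obtain rfl : c' = c := hc
    -- orthogonality to the indicator function of an edge
    have := h (Pi.single v 1 + Pi.single (Γ.adj c' v) 1) (by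
      intro c'' hc w
      obtain rfl : c'' = c' := hc
      simp only [Pi.add_apply, Pi.single_apply]
      rw [add_comm]
      congr 1
      · have : Γ.adj c'' w = Γ.adj c'' v ↔ w = v :=
          ⟨fun h => by rw [← Γ.adj_adj c'' w, h, Γ.adj_adj], fun h => h ▸ rfl⟩
        simp [this]
      · have : Γ.adj c'' w = v ↔ w = Γ.adj c'' v :=
          ⟨fun h => by rw [← h, Γ.adj_adj], fun h => by rw [h, Γ.adj_adj]⟩
        simp [this])
    change (Pi.single v 1 + Pi.single (Γ.adj c' v) 1) ⬝ᵥ φ = 0 at this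
    simp only [add_dotProduct, single_dotProduct, one_mul] at this
    exact (CharTwo.add_eq_zero.1 this).symm
  · intro h w hw
    change ∑ v, w v * φ v = 0
    -- modulo two, the equal terms at the two ends of an edge cancel
    refine Finset.sum_involution (fun v _ => Γ.adj c v) (fun v _ => ?_) (fun v _ _ => Γ.adj_ne c v)
      (fun _ _ => Finset.mem_univ _) (fun v _ => Γ.adj_adj c v)
    rw [h c rfl, hw c rfl, CharTwo.add_self_eq_zero]

theorem two_mul_finrank_inv_singleton (c : Fin 3) :
    2 * Module.finrank (ZMod 2) (Γ.inv {c}) = Nat.card Γ.V := by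
  have := Γ.finrank_add_finrank_perp (Γ.inv {c})
  rw [perp_inv_singleton] at this
  omega

/-- The sum of functions on the edges of the three colors. -/
def edgeSum : (∀ c : Fin 3, Γ.inv {c}) →ₗ[ZMod 2] (Γ.V → ZMod 2) :=
  ∑ c, (Γ.inv {c}).subtype ∘ₗ LinearMap.proj c

theorem edgeSum_apply (a : ∀ c : Fin 3, Γ.inv {c}) (v : Γ.V) :
    Γ.edgeSum a v = ∑ c, (a c).1 v := by
  simp [edgeSum]

/-- A function orthogonal to all sums of functions on edges is invariant under all colors, as each
space of functions on the edges of one color is its own orthogonal complement. -/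
theorem perp_range_edgeSum : Γ.perp (LinearMap.range Γ.edgeSum) = Γ.inv univ := by
  classical
  ext φ
  constructor
  · intro h c _ v
    have h' : φ ∈ Γ.perp (Γ.inv {c}) := by
      intro w hw
      refine h w ⟨Pi.single c ⟨w, hw⟩, ?_⟩
      funext v
      rw [edgeSum_apply, Finset.sum_eq_single c]
      · simp
      · intro b _ hb
        simp [Pi.single_eq_of_ne hb]
      · simp
    rw [perp_inv_singleton] at h'
    exact h' c rfl v
  · rintro h _ ⟨a, rfl⟩
    change Γ.edgeSum a ⬝ᵥ φ = 0
    simp only [edgeSum, LinearMap.sum_apply, sum_dotProduct]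
    refine Finset.sum_eq_zero fun c _ => ?_
    have : φ ∈ Γ.perp (Γ.inv {c}) := by
      rw [perp_inv_singleton]
      exact fun c _ v => h c trivial v
    exact this _ (a c).2

/-- Triples of functions on the vertices, thought of as primitives of a cocycle on the stars of
the vertices of the three colors: across an edge, those of the two stars that contain it agree. -/
def cochain : Submodule (ZMod 2) (Fin 3 → Γ.V → ZMod 2) where
  carrier := {g | ∀ c k k', k ≠ c → k' ≠ c → ∀ v,
    g k v + g k (Γ.adj c v) = g k' v + g k' (Γ.adj c v)}
  zero_mem' := fun _ _ _ _ _ _ => rfl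
  add_mem' := fun {a b} ha hb c k k' hk hk' v => by
    simp only [Pi.add_apply]
    linear_combination ha c k k' hk hk' v + hb c k k' hk hk' v
  smul_mem' := fun r a ha c k k' hk hk' v => by
    simp only [Pi.smul_apply, smul_eq_mul]
    linear_combination r * ha c k k' hk hk' v

/-- The sum of functions on the edges, as a map that ignores a function on the vertices. -/
def edgeSum' : ((Γ.V → ZMod 2) × (∀ c : Fin 3, Γ.inv {c})) →ₗ[ZMod 2] (Γ.V → ZMod 2) :=
  Γ.edgeSum ∘ₗ LinearMap.snd _ _ _

/-- The differences of the functions of a triple are functions on the edges whose sum vanishes, so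
that `Γ.cochain` is the kernel of `Γ.edgeSum'`. The two sides are kept free of subtraction. -/
theorem finrank_cochain :
    Module.finrank (ZMod 2) Γ.cochain + Nat.card Γ.V =
      Nat.card Γ.V + ∑ c : Fin 3, Module.finrank (ZMod 2) (Γ.inv {c}) +
        Module.finrank (ZMod 2) (Γ.inv univ) := by
  have char2 : ∀ a : ZMod 2, a + a = 0 := CharTwo.add_self_eq_zero
  let e : Γ.cochain ≃ₗ[ZMod 2] LinearMap.ker Γ.edgeSum' :=
    { toFun := fun g => ⟨(g.1 0, fun c => ⟨g.1 (c + 1) + g.1 (c + 2), by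
          rintro c' hc v
          obtain rfl : c' = c := hc
          simp only [Pi.add_apply]
          linear_combination g.2 c' (c' + 1) (c' + 2) (by fin_cases c' <;> decide)
            (by fin_cases c' <;> decide) v + char2 (g.1 (c' + 2) (Γ.adj c' v))
            - char2 (g.1 (c' + 1) v)⟩), by
          rw [LinearMap.mem_ker]
          funext v
          simp only [edgeSum', LinearMap.comp_apply, LinearMap.snd_apply, edgeSum_apply,
            Fin.sum_univ_three, Pi.add_apply, Pi.zero_apply]
          change g.1 1 v + g.1 2 v + (g.1 2 v + g.1 0 v) + (g.1 0 v + g.1 1 v) = 0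
          linear_combination char2 (g.1 0 v) + char2 (g.1 1 v) + char2 (g.1 2 v)⟩
      invFun := fun x => ⟨![x.1.1, x.1.1 + (x.1.2 2).1, x.1.1 + (x.1.2 1).1], by
        have h0 : ∀ v, (x.1.2 0).1 v + (x.1.2 1).1 v + (x.1.2 2).1 v = 0 := fun v => by
          have := congrFun (LinearMap.mem_ker.1 x.2) v
          simpa [edgeSum', edgeSum_apply, Fin.sum_univ_three] using this
        have hi : ∀ c v, (x.1.2 c).1 (Γ.adj c v) = (x.1.2 c).1 v := fun c v => (x.1.2 c).2 c rfl v
        intro c k k' hk hk' v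
        have a0 := h0 v
        have a1 := h0 (Γ.adj c v)
        have a2 := hi c v
        have := fun c v => char2 ((x.1.2 c).1 v)
        fin_cases c <;> fin_cases k <;> fin_cases k' <;>
          simp at hk hk' a1 a2 ⊢
        · linear_combination a0 + a1 - this 0 v - this 1 v - this 1 (Γ.adj 0 v) - a2
        · linear_combination a0 + a1 - this 0 v - this 2 v - this 2 (Γ.adj 0 v) - a2
        · linear_combination -a2 - this 1 v
        · linear_combination a2 + this 1 v
        · linear_combination -a2 - this 2 v
        · linear_combination a2 + this 2 v⟩
      map_add' := fun a b => by
        refine Subtype.ext (Prod.ext rfl (funext fun c => Subtype.ext (funext fun v => ?_)))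
        simp only [Submodule.coe_add, Pi.add_apply, Prod.snd_add]
        ring
      map_smul' := fun r a => by
        refine Subtype.ext (Prod.ext rfl (funext fun c => Subtype.ext (funext fun v => ?_)))
        simp only [Submodule.coe_smul, Pi.add_apply, Pi.smul_apply, Prod.smul_snd, smul_eq_mul,
          RingHom.id_apply]
        ring
      left_inv := fun g => by
        refine Subtype.ext (funext fun k => funext fun v => ?_)
        fin_cases k
        · rfl
        · change g.1 0 v + (g.1 0 v + g.1 1 v) = g.1 1 v
          linear_combination char2 (g.1 0 v)
        · change g.1 0 v + (g.1 2 v + g.1 0 v) = g.1 2 v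
          linear_combination char2 (g.1 0 v)
      right_inv := fun x => by
        have h0 : ∀ v, (x.1.2 0).1 v + (x.1.2 1).1 v + (x.1.2 2).1 v = 0 := fun v => by
          have := congrFun (LinearMap.mem_ker.1 x.2) v
          simpa [edgeSum', edgeSum_apply, Fin.sum_univ_three] using this
        refine Subtype.ext (Prod.ext rfl (funext fun c => Subtype.ext (funext fun v => ?_)))
        fin_cases c
        · change x.1.1 v + (x.1.2 2).1 v + (x.1.1 v + (x.1.2 1).1 v) = (x.1.2 0).1 v
          linear_combination h0 v + char2 (x.1.1 v) - char2 ((x.1.2 0).1 v)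
        · change x.1.1 v + (x.1.2 1).1 v + x.1.1 v = (x.1.2 1).1 v
          linear_combination char2 (x.1.1 v)
        · change x.1.1 v + (x.1.1 v + (x.1.2 2).1 v) = (x.1.2 2).1 v
          linear_combination char2 (x.1.1 v) }
  have h1 := LinearMap.finrank_range_add_finrank_ker Γ.edgeSum'
  have h2 : LinearMap.range Γ.edgeSum' = LinearMap.range Γ.edgeSum := by
    rw [edgeSum', LinearMap.range_comp, LinearMap.range_eq_top.2 LinearMap.snd_surjective,
      Submodule.map_top]
  have h3 := Γ.finrank_add_finrank_perp (LinearMap.range Γ.edgeSum)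
  rw [perp_range_edgeSum] at h3
  rw [h2, ← e.finrank_eq, Module.finrank_prod, finrank_fun, Module.finrank_pi_fintype] at h1
  omega

/-- The triples of functions that are, up to a common function, constant on the stars. -/
def cobound : ((Γ.V → ZMod 2) × (∀ k : Fin 3, Γ.inv {k}ᶜ)) →ₗ[ZMod 2]
    (Fin 3 → Γ.V → ZMod 2) where
  toFun x k := x.1 + (x.2 k).1
  map_add' x y := by funext k v; simp; ring
  map_smul' r x := by funext k v; simp [mul_add]

theorem range_cobound_le : LinearMap.range Γ.cobound ≤ Γ.cochain := by
  rintro _ ⟨x, rfl⟩ c k k' hk hk' v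
  have h1 := (x.2 k).2 c hk.symm v
  have h2 := (x.2 k').2 c hk'.symm v
  simp only [cobound, LinearMap.coe_mk, AddHom.coe_mk, Pi.add_apply]
  rw [h1, h2]
  linear_combination CharTwo.add_self_eq_zero ((x.2 k).1 v) -
    CharTwo.add_self_eq_zero ((x.2 k').1 v)

/-- The kernel of `Γ.cobound` consists of the functions invariant under all colors. -/
theorem finrank_range_cobound :
    Module.finrank (ZMod 2) (LinearMap.range Γ.cobound) + Module.finrank (ZMod 2) (Γ.inv univ) =
      Nat.card Γ.V + ∑ k : Fin 3, Nat.card (Γ.Comp {k}ᶜ) := by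
  let e : Γ.inv univ ≃ₗ[ZMod 2] LinearMap.ker Γ.cobound :=
    { toFun := fun g => ⟨(g.1, fun k => ⟨g.1, fun c _ v => g.2 c trivial v⟩), by
        rw [LinearMap.mem_ker]
        funext k v
        exact CharTwo.add_self_eq_zero (g.1 v)⟩
      invFun := fun x => ⟨x.1.1, by
        have h : ∀ k v, x.1.1 v = (x.1.2 k).1 v := fun k v =>
          CharTwo.add_eq_zero.1 (congrFun (congrFun (LinearMap.mem_ker.1 x.2) k) v)
        intro c _ v
        rw [h (c + 1), h (c + 1)]
        exact (x.1.2 (c + 1)).2 c (by fin_cases c <;> decide) v⟩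
      map_add' := fun _ _ => rfl
      map_smul' := fun _ _ => rfl
      left_inv := fun _ => rfl
      right_inv := fun x => by
        refine Subtype.ext (Prod.ext rfl (funext fun k => Subtype.ext (funext fun v => ?_)))
        exact CharTwo.add_eq_zero.1 (congrFun (congrFun (LinearMap.mem_ker.1 x.2) k) v) }
  have h1 := LinearMap.finrank_range_add_finrank_ker Γ.cobound
  rw [← e.finrank_eq, Module.finrank_prod, finrank_fun, Module.finrank_pi_fintype] at h1
  simp only [finrank_inv _ ({_}ᶜ)] at h1
  exact h1

end ColoredGraph

/-! ### The Euler characteristic of a colored graph is an invariant of its carrier -/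

namespace ColoredGraph

variable {Γ : ColoredGraph 2}

/-- The barycentric coordinates of a point of the carrier. -/
def bary : Γ.Carrier → stdSimplex ℝ (Fin 3) := carrierLift (fun _ p => p) (fun _ _ _ _ => rfl)

theorem continuous_bary : Continuous (bary (Γ := Γ)) :=
  continuous_carrierLift _ fun _ => continuous_id

theorem exists_rep (x : Γ.Carrier) : ∃ v, x = Γ.point v (bary x) := by
  obtain ⟨v, p, rfl⟩ := point_surjective x
  exact ⟨v, rfl⟩

/-- A graph vertex whose simplex contains the given point. -/
noncomputable def rep (x : Γ.Carrier) : Γ.V := (exists_rep x).choose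

theorem point_rep (x : Γ.Carrier) : Γ.point (rep x) (bary x) = x := (exists_rep x).choose_spec.symm

theorem comp_rep (v : Γ.V) (p : stdSimplex ℝ (Fin 3)) :
    Γ.comp (zeros p) (rep (Γ.point v p)) = Γ.comp (zeros p) v := by
  have := point_rep (Γ.point v p)
  exact (point_eq_iff.1 this).2

theorem exists_third_le (p : stdSimplex ℝ (Fin 3)) : ∃ k, 1 / 3 ≤ p.1 k := by
  by_contra! h
  have := p.2.2
  rw [Fin.sum_univ_three] at this
  linarith [h 0, h 1, h 2]

/-- A color whose barycentric coordinate is at least `1 / 3`. -/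
noncomputable def big (p : stdSimplex ℝ (Fin 3)) : Fin 3 := (exists_third_le p).choose

theorem third_le_big (p : stdSimplex ℝ (Fin 3)) : 1 / 3 ≤ p.1 (big p) :=
  (exists_third_le p).choose_spec

theorem big_notMem_zeros (p : stdSimplex ℝ (Fin 3)) : big p ∉ zeros p := fun h => by
  have h1 := third_le_big p
  rw [show p.1 (big p) = 0 from h] at h1
  norm_num at h1

/-- Near `z`, the coordinates that vanish at `z` stay below `1 / 3`. -/
theorem eventually_big (z : Γ.Carrier) : ∀ᶠ x in 𝓝 z, big (bary x) ∉ zeros (bary z) := by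
  have : ∀ k, ∀ᶠ x in 𝓝 z, k ∈ zeros (bary z) → (bary x).1 k < 1 / 3 := by
    intro k
    by_cases hk : k ∈ zeros (bary z)
    · have hc : Continuous fun x : Γ.Carrier => (bary x).1 k :=
        (continuous_apply k).comp (continuous_subtype_val.comp continuous_bary)
      filter_upwards [hc.continuousAt.eventually_lt continuousAt_const
        (show (bary z).1 k < 1 / 3 by rw [show (bary z).1 k = 0 from hk]; norm_num)] with x hx _
        using hx
    · exact Filter.Eventually.of_forall fun x h => absurd h hk
  filter_upwards [Filter.eventually_all.2 this] with x hx h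
  exact absurd (third_le_big (bary x)) (not_le.2 (hx _ h))

/-- Near `z`, all points lie in simplices that meet at `z`. -/
theorem eventually_comp_rep (z : Γ.Carrier) :
    ∀ᶠ x in 𝓝 z, Γ.comp (zeros (bary z)) (rep x) = Γ.comp (zeros (bary z)) (rep z) := by
  have := (isClosedMap_proj (Γ := Γ)).eventually_nhds_fiber
    (p := fun y => Γ.comp (zeros (bary z)) y.1 = Γ.comp (zeros (bary z)) (rep z)) z (by
      rintro ⟨w, p⟩ hw
      obtain rfl : Γ.point w p = z := hw
      have : ∀ᶠ y : (Σ _ : Γ.V, stdSimplex ℝ (Fin 3)) in 𝓝 ⟨w, p⟩, y.1 = w := by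
        have : range (fun q => (⟨w, q⟩ : Σ _ : Γ.V, stdSimplex ℝ (Fin 3))) ∈
            𝓝 (⟨w, p⟩ : Σ _ : Γ.V, stdSimplex ℝ (Fin 3)) :=
          isOpen_range_sigmaMk.mem_nhds ⟨p, rfl⟩
        filter_upwards [this] with y hy
        obtain ⟨q, rfl⟩ := hy
        rfl
      filter_upwards [this] with y hy
      rw [hy]
      exact (comp_rep w p).symm)
  filter_upwards [this] with x hx
  exact hx ⟨rep x, bary x⟩ (point_rep x)

/-- If `u` and `v` are joined by colors different from `k` and `k'`, then the two primitives on the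
stars of colors `k` and `k'` differ by the same amount. -/
theorem cochain_congr {g : Fin 3 → Γ.V → ZMod 2} (hg : g ∈ Γ.cochain) {Z : Set (Fin 3)}
    {k k' : Fin 3} (hk : k ∉ Z) (hk' : k' ∉ Z) {u v : Γ.V} (h : Γ.comp Z u = Γ.comp Z v) :
    g k u + g k v = g k' u + g k' v := by
  have := eq_of_comp_eq (fun w => g k w + g k' w) (fun c hc w => by
    have := hg c k k' (fun e => hk (e ▸ hc)) (fun e => hk' (e ▸ hc)) w
    linear_combination this - CharTwo.add_self_eq_zero (g k w) +
      CharTwo.add_self_eq_zero (g k' (Γ.adj c w))) h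
  linear_combination this - CharTwo.add_self_eq_zero (g k' u) + CharTwo.add_self_eq_zero (g k v)

/-- The function on pairs of points that a triple of primitives on stars defines: the points are
compared in a star that contains the first of them. -/
noncomputable def cocycleFun (g : Fin 3 → Γ.V → ZMod 2) (x y : Γ.Carrier) : ZMod 2 :=
  g (big (bary x)) (rep x) + g (big (bary x)) (rep y)

/-- Near a point of the open star of color `k`, the cocycle is the coboundary of the primitive on
that star. -/
theorem cocycleFun_local {g : Fin 3 → Γ.V → ZMod 2} (hg : g ∈ Γ.cochain) (z : Γ.Carrier)
    {k : Fin 3} (hk : k ∉ zeros (bary z)) :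
    ∃ U ∈ 𝓝 z, ∀ x ∈ U, ∀ y ∈ U, cocycleFun g x y = g k (rep x) + g k (rep y) := by
  refine ⟨_, Filter.inter_mem (eventually_big z) (eventually_comp_rep z), fun x hx y hy => ?_⟩
  exact cochain_congr hg hx.1 hk (hx.2.trans hy.2.symm)

theorem cocycleFun_mem {g : Fin 3 → Γ.V → ZMod 2} (hg : g ∈ Γ.cochain) :
    cocycleFun g ∈ Z1 Γ.Carrier := by
  intro z
  obtain ⟨U, hU, h⟩ := cocycleFun_local hg z (big_notMem_zeros _)
  refine ⟨U, hU, fun a ha b hb c hc => ?_⟩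
  rw [h a ha b hb, h b hb c hc, h a ha c hc]
  linear_combination CharTwo.add_self_eq_zero (g (big (bary z)) (rep b))

variable (Γ) in
/-- The map from triples of primitives on stars to the cohomology of the carrier. -/
noncomputable def cochainToH1 : Γ.cochain →ₗ[ZMod 2] H1 Γ.Carrier :=
  ((B1 Γ.Carrier).submoduleOf (Z1 Γ.Carrier)).mkQ ∘ₗ
    { toFun := fun g => ⟨cocycleFun g.1, cocycleFun_mem g.2⟩
      map_add' := fun g g' => Subtype.ext (funext fun x => funext fun y => by
        simp only [cocycleFun, Submodule.coe_add, Pi.add_apply]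
        ring)
      map_smul' := fun r g => Subtype.ext (funext fun x => funext fun y => by
        simp only [cocycleFun, Submodule.coe_smul, Pi.smul_apply, smul_eq_mul, RingHom.id_apply]
        ring) }

theorem cochainToH1_eq_zero_iff (g : Γ.cochain) :
    Γ.cochainToH1 g = 0 ↔ cocycleFun g.1 ∈ B1 Γ.Carrier :=
  Submodule.Quotient.mk_eq_zero _

theorem cocycleFun_mem_B1 {g : Fin 3 → Γ.V → ZMod 2} (hg : g ∈ LinearMap.range Γ.cobound) :
    cocycleFun g ∈ B1 Γ.Carrier := by
  have hg' := Γ.range_cobound_le hg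
  obtain ⟨x, rfl⟩ := hg
  refine ⟨fun y => x.1 (rep y), fun z => ?_⟩
  have hk := big_notMem_zeros (bary z)
  set k := big (bary z)
  obtain ⟨U, hU, h⟩ := cocycleFun_local hg' z hk
  refine ⟨_, Filter.inter_mem hU (eventually_comp_rep z), fun a ha b hb => ?_⟩
  rw [h a ha.1 b hb.1]
  have : (x.2 k).1 (rep a) = (x.2 k).1 (rep b) := by
    have hsub : zeros (bary z) ⊆ {k}ᶜ := fun c hc hck => hk ((show c = k from hck) ▸ hc)
    exact eq_of_mem_inv (x.2 k).2 (comp_mono hsub (ha.2.trans hb.2.symm))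
  simp only [cobound, LinearMap.coe_mk, AddHom.coe_mk, Pi.add_apply]
  rw [this]
  linear_combination CharTwo.add_self_eq_zero ((x.2 k).1 (rep b))

/-- The vertex of the standard simplex labeled `k`. -/
def corner (k : Fin 3) : stdSimplex ℝ (Fin 3) := ⟨Pi.single k 1, single_mem_stdSimplex ℝ k⟩

theorem corner_apply_of_ne {k c : Fin 3} (h : c ≠ k) : (corner k).1 c = 0 :=
  Pi.single_eq_of_ne h _

theorem notMem_zeros_corner (k : Fin 3) : k ∉ zeros (corner k) := fun h => by
  have : (corner k).1 k = 1 := Pi.single_eq_same k 1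
  rw [show (corner k).1 k = 0 from h] at this
  exact zero_ne_one this

instance : ConnectedSpace (stdSimplex ℝ (Fin 3)) :=
  isConnected_iff_connectedSpace.1
    ⟨⟨_, single_mem_stdSimplex ℝ 0⟩, (convex_stdSimplex ℝ (Fin 3)).isPreconnected⟩

/-- If the cocycle of a triple of primitives on stars has a global primitive `G`, then the triple
is, up to a common function, constant on the stars. -/
theorem mem_range_cobound {g : Fin 3 → Γ.V → ZMod 2} (hg : g ∈ Γ.cochain)
    (hB : cocycleFun g ∈ B1 Γ.Carrier) : g ∈ LinearMap.range Γ.cobound := by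
  obtain ⟨G, hG⟩ := hB
  have char2 : ∀ a : ZMod 2, a + a = 0 := CharTwo.add_self_eq_zero
  -- the difference between the primitive `G` and the one that `g` suggests on the simplex of `w`
  let D : Γ.V → stdSimplex ℝ (Fin 3) → ZMod 2 := fun w p =>
    G (Γ.point w p) + (g (big p) (rep (Γ.point w p)) + g (big p) w)
  have hD : ∀ w p k, k ∉ zeros p →
      D w p = G (Γ.point w p) + (g k (rep (Γ.point w p)) + g k w) := fun w p k hk => by
    rw [← cochain_congr hg (big_notMem_zeros p) hk (comp_rep w p)]
  have hloc : ∀ w, IsLocallyConstant (D w) := by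
    intro w
    rw [IsLocallyConstant.iff_eventually_eq]
    intro p
    obtain ⟨U, hU, h⟩ := cocycleFun_local hg (Γ.point w p) (big_notMem_zeros p)
    obtain ⟨U', hU', h'⟩ := hG (Γ.point w p)
    have hz : ∀ᶠ q : stdSimplex ℝ (Fin 3) in 𝓝 p, big p ∉ zeros q := by
      have hc : Continuous fun q : stdSimplex ℝ (Fin 3) => q.1 (big p) :=
        (continuous_apply _).comp continuous_subtype_val
      exact hc.continuousAt.eventually_ne (big_notMem_zeros p)
    filter_upwards [hz, (continuous_point w).continuousAt hU,
      (continuous_point w).continuousAt hU'] with q hq hqU hqU'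
    rw [hD w q _ hq, hD w p _ (big_notMem_zeros p)]
    have e1 := h _ hqU _ (mem_of_mem_nhds hU)
    have e2 := h' _ hqU' _ (mem_of_mem_nhds hU')
    rw [e2] at e1
    linear_combination e1 - char2 (G (Γ.point w p)) + char2 (g (big p) (rep (Γ.point w q)))
  -- `D` is locally constant on a connected simplex
  have hconst : ∀ w p q, D w p = D w q := fun w p q =>
    (hloc w).apply_eq_of_isPreconnected isPreconnected_univ (mem_univ _) (mem_univ _)
  let x : Γ.V → ZMod 2 := fun w => D w (corner 0)
  have hx : ∀ k w, x w = D w (corner k) := fun k w => hconst w _ _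
  refine ⟨(x, fun k => ⟨fun w => g k w + x w, fun c hc w => ?_⟩), ?_⟩
  · have e1 := hD w (corner k) k (notMem_zeros_corner k)
    have e2 := hD (Γ.adj c w) (corner k) k (notMem_zeros_corner k)
    rw [point_adj (corner_apply_of_ne hc)] at e2
    simp only [hx k]
    linear_combination e1 + e2 + char2 (g k (Γ.adj c w)) - char2 (D w (corner k)) +
      char2 (G (Γ.point w (corner k))) + char2 (g k (rep (Γ.point w (corner k))))
  · funext k w
    simp only [cobound, LinearMap.coe_mk, AddHom.coe_mk, Pi.add_apply]
    linear_combination char2 (x w)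

theorem isPreconnected_side (c : Fin 3) :
    IsPreconnected {p : stdSimplex ℝ (Fin 3) | p.1 c = 0} := by
  have : IsPreconnected ({f | f c = 0} ∩ stdSimplex ℝ (Fin 3)) := by
    refine Convex.isPreconnected (Convex.inter ?_ (convex_stdSimplex ℝ (Fin 3)))
    exact convex_hyperplane (f := fun f : Fin 3 → ℝ => f c) ⟨fun _ _ => rfl, fun _ _ => rfl⟩ 0
  rw [IsInducing.subtypeVal.isPreconnected_image.symm]
  convert this using 1
  ext f
  simp [and_comm]

/-- Every cocycle has primitives on the simplices, which are convex. Their values at the corners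
form the triple of functions from which its class arises. -/
theorem cochainToH1_surjective : Function.Surjective Γ.cochainToH1 := by
  intro q
  obtain ⟨f, rfl⟩ := Submodule.mkQ_surjective _ q
  have char2 : ∀ a : ZMod 2, a + a = 0 := CharTwo.add_self_eq_zero
  have hprim : ∀ w, ∃ G, IsPrimitive (fun a b => f.1 (Γ.point w a) (Γ.point w b)) G := fun w =>
    exists_primitive_of_convex (convex_stdSimplex ℝ (Fin 3)) (isCompact_stdSimplex ℝ (Fin 3))
      (pullback_mem_Z1 f.2 (continuous_point w))
  choose G hG using hprim
  -- the primitives on two adjacent simplices differ by a constant on the common side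
  have hside : ∀ c w p q, p.1 c = 0 → q.1 c = 0 →
      G w p + G (Γ.adj c w) p = G w q + G (Γ.adj c w) q := by
    intro c w p q hp hq
    have hc : ContinuousOn (fun p => G w p + G (Γ.adj c w) p)
        {p : stdSimplex ℝ (Fin 3) | p.1 c = 0} := by
      intro p hp
      obtain ⟨U, hU, h⟩ := hG w p
      obtain ⟨U', hU', h'⟩ := hG (Γ.adj c w) p
      refine ContinuousWithinAt.congr_of_eventuallyEq
        (f := fun _ => G w p + G (Γ.adj c w) p) continuousWithinAt_const ?_ rfl
      filter_upwards [nhdsWithin_le_nhds hU, nhdsWithin_le_nhds hU', self_mem_nhdsWithin]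
        with q hq hq' hqc
      have e1 := h q hq p (mem_of_mem_nhds hU)
      have e2 := h' q hq' p (mem_of_mem_nhds hU')
      simp only [point_adj hqc, point_adj (show p.1 c = 0 from hp)] at e2
      rw [show f.1 (Γ.point w q) (Γ.point w p) = _ from e1] at e2
      linear_combination e2 + char2 (G (Γ.adj c w) q) - char2 (G w p)
    exact (isPreconnected_side c).constant hc hp hq
  let g : Fin 3 → Γ.V → ZMod 2 := fun k w => G w (corner k)
  have hg : g ∈ Γ.cochain := fun c k k' hk hk' v =>
    hside c v _ _ (corner_apply_of_ne hk.symm) (corner_apply_of_ne hk'.symm)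
  have hinv : ∀ p k, k ∉ zeros p → ∀ u v, Γ.comp (zeros p) u = Γ.comp (zeros p) v →
      G u p + g k u = G v p + g k v := by
    intro p k hk u v h
    refine eq_of_comp_eq (fun w => G w p + g k w) (fun c hc w => ?_) h
    have := hside c w p (corner k) hc (corner_apply_of_ne (fun e => hk (e ▸ hc)))
    linear_combination this - char2 (G w p) + char2 (g k (Γ.adj c w))
  refine ⟨⟨g, hg⟩, ?_⟩
  rw [← sub_eq_zero]
  change Submodule.mkQ _ _ - Submodule.mkQ _ _ = _
  rw [← map_sub]
  refine (Submodule.Quotient.mk_eq_zero _).2 ?_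
  -- The difference of the two cocycles has this primitive; it need not be continuous in `x`, so
  -- that the choice of `rep x` does no harm.
  refine ⟨fun x => G (rep x) (bary x), ?_⟩
  refine IsPrimitive.descend (f := cocycleFun g - f.1) (sub_mem (cocycleFun_mem hg) f.2)
    isClosedMap_proj proj_surjective ?_
  rintro ⟨w, p⟩
  have hk := big_notMem_zeros p
  set k := big p
  have hz : ∀ᶠ q : stdSimplex ℝ (Fin 3) in 𝓝 p, k ∉ zeros q := by
    have hc : Continuous fun q : stdSimplex ℝ (Fin 3) => q.1 k :=
      (continuous_apply _).comp continuous_subtype_val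
    exact hc.continuousAt.eventually_ne hk
  obtain ⟨U, hU, h⟩ := hG w p
  obtain ⟨U', hU', h'⟩ := cocycleFun_local hg (Γ.point w p) (k := k) hk
  have hN : Sigma.mk w '' ((U ∩ {q | k ∉ zeros q}) ∩ Γ.point w ⁻¹' U') ∈
      𝓝 (⟨w, p⟩ : Σ _ : Γ.V, stdSimplex ℝ (Fin 3)) :=
    isOpenMap_sigmaMk.image_mem_nhds (Filter.inter_mem (Filter.inter_mem hU hz)
      ((continuous_point w).continuousAt hU'))
  refine ⟨_, hN, ?_⟩
  rintro _ ⟨a, ⟨⟨ha, hak⟩, ha'⟩, rfl⟩ _ ⟨b, ⟨⟨hb, hbk⟩, hb'⟩, rfl⟩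
  have e1 : f.1 (Γ.point w a) (Γ.point w b) = G w a + G w b := h a ha b hb
  have e2 := h' _ ha' _ hb'
  have e3 := hinv a k hak _ _ (comp_rep w a)
  have e4 := hinv b k hbk _ _ (comp_rep w b)
  change cocycleFun g (Γ.point w a) (Γ.point w b) - f.1 (Γ.point w a) (Γ.point w b) =
    G (rep (Γ.point w a)) a + G (rep (Γ.point w b)) b
  rw [e2, e1]
  linear_combination -e3 - e4 + char2 (g k (rep (Γ.point w a))) + char2 (g k (rep (Γ.point w b))) -
    char2 (G w a) - char2 (G w b) - char2 (g k w)

/-- Locally constant functions on the carrier are constant on simplices. -/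
theorem finrank_H0_carrier : Module.finrank (ZMod 2) (H0 Γ.Carrier) =
    Module.finrank (ZMod 2) (Γ.inv univ) := by
  refine LinearEquiv.finrank_eq
    { toFun := fun g => ⟨fun v => g.1 (Γ.point v (corner 0)), fun c _ v => ?_⟩
      invFun := fun g => ⟨carrierLift (fun v _ => g.1 v) (fun v c _ _ => g.2 c trivial v), ?_⟩
      map_add' := fun _ _ => rfl
      map_smul' := fun _ _ => rfl
      left_inv := fun g => Subtype.ext (funext fun x => ?_)
      right_inv := fun _ => rfl }
  · have h : ∀ p q : stdSimplex ℝ (Fin 3), g.1 (Γ.point (Γ.adj c v) p) =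
        g.1 (Γ.point (Γ.adj c v) q) := fun p q =>
      (g.2.comp_continuous (continuous_point (Γ.adj c v))).apply_eq_of_isPreconnected
        isPreconnected_univ (mem_univ p) (mem_univ q)
    have h' : ∀ p q : stdSimplex ℝ (Fin 3), g.1 (Γ.point v p) = g.1 (Γ.point v q) := fun p q =>
      (g.2.comp_continuous (continuous_point v)).apply_eq_of_isPreconnected
        isPreconnected_univ (mem_univ p) (mem_univ q)
    have hc : (corner (c + 1)).1 c = 0 := corner_apply_of_ne (by fin_cases c <;> decide)
    refine (h _ (corner (c + 1))).trans ?_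
    rw [point_adj hc]
    exact h' _ _
  · refine (IsLocallyConstant.iff_continuous _).2 (continuous_carrierLift _ fun v => ?_)
    exact continuous_const
  · obtain ⟨v, p, rfl⟩ := point_surjective x
    exact (g.2.comp_continuous (continuous_point v)).apply_eq_of_isPreconnected
        isPreconnected_univ (mem_univ _) (mem_univ p)

variable (Γ) in
/-- In dimension two, `χ_ε` does not depend on `ε`, as every pair of colors is cyclically
consecutive. -/
theorem eulerChar_eq (ε : Equiv.Perm (Fin 3)) :
    Γ.eulerChar ε = ∑ k : Fin 3, (Nat.card (Γ.Comp {k}ᶜ) : ℚ) - (Nat.card Γ.V : ℚ) / 2 := by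
  have h : ∀ i, ({ε i, ε (i + 1)} : Set (Fin 3)) = {ε (i + 2)}ᶜ := by
    intro i
    ext c
    obtain ⟨j, rfl⟩ := ε.surjective c
    simp only [mem_insert_iff, mem_singleton_iff, mem_compl_iff, EmbeddingLike.apply_eq_iff_eq]
    revert i j
    decide
  have hs : ∑ i : Fin 3, (Nat.card (Γ.Comp {ε i, ε (i + 1)}) : ℚ) =
      ∑ k : Fin 3, (Nat.card (Γ.Comp {k}ᶜ) : ℚ) := by
    simp_rw [h]
    exact ((Equiv.addRight (2 : Fin 3)).trans ε).sum_comp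
      (fun k => (Nat.card (Γ.Comp {k}ᶜ) : ℚ))
  change ∑ i : Fin 3, (Nat.card (Γ.Comp {ε i, ε (i + 1)}) : ℚ) + _ = _
  rw [hs]
  push_cast
  ring

variable (Γ) in
/-- The combinatorial Euler characteristic: components with two colors are the vertices of the
complex, and each edge of a triangle is shared by two triangles. -/
theorem euler_carrier : (euler Γ.Carrier : ℚ) =
    ∑ k : Fin 3, (Nat.card (Γ.Comp {k}ᶜ) : ℚ) - (Nat.card Γ.V : ℚ) / 2 := by
  have h1 := LinearMap.finrank_range_add_finrank_ker Γ.cochainToH1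
  have hk : Module.finrank (ZMod 2) (LinearMap.ker Γ.cochainToH1) =
      Module.finrank (ZMod 2) (LinearMap.range Γ.cobound) := by
    have : LinearMap.ker Γ.cochainToH1 = (LinearMap.range Γ.cobound).submoduleOf Γ.cochain := by
      ext g
      rw [LinearMap.mem_ker, cochainToH1_eq_zero_iff]
      exact ⟨fun h => mem_range_cobound g.2 h, fun h => cocycleFun_mem_B1 h⟩
    rw [this]
    exact (Submodule.submoduleOfEquivOfLe Γ.range_cobound_le).finrank_eq
  rw [LinearMap.range_eq_top.2 cochainToH1_surjective, finrank_top, hk] at h1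
  have h2 := Γ.finrank_cochain
  have h3 := Γ.finrank_range_cobound
  have h4 : 2 * ∑ c : Fin 3, Module.finrank (ZMod 2) (Γ.inv {c}) = 3 * Nat.card Γ.V := by
    rw [Finset.mul_sum]
    simp [two_mul_finrank_inv_singleton]
  rw [euler, finrank_H0_carrier]
  have h1' := congrArg (Nat.cast : ℕ → ℚ) h1
  have h2' := congrArg (Nat.cast : ℕ → ℚ) h2
  have h3' := congrArg (Nat.cast : ℕ → ℚ) h3
  have h4' := congrArg (Nat.cast : ℕ → ℚ) h4
  push_cast at h1' h2' h3' h4' ⊢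
  linarith

theorem regularGenus_eq (Γ : ColoredGraph 2) :
    Γ.regularGenus = 1 - (euler Γ.Carrier : ℚ) / 2 := by
  have h : Γ.genusAt = fun _ => 1 - (euler Γ.Carrier : ℚ) / 2 := by
    funext ε
    rw [genusAt, eulerChar_eq, euler_carrier]
  rw [regularGenus, h, Finset.inf'_const]

/-- The regular genus of a gem depends only on the surface, so that every gem is minimal. -/
theorem Represents.isGenusMinimal {M : Type*} [TopologicalSpace M] (h : Γ.Represents M) :
    Γ.IsGenusMinimal M := by
  refine ⟨h, ⟨Γ, h, rfl⟩, ?_⟩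
  rintro _ ⟨Γ', h', rfl⟩
  obtain ⟨e⟩ := h
  obtain ⟨e'⟩ := h'
  rw [regularGenus_eq, regularGenus_eq, euler_congr e, euler_congr e']

end ColoredGraph

/-! ### Polar coordinates on a fan of triangles -/

namespace ColoredGraph

/-- The closed half disc. -/
def halfDisc : Set ℂ := {z | ‖z‖ ≤ 1 ∧ 0 ≤ z.im}

/-- The colors `i`, `j`, `i`, `j`, … of the edges along a two-colored cycle. -/
def col (i j : Fin 3) (n : ℕ) : Fin 3 := if Even n then i else j

/-- The distance from the vertex opposite to the side `i j`, measured linearly. -/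
def rad (i j : Fin 3) (p : stdSimplex ℝ (Fin 3)) : ℝ := p.1 i + p.1 j

/-- The angle in the `n`-th triangle of a fan, measured linearly on the side opposite to the
center of the fan; for a point at the center it has the junk value zero. -/
noncomputable def frac (i j : Fin 3) (n : ℕ) (p : stdSimplex ℝ (Fin 3)) : ℝ :=
  p.1 (col i j (n + 1)) / rad i j p

/-- The map that takes the triangles `1, …, L - 1` of a fan to sectors of equal angles that
together form the half disc, with the center of the fan going to zero. -/
noncomputable def arcMap (i j : Fin 3) (L n : ℕ) (p : stdSimplex ℝ (Fin 3)) : ℂ :=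
  rad i j p * Complex.exp ((Real.pi * ((n - 1 + frac i j n p) / (L - 1)) : ℝ) * Complex.I)

/-- The map that takes the triangles `1, …, L` of a cyclic fan to the half disc: the center of the
fan goes to `I / 2`, and the outer side of the last triangle goes to the diameter. -/
noncomputable def fanMap (i j : Fin 3) (L n : ℕ) (p : stdSimplex ℝ (Fin 3)) : ℂ :=
  (1 - rad i j p : ℝ) * (Complex.I / 2) +
    if n < L then arcMap i j L n p else ((p.1 j - p.1 i : ℝ) : ℂ)

section
variable {i j c : Fin 3}

theorem col_zero : col i j 0 = i := rfl

theorem col_add_two (n : ℕ) : col i j (n + 2) = col i j n := by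
  simp [col, Nat.even_add]

theorem col_cases (n : ℕ) :
    (col i j n = i ∧ col i j (n + 1) = j) ∨ (col i j n = j ∧ col i j (n + 1) = i) := by
  by_cases h : Even n <;> simp [col, Nat.even_add_one, h]

theorem col_of_even {n : ℕ} (h : Even n) : col i j n = i := if_pos h

theorem col_succ_of_even {n : ℕ} (h : Even n) : col i j (n + 1) = j := by
  simp [col, Nat.even_add_one, h]

theorem rad_eq (n : ℕ) (p : stdSimplex ℝ (Fin 3)) :
    rad i j p = p.1 (col i j n) + p.1 (col i j (n + 1)) := by
  rcases col_cases (i := i) (j := j) n with ⟨h, h'⟩ | ⟨h, h'⟩ <;> rw [h, h', rad]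
  ring

theorem exists_third (i j : Fin 3) : ∃ c, i ≠ c ∧ j ≠ c := by
  revert i j
  decide

theorem sum_coords (hij : i ≠ j) (hic : i ≠ c) (hjc : j ≠ c) (p : stdSimplex ℝ (Fin 3)) :
    p.1 i + p.1 j + p.1 c = 1 := by
  have h : (Finset.univ : Finset (Fin 3)) = {i, j, c} := by
    revert i j c
    decide
  have := p.2.2
  rw [h, Finset.sum_insert (by simp [hij, hic]), Finset.sum_pair hjc] at this
  linarith

theorem simplex_ext (hij : i ≠ j) {p q : stdSimplex ℝ (Fin 3)} (hi : p.1 i = q.1 i)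
    (hj : p.1 j = q.1 j) : p = q := by
  obtain ⟨c, hic, hjc⟩ := exists_third i j
  have h1 := sum_coords hij hic hjc p
  have h2 := sum_coords hij hic hjc q
  refine Subtype.ext (funext fun k => ?_)
  have : k = i ∨ k = j ∨ k = c := by
    clear * - hij hic hjc
    revert i j c k
    decide
  rcases this with rfl | rfl | rfl
  · exact hi
  · exact hj
  · linarith

theorem rad_nonneg (p : stdSimplex ℝ (Fin 3)) : 0 ≤ rad i j p := add_nonneg (p.2.1 i) (p.2.1 j)

theorem rad_le_one (hij : i ≠ j) (p : stdSimplex ℝ (Fin 3)) : rad i j p ≤ 1 := by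
  obtain ⟨c, hic, hjc⟩ := exists_third i j
  have h1 := sum_coords hij hic hjc p
  have := p.2.1 c
  rw [rad]
  linarith

theorem frac_nonneg (n : ℕ) (p : stdSimplex ℝ (Fin 3)) : 0 ≤ frac i j n p :=
  div_nonneg (p.2.1 _) (rad_nonneg p)

theorem frac_le_one (n : ℕ) (p : stdSimplex ℝ (Fin 3)) : frac i j n p ≤ 1 := by
  refine div_le_one_of_le₀ ?_ (rad_nonneg p)
  rw [rad_eq n]
  linarith [p.2.1 (col i j n)]

theorem continuous_coord (k : Fin 3) : Continuous fun p : stdSimplex ℝ (Fin 3) => p.1 k :=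
  (continuous_apply k).comp continuous_subtype_val

theorem continuous_rad : Continuous (rad i j) := (continuous_coord i).add (continuous_coord j)

theorem norm_arcMap (L n : ℕ) (p : stdSimplex ℝ (Fin 3)) : ‖arcMap i j L n p‖ = rad i j p := by
  rw [arcMap, norm_mul, Complex.norm_exp_ofReal_mul_I, mul_one, Complex.norm_real,
    Real.norm_of_nonneg (rad_nonneg p)]

theorem continuous_arcMap (L n : ℕ) : Continuous (arcMap i j L n) := by
  rw [continuous_iff_continuousAt]
  intro p
  by_cases h : rad i j p = 0
  · have h0 : arcMap i j L n p = 0 := by rw [← norm_eq_zero, norm_arcMap, h]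
    rw [ContinuousAt, h0, tendsto_zero_iff_norm_tendsto_zero]
    simp only [norm_arcMap]
    have := (continuous_rad (i := i) (j := j)).tendsto p
    rwa [h] at this
  · have h1 : ContinuousAt (frac i j n) p :=
      (continuous_coord _).continuousAt.div continuous_rad.continuousAt h
    have h2 : ContinuousAt (fun p => Real.pi * ((n - 1 + frac i j n p) / (L - 1))) p :=
      continuousAt_const.mul ((continuousAt_const.add h1).div_const _)
    exact (Complex.continuous_ofReal.continuousAt.comp continuous_rad.continuousAt).mul
      (Complex.continuous_exp.continuousAt.comp
        ((Complex.continuous_ofReal.continuousAt.comp h2).mul continuousAt_const))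

theorem continuous_fanMap (L n : ℕ) : Continuous (fanMap i j L n) := by
  unfold fanMap
  refine Continuous.add ?_ ?_
  · exact (Complex.continuous_ofReal.comp (continuous_const.sub continuous_rad)).mul
      continuous_const
  · split_ifs
    · exact continuous_arcMap L n
    · exact Complex.continuous_ofReal.comp ((continuous_coord j).sub (continuous_coord i))

theorem angle_mem {L n : ℕ} (hn : 1 ≤ n) (hnL : n < L) {s : ℝ} (h0 : 0 ≤ s) (h1 : s ≤ 1) :
    Real.pi * ((n - 1 + s) / (L - 1)) ∈ Icc 0 Real.pi := by
  have hn' : (1 : ℝ) ≤ n := by exact_mod_cast hn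
  have hL' : (n : ℝ) + 1 ≤ L := by exact_mod_cast hnL
  have : (0 : ℝ) < L - 1 := by linarith
  constructor
  · exact mul_nonneg Real.pi_pos.le (div_nonneg (by linarith) this.le)
  · refine mul_le_of_le_one_right Real.pi_pos.le ((div_le_one this).2 (by linarith))

theorem arcMap_mem {L n : ℕ} (hij : i ≠ j) (hn : 1 ≤ n) (hnL : n < L)
    (p : stdSimplex ℝ (Fin 3)) : arcMap i j L n p ∈ halfDisc := by
  refine ⟨(norm_arcMap L n p).trans_le (rad_le_one hij p), ?_⟩
  rw [arcMap, Complex.im_ofReal_mul, Complex.exp_ofReal_mul_I_im]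
  exact mul_nonneg (rad_nonneg p) (Real.sin_nonneg_of_mem_Icc
    (angle_mem hn hnL (frac_nonneg n p) (frac_le_one n p)))

theorem arcMap_succ {L n : ℕ} {p : stdSimplex ℝ (Fin 3)} (hp : p.1 (col i j n) = 0) :
    arcMap i j L n p = arcMap i j L (n + 1) p := by
  by_cases h : rad i j p = 0
  · rw [arcMap, arcMap, h]
    simp
  · have h1 : frac i j n p = 1 := by
      rw [frac, div_eq_one_iff_eq h, rad_eq n, hp, zero_add]
    have h2 : frac i j (n + 1) p = 0 := by
      rw [frac, col_add_two, hp, zero_div]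
    rw [arcMap, arcMap, h1, h2]
    push_cast
    ring_nf

/-- The last side of the fan goes to the negative half of the diameter. -/
theorem arcMap_last {L : ℕ} (hL : 1 ≤ L) {p : stdSimplex ℝ (Fin 3)}
    (hp : p.1 (col i j L) = 0) : arcMap i j (L + 1) L p = -(rad i j p : ℂ) := by
  by_cases h : rad i j p = 0
  · rw [arcMap, h]
    simp
  · have h1 : frac i j L p = 1 := by
      rw [frac, div_eq_one_iff_eq h, rad_eq L, hp, zero_add]
    have hL' : (1 : ℝ) ≤ L := by exact_mod_cast hL
    have h2 : Real.pi * (((L : ℝ) - 1 + 1) / (((L + 1 : ℕ) : ℝ) - 1)) = Real.pi := by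
      push_cast
      rw [sub_add_cancel, add_sub_cancel_right, div_self (by positivity), mul_one]
    rw [arcMap, h1, h2, Complex.exp_pi_mul_I]
    ring

/-- The first side of the fan goes to the positive half of the diameter. -/
theorem arcMap_one {L : ℕ} {p : stdSimplex ℝ (Fin 3)} (hp : p.1 i = 0) :
    arcMap i j L 1 p = (rad i j p : ℂ) := by
  have h2 : frac i j 1 p = 0 := by
    rw [frac, show col i j (1 + 1) = i from rfl, hp, zero_div]
  rw [arcMap, h2]
  simp

/-- Consecutive triangles of a fan agree on their common side. -/
theorem fanMap_succ {L n : ℕ} (hn : 1 ≤ n) (hnL : n < L) (hL : Even L)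
    {p : stdSimplex ℝ (Fin 3)} (hp : p.1 (col i j n) = 0) :
    fanMap i j L n p = fanMap i j L (n + 1) p := by
  rw [fanMap, fanMap, if_pos hnL]
  congr 1
  split_ifs with h
  · exact arcMap_succ hp
  · obtain rfl : L = n + 1 := by omega
    rw [arcMap_last hn hp]
    have hodd : ¬ Even n := by rwa [← Nat.even_add_one]
    rw [col, if_neg hodd] at hp
    rw [rad, hp]
    push_cast
    ring

theorem fanMap_last {L : ℕ} (hL : 2 ≤ L) {p : stdSimplex ℝ (Fin 3)} (hp : p.1 i = 0) :
    fanMap i j L L p = fanMap i j L 1 p := by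
  rw [fanMap, fanMap, if_neg (lt_irrefl L), if_pos (by omega), arcMap_one hp, rad, hp]
  simp

/-- Points with equal polar coordinates agree, up to the identification of consecutive
triangles. -/
theorem eq_of_polar_eq (hij : i ≠ j) {n n' : ℕ} {p p' : stdSimplex ℝ (Fin 3)}
    (hr : rad i j p = rad i j p') (h0 : 0 < rad i j p)
    (h : (n : ℝ) + frac i j n p = n' + frac i j n' p') :
    p = p' ∧ (n = n' ∨ (n' = n + 1 ∧ p.1 (col i j n) = 0) ∨
      (n = n' + 1 ∧ p.1 (col i j n') = 0)) := by
  wlog hle : n ≤ n' generalizing n n' p p'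
  · obtain ⟨h1, h2⟩ := this hr.symm (hr ▸ h0) h.symm (by omega)
    subst h1
    refine ⟨rfl, ?_⟩
    rcases h2 with h2 | h2 | h2
    · exact Or.inl h2.symm
    · exact Or.inr (Or.inr h2)
    · exact Or.inr (Or.inl h2)
  have hext : ∀ m, p.1 (col i j m) = p'.1 (col i j m) → p = p' := by
    intro m hm
    have h1 := rad_eq (i := i) (j := j) m p
    have h2 := rad_eq (i := i) (j := j) m p'
    rcases col_cases (i := i) (j := j) m with ⟨e, e'⟩ | ⟨e, e'⟩ <;> rw [e, e'] at h1 h2 <;>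
      rw [e] at hm
    · exact simplex_ext hij hm (by linarith)
    · exact simplex_ext hij (by linarith) hm
  have f1 := frac_le_one (i := i) (j := j) n p
  have f2 := frac_nonneg (i := i) (j := j) n' p'
  rcases hle.eq_or_lt with rfl | hlt
  · have : frac i j n p = frac i j n p' := by linarith
    rw [frac, frac, ← hr, div_left_inj' h0.ne'] at this
    exact ⟨hext _ this, Or.inl rfl⟩
  · have hlt' : (n : ℝ) + 1 ≤ n' := by exact_mod_cast hlt
    have e : n' = n + 1 := by
      have : (n' : ℝ) ≤ n + 1 := by linarith
      have : n' ≤ n + 1 := by exact_mod_cast this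
      omega
    subst e
    have e1 : frac i j n p = 1 := by push_cast at h hlt'; linarith
    have e2 : frac i j (n + 1) p' = 0 := by push_cast at h hlt'; linarith
    rw [frac, div_eq_one_iff_eq h0.ne', rad_eq n] at e1
    rw [frac, div_eq_zero_iff, col_add_two, ← hr] at e2
    have e2' : p'.1 (col i j n) = 0 := e2.resolve_right h0.ne'
    have e1' : p.1 (col i j n) = 0 := by linarith
    exact ⟨hext n (e1'.trans e2'.symm), Or.inr (Or.inl ⟨rfl, e1'⟩)⟩

theorem eq_of_rad_eq_zero (hij : i ≠ j) {p p' : stdSimplex ℝ (Fin 3)} (h : rad i j p = 0)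
    (h' : rad i j p' = 0) : p = p' ∧ p.1 i = 0 ∧ p.1 j = 0 := by
  rw [rad] at h h'
  have := p.2.1 i
  have := p.2.1 j
  have := p'.2.1 i
  have := p'.2.1 j
  exact ⟨simplex_ext hij (by linarith) (by linarith), by linarith, by linarith⟩

/-- Every pair of polar coordinates is attained. -/
theorem exists_polar (hij : i ≠ j) {N : ℕ} (hN : 1 ≤ N) {r t : ℝ} (hr0 : 0 ≤ r) (hr1 : r ≤ 1)
    (ht0 : 0 ≤ t) (htN : t ≤ N) : ∃ n, 1 ≤ n ∧ n ≤ N ∧ ∃ p : stdSimplex ℝ (Fin 3),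
      rad i j p = r ∧ (0 < r → (n : ℝ) - 1 + frac i j n p = t) := by
  obtain ⟨n, hn1, hnN, hs0, hs1⟩ : ∃ n : ℕ, 1 ≤ n ∧ n ≤ N ∧ 0 ≤ t - (n - 1) ∧ t - (n - 1) ≤ 1 := by
    -- the triangle with number `⌈t⌉`
    rcases ht0.eq_or_lt with rfl | hpos
    · exact ⟨1, le_rfl, hN, by norm_num, by norm_num⟩
    · refine ⟨⌈t⌉₊, Nat.one_le_ceil_iff.2 hpos, Nat.ceil_le.2 htN, ?_, ?_⟩
      · linarith [Nat.ceil_lt_add_one ht0]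
      · linarith [Nat.le_ceil t]
  refine ⟨n, hn1, hnN, ?_⟩
  set s := t - (n - 1)
  obtain ⟨c, hic, hjc⟩ := exists_third i j
  have key : ∀ a b : ℝ, 0 ≤ a → 0 ≤ b → a + b ≤ 1 →
      ∃ p : stdSimplex ℝ (Fin 3), p.1 i = a ∧ p.1 j = b := by
    intro a b ha hb hab
    refine ⟨⟨fun k => if k = i then a else if k = j then b else 1 - a - b, fun k => ?_, ?_⟩, ?_, ?_⟩
    · dsimp only
      split_ifs <;> linarith
    · have h : (Finset.univ : Finset (Fin 3)) = {i, j, c} := by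
        clear * - hij hic hjc
        revert i j c
        decide
      rw [h, Finset.sum_insert (by simp [hij, hic]), Finset.sum_pair hjc]
      simp only [if_true, if_neg hij.symm, if_neg hic.symm, if_neg hjc.symm]
      ring
    · simp
    · simp [hij.symm]
  have hrs : 0 ≤ r * s := mul_nonneg hr0 hs0
  have hrs' : 0 ≤ r * (1 - s) := mul_nonneg hr0 (by linarith)
  rcases col_cases (i := i) (j := j) n with ⟨e, e'⟩ | ⟨e, e'⟩
  · obtain ⟨p, hpi, hpj⟩ := key (r * (1 - s)) (r * s) hrs' hrs (by linarith)
    have hr : rad i j p = r := by rw [rad, hpi, hpj]; ring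
    refine ⟨p, hr, fun h0 => ?_⟩
    rw [frac, hr, e', hpj, mul_div_cancel_left₀ _ h0.ne']
    ring
  · obtain ⟨p, hpi, hpj⟩ := key (r * s) (r * (1 - s)) hrs hrs' (by linarith)
    have hr : rad i j p = r := by rw [rad, hpi, hpj]; ring
    refine ⟨p, hr, fun h0 => ?_⟩
    rw [frac, hr, e', hpi, mul_div_cancel_left₀ _ h0.ne']
    ring

end

end ColoredGraph

/-! ### Fans of triangles are half discs -/

namespace ColoredGraph

theorem exp_injOn {a b : ℝ} (ha : a ∈ Icc 0 Real.pi) (hb : b ∈ Icc 0 Real.pi)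
    (h : Complex.exp (a * Complex.I) = Complex.exp (b * Complex.I)) : a = b := by
  refine Real.injOn_cos ha hb ?_
  rw [← Complex.exp_ofReal_mul_I_re, h, Complex.exp_ofReal_mul_I_re]

/-- The boundary of the half disc, with the arc on `[0, L - 1]` and the diameter on
`[L - 1, L]`. -/
noncomputable def bdry (L : ℕ) (t : ℝ) : ℂ :=
  if t ≤ L - 1 then Complex.exp ((Real.pi * (t / (L - 1)) : ℝ) * Complex.I)
  else ((2 * (t - (L - 1)) - 1 : ℝ) : ℂ)

theorem bdry_angle {L : ℕ} (hL : 2 ≤ L) {t : ℝ} (h0 : 0 ≤ t) (h1 : t ≤ L - 1) :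
    Real.pi * (t / (L - 1)) ∈ Icc 0 Real.pi := by
  have hL' : (2 : ℝ) ≤ L := by exact_mod_cast hL
  have : (0 : ℝ) < L - 1 := by linarith
  exact ⟨mul_nonneg Real.pi_pos.le (div_nonneg h0 this.le),
    mul_le_of_le_one_right Real.pi_pos.le ((div_le_one this).2 h1)⟩

theorem bdry_cases {L : ℕ} (hL : 2 ≤ L) {t : ℝ} (h0 : 0 ≤ t) (h1 : t ≤ L) :
    bdry L t ∈ halfDisc ∧ (‖bdry L t‖ = 1 ∨ (bdry L t).im = 0) := by
  rw [bdry]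
  split_ifs with h
  · have := bdry_angle hL h0 h
    refine ⟨⟨(Complex.norm_exp_ofReal_mul_I _).le, ?_⟩, Or.inl (Complex.norm_exp_ofReal_mul_I _)⟩
    rw [Complex.exp_ofReal_mul_I_im]
    exact Real.sin_nonneg_of_mem_Icc this
  · refine ⟨⟨?_, (Complex.ofReal_im _).ge⟩, Or.inr (Complex.ofReal_im _)⟩
    rw [Complex.norm_real, Real.norm_eq_abs, abs_le]
    constructor <;> linarith

/-- The boundary of the half disc is run through once; only its two ends agree. -/
theorem bdry_injective {L : ℕ} (hL : 2 ≤ L) {t t' : ℝ} (h0 : 0 ≤ t) (h1 : t ≤ L) (h0' : 0 ≤ t')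
    (h1' : t' ≤ L) (h : bdry L t = bdry L t') : t = t' ∨ (t = 0 ∧ t' = L) ∨ (t = L ∧ t' = 0) := by
  have hL' : (2 : ℝ) ≤ L := by exact_mod_cast hL
  have hL1 : (0 : ℝ) < L - 1 := by linarith
  wlog hle : t ≤ t' generalizing t t'
  · rcases this h0' h1' h0 h1 h.symm (by linarith) with h2 | h2 | h2
    · exact Or.inl h2.symm
    · exact Or.inr (Or.inr ⟨h2.2, h2.1⟩)
    · exact Or.inr (Or.inl ⟨h2.2, h2.1⟩)
  rw [bdry, bdry] at h
  by_cases ht' : t' ≤ L - 1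
  · rw [if_pos (hle.trans ht'), if_pos ht'] at h
    have := exp_injOn (bdry_angle hL h0 (hle.trans ht')) (bdry_angle hL h0' ht') h
    rw [mul_right_inj' Real.pi_pos.ne', div_left_inj' hL1.ne'] at this
    exact Or.inl this
  · by_cases ht : t ≤ L - 1
    · rw [if_pos ht, if_neg ht'] at h
      have him := congrArg Complex.im h
      have hre := congrArg Complex.re h
      rw [Complex.exp_ofReal_mul_I_im, Complex.ofReal_im] at him
      rw [Complex.exp_ofReal_mul_I_re, Complex.ofReal_re] at hre
      have hm := bdry_angle hL h0 ht
      have hsin : Real.pi * (t / (L - 1)) = 0 ∨ Real.pi * (t / (L - 1)) = Real.pi := by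
        by_contra! hne
        exact (Real.sin_pos_of_pos_of_lt_pi (hm.1.lt_of_ne' hne.1) (hm.2.lt_of_ne hne.2)).ne' him
      rcases hsin with hs | hs <;> rw [hs] at hre
      · rw [Real.cos_zero] at hre
        have : t = 0 := by
          rw [mul_eq_zero, div_eq_zero_iff] at hs
          exact (hs.resolve_left Real.pi_pos.ne').resolve_right hL1.ne'
        exact Or.inr (Or.inl ⟨this, by linarith⟩)
      · rw [Real.cos_pi] at hre
        linarith
    · rw [if_neg ht, if_neg ht', Complex.ofReal_inj] at h
      exact Or.inl (by linarith)

theorem exists_bdry {L : ℕ} (hL : 2 ≤ L) {z : ℂ} (hz : z ∈ halfDisc)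
    (h : ‖z‖ = 1 ∨ z.im = 0) : ∃ t : ℝ, 0 ≤ t ∧ t ≤ L ∧ bdry L t = z := by
  have hL' : (2 : ℝ) ≤ L := by exact_mod_cast hL
  have hL1 : (0 : ℝ) < L - 1 := by linarith
  by_cases hn : ‖z‖ = 1
  · have ha0 : 0 ≤ z.arg := Complex.arg_nonneg_iff.2 hz.2
    have ha1 := Complex.arg_le_pi z
    have hle : z.arg / Real.pi * (L - 1) ≤ L - 1 :=
      mul_le_of_le_one_left hL1.le ((div_le_one Real.pi_pos).2 ha1)
    refine ⟨z.arg / Real.pi * (L - 1), mul_nonneg (div_nonneg ha0 Real.pi_pos.le) hL1.le,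
      by linarith, ?_⟩
    rw [bdry, if_pos hle, mul_div_cancel_right₀ _ hL1.ne', mul_div_cancel₀ _ Real.pi_pos.ne']
    have := Complex.norm_mul_exp_arg_mul_I z
    rwa [hn, Complex.ofReal_one, one_mul] at this
  · have him := h.resolve_left hn
    have hre : z = (z.re : ℂ) := Complex.ext rfl him
    have habs : |z.re| < 1 := by
      have := hz.1.lt_of_ne hn
      rwa [hre, Complex.norm_real, Real.norm_eq_abs] at this
    rw [abs_lt] at habs
    refine ⟨(z.re + 1) / 2 + (L - 1), by linarith, by linarith, ?_⟩
    rw [bdry, if_neg (by linarith)]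
    conv_rhs => rw [hre]
    congr 1
    ring

/-- A ray from `I / 2` leaves the half disc at the boundary. -/
theorem notMem_halfDisc {b : ℂ} (h : ‖b‖ = 1 ∨ b.im = 0) {t : ℝ} (ht : 1 < t) :
    Complex.I / 2 + t * (b - Complex.I / 2) ∉ halfDisc := by
  rintro ⟨h1, h2⟩
  rcases h with h | h
  · have e : (t : ℂ) * b = (Complex.I / 2 + t * (b - Complex.I / 2)) +
        ((t - 1) / 2 : ℝ) * Complex.I := by
      push_cast
      ring
    have h3 := norm_add_le (Complex.I / 2 + t * (b - Complex.I / 2)) (((t - 1) / 2 : ℝ) * Complex.I)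
    rw [← e, norm_mul, norm_mul, Complex.norm_I, Complex.norm_real, Complex.norm_real, h,
      Real.norm_of_nonneg (by linarith), Real.norm_of_nonneg (by linarith)] at h3
    linarith
  · have : (Complex.I / 2 + t * (b - Complex.I / 2)).im = 1 / 2 - t / 2 := by
      simp [h]
      ring
    rw [this] at h2
    linarith

/-- The half disc is star shaped with respect to `I / 2`, and rays from there meet the boundary only
once. -/
theorem radial_unique {b b' : ℂ} (hb : b ∈ halfDisc) (hb' : b' ∈ halfDisc)
    (h : ‖b‖ = 1 ∨ b.im = 0) (h' : ‖b'‖ = 1 ∨ b'.im = 0) {r r' : ℝ} (hr : 0 ≤ r) (hr' : 0 ≤ r')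
    (he : ((1 - r : ℝ) : ℂ) * (Complex.I / 2) + r * b =
      ((1 - r' : ℝ) : ℂ) * (Complex.I / 2) + r' * b') : r = r' ∧ (0 < r → b = b') := by
  have key : ∀ (b b' : ℂ) (_ : b ∈ halfDisc) (_ : ‖b'‖ = 1 ∨ b'.im = 0) (r r' : ℝ) (_ : 0 ≤ r),
      ((1 - r : ℝ) : ℂ) * (Complex.I / 2) + r * b =
      ((1 - r' : ℝ) : ℂ) * (Complex.I / 2) + r' * b' → ¬ r < r' := by
    intro b b' hb h' r r' hr he hlt
    rcases hr.eq_or_lt with rfl | hpos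
    · have e : (Complex.I / 2 : ℂ) = b' := by
        have hr' : (r' : ℂ) ≠ 0 := by exact_mod_cast hlt.ne'
        have : (r' : ℂ) * (Complex.I / 2) = r' * b' := by
          push_cast at he
          linear_combination he
        exact mul_left_cancel₀ hr' this
      rcases h' with h' | h' <;> rw [← e] at h' <;> norm_num at h'
    · refine notMem_halfDisc h' (t := r' / r) ((one_lt_div hpos).2 hlt) ?_
      convert hb using 1
      have hr' : (r : ℂ) ≠ 0 := by exact_mod_cast hpos.ne'
      push_cast at he ⊢
      field_simp
      linear_combination -2 * he
  have heq : r = r' := le_antisymm (not_lt.1 (key b' b hb' h r' r hr' he.symm))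
    (not_lt.1 (key b b' hb h' r r' hr he))
  refine ⟨heq, fun hpos => ?_⟩
  subst heq
  have hr' : (r : ℂ) ≠ 0 := by exact_mod_cast hpos.ne'
  exact mul_left_cancel₀ hr' (add_left_cancel he)

theorem isCompact_halfDisc : IsCompact halfDisc := by
  have : halfDisc = Metric.closedBall 0 1 ∩ {z | 0 ≤ z.im} := by
    ext z
    simp [halfDisc]
  rw [this]
  exact (isCompact_closedBall _ _).inter_right (isClosed_le continuous_const Complex.continuous_im)

theorem convex_halfDisc : Convex ℝ halfDisc := by
  have : halfDisc = Metric.closedBall 0 1 ∩ {z | 0 ≤ z.im} := by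
    ext z
    simp [halfDisc]
  rw [this]
  exact (convex_closedBall _ _).inter (convex_halfSpace_im_ge 0)

theorem center_mem_halfDisc : Complex.I / 2 ∈ halfDisc := by
  constructor <;> norm_num

/-- Every point of the half disc lies on a segment from `I / 2` to the boundary. -/
theorem exists_radial {z : ℂ} (hz : z ∈ halfDisc) : ∃ (r : ℝ) (b : ℂ), 0 ≤ r ∧ r ≤ 1 ∧
    b ∈ halfDisc ∧ (‖b‖ = 1 ∨ b.im = 0) ∧
      z = ((1 - r : ℝ) : ℂ) * (Complex.I / 2) + r * b := by
  by_cases hzc : z = Complex.I / 2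
  · exact ⟨0, 0, le_rfl, zero_le_one, ⟨by simp, by simp⟩, Or.inr rfl, by simp [hzc]⟩
  let g : ℝ → ℂ := fun t => Complex.I / 2 + t * (z - Complex.I / 2)
  have hg : Continuous g := by fun_prop
  have hd : 0 < ‖z - Complex.I / 2‖ := norm_pos_iff.2 (sub_ne_zero.2 hzc)
  -- the last point of the ray through `z` that is in the half disc is on the boundary
  let S := {t : ℝ | 0 ≤ t ∧ g t ∈ halfDisc}
  have hS : IsCompact S := by
    refine Metric.isCompact_of_isClosed_isBounded
      (isClosed_Ici.inter (isCompact_halfDisc.isClosed.preimage hg)) ?_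
    refine (Metric.isBounded_Icc (0 : ℝ) (2 / ‖z - Complex.I / 2‖)).subset fun t ht => ⟨ht.1, ?_⟩
    rw [le_div_iff₀ hd]
    have h1 : ‖(t : ℂ) * (z - Complex.I / 2)‖ = t * ‖z - Complex.I / 2‖ := by
      rw [norm_mul, Complex.norm_real, Real.norm_of_nonneg ht.1]
    rw [← h1]
    have h2 : (t : ℂ) * (z - Complex.I / 2) = g t - Complex.I / 2 := by simp [g]
    rw [h2]
    refine (norm_sub_le _ _).trans ?_
    linarith [ht.2.1, center_mem_halfDisc.1]
  have h1S : (1 : ℝ) ∈ S := ⟨zero_le_one, by simpa [g] using hz⟩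
  obtain ⟨t, htS, hmax⟩ := hS.exists_isGreatest ⟨1, h1S⟩
  have ht1 : 1 ≤ t := hmax h1S
  have ht0 : (t : ℂ) ≠ 0 := by
    have : (0 : ℝ) < t := by linarith
    exact_mod_cast this.ne'
  refine ⟨1 / t, g t, by positivity, (div_le_one (by linarith)).2 ht1, htS.2, ?_, ?_⟩
  · by_contra! hne
    have h1 : ‖g t‖ < 1 := htS.2.1.lt_of_ne hne.1
    have h2 : 0 < (g t).im := htS.2.2.lt_of_ne' hne.2
    have h3 : ∀ᶠ s in 𝓝 t, ‖g s‖ < 1 ∧ 0 < (g s).im :=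
      (hg.norm.continuousAt.eventually_lt continuousAt_const h1).and
        (continuousAt_const.eventually_lt (Complex.continuous_im.comp hg).continuousAt h2)
    obtain ⟨s, hs, hts⟩ := ((h3.filter_mono nhdsWithin_le_nhds).and
      (self_mem_nhdsWithin : Ioi t ∈ 𝓝[>] t)).exists
    exact absurd (hmax ⟨by linarith [show t < s from hts], hs.1.le, hs.2.le⟩) (not_le.2 hts)
  · simp only [g]
    push_cast
    field_simp
    ring

section
variable {i j : Fin 3} {L : ℕ}

/-- In polar coordinates around `I / 2`, the `n`-th triangle of the fan fills the sector over the
part `[n - 1, n]` of the boundary of the half disc. -/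
theorem fanMap_eq (hL : 2 ≤ L) (hE : Even L) {n : ℕ} (hnL : n ≤ L)
    (p : stdSimplex ℝ (Fin 3)) :
    fanMap i j L n p = ((1 - rad i j p : ℝ) : ℂ) * (Complex.I / 2) +
      rad i j p * bdry L (n - 1 + frac i j n p) := by
  have f1 := frac_le_one (i := i) (j := j) n p
  have f2 := frac_nonneg (i := i) (j := j) n p
  have hL' : (2 : ℝ) ≤ L := by exact_mod_cast hL
  have hL1 : (0 : ℝ) < L - 1 := by linarith
  rw [fanMap]
  congr 1
  split_ifs with h
  · have h' : (n : ℝ) + 1 ≤ L := by exact_mod_cast h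
    rw [bdry, if_pos (by linarith), arcMap]
  · obtain rfl : n = L := by omega
    by_cases hr : rad i j p = 0
    · have := p.2.1 i
      have := p.2.1 j
      rw [rad] at hr
      have h1 : p.1 i = 0 := by linarith
      have h2 : p.1 j = 0 := by linarith
      simp [rad, h1, h2]
    · have e : bdry n (n - 1 + frac i j n p) = ((2 * frac i j n p - 1 : ℝ) : ℂ) := by
        rw [bdry]
        split_ifs with h3
        · have : frac i j n p = 0 := by linarith
          rw [this, add_zero, div_self hL1.ne', mul_one, Complex.exp_pi_mul_I]
          norm_num
        · congr 1
          ring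
      rw [e, ← Complex.ofReal_mul, frac, col_succ_of_even hE]
      congr 1
      field_simp
      rw [rad]
      ring

theorem time_mem {n : ℕ} (hn : 1 ≤ n) (hnL : n ≤ L) (p : stdSimplex ℝ (Fin 3)) :
    0 ≤ (n : ℝ) - 1 + frac i j n p ∧ (n : ℝ) - 1 + frac i j n p ≤ L := by
  have f1 := frac_le_one (i := i) (j := j) n p
  have f2 := frac_nonneg (i := i) (j := j) n p
  have hn' : (1 : ℝ) ≤ n := by exact_mod_cast hn
  have hL' : (n : ℝ) ≤ L := by exact_mod_cast hnL
  constructor <;> linarith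

theorem fanMap_mem (hij : i ≠ j) (hL : 2 ≤ L) (hE : Even L) {n : ℕ} (hn : 1 ≤ n) (hnL : n ≤ L)
    (p : stdSimplex ℝ (Fin 3)) : fanMap i j L n p ∈ halfDisc := by
  rw [fanMap_eq hL hE hnL]
  have ht := time_mem (i := i) (j := j) hn hnL p
  have := convex_halfDisc center_mem_halfDisc (bdry_cases hL ht.1 ht.2).1
    (sub_nonneg.2 (rad_le_one hij p)) (rad_nonneg p) (sub_add_cancel _ _)
  simpa [Complex.real_smul] using this

/-- Two points of the triangles of a cyclic fan have the same image exactly if they are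
identified: they are the center or lie on the common side of consecutive triangles. -/
theorem eq_of_fanMap_eq (hij : i ≠ j) (hL : 2 ≤ L) (hE : Even L) {n n' : ℕ} (hn : 1 ≤ n)
    (hnL : n ≤ L) (hn' : 1 ≤ n') (hnL' : n' ≤ L) {p p' : stdSimplex ℝ (Fin 3)}
    (h : fanMap i j L n p = fanMap i j L n' p') :
    p = p' ∧ ((p.1 i = 0 ∧ p.1 j = 0) ∨ n = n' ∨ (n' = n + 1 ∧ p.1 (col i j n) = 0) ∨
      (n = n' + 1 ∧ p.1 (col i j n') = 0) ∨ (n = L ∧ n' = 1 ∧ p.1 i = 0) ∨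
      (n' = L ∧ n = 1 ∧ p.1 i = 0)) := by
  wlog hle : n ≤ n' generalizing n n' p p'
  · obtain ⟨rfl, h2⟩ := this hn' hnL' hn hnL h.symm (by omega)
    refine ⟨rfl, ?_⟩
    rcases h2 with h2 | h2 | h2 | h2 | h2 | h2
    · exact Or.inl h2
    · exact Or.inr (Or.inl h2.symm)
    · exact Or.inr (Or.inr (Or.inr (Or.inl h2)))
    · exact Or.inr (Or.inr (Or.inl h2))
    · exact Or.inr (Or.inr (Or.inr (Or.inr (Or.inr h2))))
    · exact Or.inr (Or.inr (Or.inr (Or.inr (Or.inl h2))))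
  rw [fanMap_eq hL hE hnL, fanMap_eq hL hE hnL'] at h
  have ht := time_mem (i := i) (j := j) hn hnL p
  have ht' := time_mem (i := i) (j := j) hn' hnL' p'
  obtain ⟨hb, hb1⟩ := bdry_cases hL ht.1 ht.2
  obtain ⟨hb', hb1'⟩ := bdry_cases hL ht'.1 ht'.2
  obtain ⟨hr, hbb⟩ := radial_unique hb hb' hb1 hb1' (rad_nonneg p) (rad_nonneg p') h
  rcases (rad_nonneg (i := i) (j := j) p).eq_or_lt with h0 | h0
  · obtain ⟨h1, h2⟩ := eq_of_rad_eq_zero hij h0.symm (hr ▸ h0.symm)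
    exact ⟨h1, Or.inl h2⟩
  have f1 := frac_le_one (i := i) (j := j) n' p'
  have f2 := frac_nonneg (i := i) (j := j) n p
  have f3 := frac_nonneg (i := i) (j := j) n' p'
  have hnr : (1 : ℝ) ≤ n := by exact_mod_cast hn
  have hnr' : (n : ℝ) ≤ n' := by exact_mod_cast hle
  have hnL'' : (n' : ℝ) ≤ L := by exact_mod_cast hnL'
  rcases bdry_injective hL ht.1 ht.2 ht'.1 ht'.2 (hbb h0) with h1 | ⟨h1, h2⟩ | ⟨h1, h2⟩
  · obtain ⟨h2, h3⟩ := eq_of_polar_eq hij hr h0 (by linarith : (n : ℝ) + frac i j n p = _)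
    refine ⟨h2, ?_⟩
    rcases h3 with h3 | h3 | h3
    · exact Or.inr (Or.inl h3)
    · exact Or.inr (Or.inr (Or.inl h3))
    · exact Or.inr (Or.inr (Or.inr (Or.inl h3)))
  · have e1 : n = 1 := by
      have : (n : ℝ) = 1 := by linarith
      exact_mod_cast this
    have e2 : n' = L := by
      have : (n' : ℝ) = L := by linarith
      exact_mod_cast this
    subst e1 e2
    have g1 : frac i j 1 p = 0 := by push_cast at h1; linarith
    have g2 : frac i j n' p' = 1 := by linarith
    rw [frac, div_eq_zero_iff, show col i j (1 + 1) = i from rfl] at g1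
    have g1' := g1.resolve_right h0.ne'
    rw [frac, div_eq_one_iff_eq (hr ▸ h0.ne'), col_succ_of_even hE, rad] at g2
    rw [rad, rad] at hr
    exact ⟨simplex_ext hij (by linarith) (by linarith),
      Or.inr (Or.inr (Or.inr (Or.inr (Or.inr ⟨rfl, rfl, g1'⟩))))⟩
  · have hL' : (2 : ℝ) ≤ L := by exact_mod_cast hL
    linarith [frac_le_one (i := i) (j := j) n p]

theorem exists_fanMap_eq (hij : i ≠ j) (hL : 2 ≤ L) (hE : Even L) {z : ℂ} (hz : z ∈ halfDisc) :
    ∃ n, 1 ≤ n ∧ n ≤ L ∧ ∃ p, fanMap i j L n p = z := by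
  obtain ⟨r, b, h0, h1, hb, hb', rfl⟩ := exists_radial hz
  obtain ⟨t, ht0, ht1, rfl⟩ := exists_bdry hL hb hb'
  obtain ⟨n, hn, hnL, p, hr, hp⟩ := exists_polar hij (by omega : 1 ≤ L) h0 h1 ht0 ht1
  refine ⟨n, hn, hnL, p, ?_⟩
  rw [fanMap_eq hL hE hnL, hr]
  rcases h0.eq_or_lt with rfl | hpos
  · simp
  · rw [hp hpos]

theorem eq_of_arcMap_eq {L' : ℕ} {n n' : ℕ} (hn : 1 ≤ n)
    (hnL : n < L) (hn' : 1 ≤ n') (hnL' : n' < L') {p p' : stdSimplex ℝ (Fin 3)}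
    (h : arcMap i j L n p = arcMap i j L' n' p') :
    rad i j p = rad i j p' ∧ (0 < rad i j p →
      ((n : ℝ) - 1 + frac i j n p) / (L - 1) = (n' - 1 + frac i j n' p') / (L' - 1)) := by
  have hr : rad i j p = rad i j p' := by rw [← norm_arcMap L n p, h, norm_arcMap]
  refine ⟨hr, fun h0 => ?_⟩
  rw [arcMap, arcMap, ← hr] at h
  have h1 := exp_injOn (angle_mem hn hnL (frac_nonneg n p) (frac_le_one n p))
    (angle_mem hn' hnL' (frac_nonneg n' p') (frac_le_one n' p'))
    (mul_left_cancel₀ (Complex.ofReal_ne_zero.2 h0.ne') h)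
  exact mul_left_cancel₀ Real.pi_pos.ne' h1

theorem exists_arcMap_eq (hij : i ≠ j) (hL : 2 ≤ L) {z : ℂ} (hz : z ∈ halfDisc) :
    ∃ n, 1 ≤ n ∧ n < L ∧ ∃ p, arcMap i j L n p = z := by
  have hL' : (2 : ℝ) ≤ L := by exact_mod_cast hL
  have hL1 : (0 : ℝ) < L - 1 := by linarith
  have ha0 : 0 ≤ z.arg := Complex.arg_nonneg_iff.2 hz.2
  have ha1 := Complex.arg_le_pi z
  have hle : z.arg / Real.pi * (L - 1) ≤ (L - 1 : ℕ) := by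
    rw [Nat.cast_sub (by omega), Nat.cast_one]
    exact mul_le_of_le_one_left hL1.le ((div_le_one Real.pi_pos).2 ha1)
  obtain ⟨n, hn, hnL, p, hr, hp⟩ := exists_polar hij (by omega : 1 ≤ L - 1) (norm_nonneg z) hz.1
    (mul_nonneg (div_nonneg ha0 Real.pi_pos.le) hL1.le) hle
  refine ⟨n, hn, by omega, p, ?_⟩
  rcases (norm_nonneg z).eq_or_lt with h0 | hpos
  · rw [arcMap, hr, ← h0, norm_eq_zero.1 h0.symm]
    simp
  · rw [arcMap, hr, hp hpos, mul_div_cancel_right₀ _ hL1.ne', mul_div_cancel₀ _ Real.pi_pos.ne']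
    exact Complex.norm_mul_exp_arg_mul_I z

end

end ColoredGraph

/-! ### Two-colored cycles and their fans -/

namespace ColoredGraph

section
variable {Γ : ColoredGraph 2} {i j : Fin 3} {u : Γ.V}

variable (Γ i j u) in
/-- The walk from `u` along the edges of colors `i`, `j`, `i`, `j`, … -/
def walk : ℕ → Γ.V
  | 0 => u
  | n + 1 => Γ.adj (col i j n) (walk n)

theorem walk_zero : Γ.walk i j u 0 = u := rfl

theorem walk_succ (n : ℕ) : Γ.walk i j u (n + 1) = Γ.adj (col i j n) (Γ.walk i j u n) := rfl

theorem adj_walk_succ (n : ℕ) : Γ.adj (col i j n) (Γ.walk i j u (n + 1)) = Γ.walk i j u n := by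
  rw [walk_succ, Γ.adj_adj]

theorem col_mem (n : ℕ) : col i j n ∈ ({i, j} : Set (Fin 3)) := by
  rcases col_cases (i := i) (j := j) n with h | h <;> simp [h.1]

theorem col_add_even (m k : ℕ) : col i j (m + 2 * k) = col i j m := by
  induction k with
  | zero => rfl
  | succ k ih => rw [mul_add, ← add_assoc, mul_one, col_add_two, ih]

theorem comp_walk (n : ℕ) : Γ.comp {i, j} (Γ.walk i j u n) = Γ.comp {i, j} u := by
  induction n with
  | zero => rfl
  | succ n ih => rw [walk_succ, Γ.comp_adj (col_mem n), ih]

/-- No vertex is met twice with different parities: otherwise going on from both visits in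
opposite directions leads to an edge with equal ends. -/
theorem walk_ne_of_odd (k : ℕ) : ∀ m, Γ.walk i j u m ≠ Γ.walk i j u (m + (2 * k + 1)) := by
  induction k with
  | zero =>
    intro m h
    exact Γ.adj_ne (col i j m) _ h.symm
  | succ k ih =>
    intro m h
    refine ih (m + 1) ?_
    rw [walk_succ, h, show m + (2 * (k + 1) + 1) = (m + 2 * (k + 1)) + 1 by ring,
      ← col_add_even m (k + 1), adj_walk_succ]
    congr 1
    ring

theorem walk_even_of_eq (k : ℕ) : ∀ m, Γ.walk i j u m = Γ.walk i j u (m + 2 * k) →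
    Γ.walk i j u (2 * k) = u := by
  intro m
  induction m with
  | zero =>
    intro h
    rw [zero_add] at h
    exact h.symm
  | succ m ih =>
    intro h
    refine ih ?_
    rw [← adj_walk_succ m, h, ← col_add_even m k, ← adj_walk_succ (m + 2 * k)]
    congr 2
    ring

variable (Γ i j u) in
/-- The walk from `u` returns to `u` after an even number `L` of steps, meets no vertex twice before
that, and covers the whole component of `u`. -/
theorem exists_cycle : ∃ L, 2 ≤ L ∧ Even L ∧ Γ.walk i j u L = u ∧
    (∀ m n, m < L → n < L → Γ.walk i j u m = Γ.walk i j u n → m = n) ∧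
    ∀ w, Γ.comp {i, j} w = Γ.comp {i, j} u → ∃ n < L, Γ.walk i j u n = w := by
  classical
  -- by finiteness, some vertex is met twice at even times; going back, so is `u`
  have hex : ∃ k, 0 < k ∧ Γ.walk i j u (2 * k) = u := by
    obtain ⟨a, b, hab, h⟩ := Finite.exists_ne_map_eq_of_infinite fun n => Γ.walk i j u (2 * n)
    wlog hlt : a < b generalizing a b
    · exact this b a hab.symm h.symm (by omega)
    refine ⟨b - a, by omega, walk_even_of_eq (b - a) (2 * a) ?_⟩
    rw [← mul_add, Nat.add_sub_cancel' hlt.le]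
    exact h
  obtain ⟨hk0, hk⟩ := Nat.find_spec hex
  have hmin := fun m => Nat.find_min hex (m := m)
  set k := Nat.find hex
  refine ⟨2 * k, by omega, even_two_mul k, hk, ?_, ?_⟩
  · intro m n hm hn h
    wlog hlt : m < n generalizing m n
    · rcases (not_lt.1 hlt).eq_or_lt with h' | h'
      · exact h'.symm
      · exact (this n m hn hm h.symm h').symm
    exfalso
    obtain ⟨d, rfl⟩ := Nat.exists_eq_add_of_lt hlt
    rcases Nat.even_or_odd' (d + 1) with ⟨e, he | he⟩
    · rw [add_assoc, he] at h
      exact hmin e (by omega) ⟨by omega, walk_even_of_eq e m h⟩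
    · rw [add_assoc, he] at h
      exact walk_ne_of_odd e m h
  -- the vertices that are met are closed under both colors
  · intro w hw
    have key : ∀ c ∈ ({i, j} : Set (Fin 3)), ∀ v, (∃ n < 2 * k, Γ.walk i j u n = v) →
        ∃ n < 2 * k, Γ.walk i j u n = Γ.adj c v := by
      rintro c hc _ ⟨n, hn, rfl⟩
      by_cases h : c = col i j n
      · subst h
        by_cases hn' : n + 1 < 2 * k
        · exact ⟨n + 1, hn', rfl⟩
        · refine ⟨0, by omega, ?_⟩
          rw [walk_zero, ← walk_succ, show n + 1 = 2 * k by omega, hk]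
      · have hc' : c = col i j (n + 1) := by
          rcases col_cases (i := i) (j := j) n with ⟨e, e'⟩ | ⟨e, e'⟩ <;>
            rcases hc with hc | hc <;> simp_all
        subst hc'
        rcases n with _ | n
        · refine ⟨2 * k - 1, by omega, ?_⟩
          have := adj_walk_succ (Γ := Γ) (i := i) (j := j) (u := u) (2 * k - 1)
          rw [Nat.sub_add_cancel (by omega), hk] at this
          rw [← this, walk_zero]
          congr 1
          rw [← col_add_even 1 (k - 1)]
          congr 1
          omega
        · refine ⟨n, by omega, ?_⟩
          rw [col_add_two, adj_walk_succ]
    have := eq_of_comp_eq (fun v => ∃ n < 2 * k, Γ.walk i j u n = v) (fun c hc v => propext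
      ⟨fun h => by simpa only [Γ.adj_adj] using key c hc _ h, key c hc v⟩) hw
    exact this.mpr ⟨0, by omega, rfl⟩

variable (Γ i j u) in
/-- The length of the cycle with colors `i` and `j` through `u`. -/
noncomputable def period : ℕ := (Γ.exists_cycle i j u).choose

theorem two_le_period : 2 ≤ Γ.period i j u := (Γ.exists_cycle i j u).choose_spec.1

theorem even_period : Even (Γ.period i j u) := (Γ.exists_cycle i j u).choose_spec.2.1

theorem walk_period : Γ.walk i j u (Γ.period i j u) = u :=
  (Γ.exists_cycle i j u).choose_spec.2.2.1

theorem walk_injOn {m n : ℕ} (hm1 : 1 ≤ m) (hm : m ≤ Γ.period i j u) (hn1 : 1 ≤ n)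
    (hn : n ≤ Γ.period i j u) (h : Γ.walk i j u m = Γ.walk i j u n) : m = n := by
  have hinj := (Γ.exists_cycle i j u).choose_spec.2.2.2.1
  have h2 := two_le_period (Γ := Γ) (i := i) (j := j) (u := u)
  rcases hm.eq_or_lt with rfl | hm' <;> rcases hn.eq_or_lt with rfl | hn'
  · rfl
  · have := hinj 0 n (two_pos.trans_le h2) hn' (by rw [← h, walk_period]; rfl)
    omega
  · have := hinj m 0 hm' (two_pos.trans_le h2) (by rw [h, walk_period]; rfl)
    omega
  · exact hinj m n hm' hn' h

theorem exists_walk_eq {w : Γ.V} (hw : Γ.comp {i, j} w = Γ.comp {i, j} u) :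
    ∃ n, 1 ≤ n ∧ n ≤ Γ.period i j u ∧ Γ.walk i j u n = w := by
  have h2 := two_le_period (Γ := Γ) (i := i) (j := j) (u := u)
  obtain ⟨n, hn, rfl⟩ := (Γ.exists_cycle i j u).choose_spec.2.2.2.2 w hw
  change n < Γ.period i j u at hn
  rcases n with _ | n
  · exact ⟨_, by omega, le_rfl, walk_period⟩
  · exact ⟨n + 1, by omega, hn.le, rfl⟩

variable (i j u) in
open Classical in
/-- The position of a vertex on the cycle through `u`, where `u` itself comes last. -/
noncomputable def idx (w : Γ.V) : ℕ :=
  if hw : Γ.comp {i, j} w = Γ.comp {i, j} u then (exists_walk_eq hw).choose else 0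

theorem idx_spec {w : Γ.V} (hw : Γ.comp {i, j} w = Γ.comp {i, j} u) :
    1 ≤ idx i j u w ∧ idx i j u w ≤ Γ.period i j u ∧ Γ.walk i j u (idx i j u w) = w := by
  rw [idx, dif_pos hw]
  exact (exists_walk_eq hw).choose_spec

theorem idx_walk {n : ℕ} (h1 : 1 ≤ n) (h2 : n ≤ Γ.period i j u) :
    idx i j u (Γ.walk i j u n) = n := by
  obtain ⟨a, b, c⟩ := idx_spec (i := i) (j := j) (u := u) (comp_walk n)
  exact walk_injOn a b h1 h2 c

theorem idx_self : idx i j u u = Γ.period i j u := by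
  have h2 := two_le_period (Γ := Γ) (i := i) (j := j) (u := u)
  conv_lhs => rw [← walk_period (Γ := Γ) (i := i) (j := j) (u := u)]
  rw [walk_period]
  have := idx_walk (Γ := Γ) (i := i) (j := j) (u := u) (n := Γ.period i j u) (by omega) le_rfl
  rwa [walk_period] at this

theorem idx_eq_period {w : Γ.V} (hw : Γ.comp {i, j} w = Γ.comp {i, j} u) :
    idx i j u w = Γ.period i j u ↔ w = u := by
  constructor
  · intro h
    have := (idx_spec hw).2.2
    rw [h, walk_period] at this
    exact this.symm
  · rintro rfl
    exact idx_self

variable (i j u) in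
/-- The map from the fan of triangles around a two-colored cycle to the half disc. -/
noncomputable def fan (w : Γ.V) (p : stdSimplex ℝ (Fin 3)) : ℂ :=
  fanMap i j (Γ.period i j u) (idx i j u w) p

theorem fan_mem (hij : i ≠ j) {w : Γ.V} (hw : Γ.comp {i, j} w = Γ.comp {i, j} u)
    (p : stdSimplex ℝ (Fin 3)) : fan i j u w p ∈ halfDisc :=
  fanMap_mem hij two_le_period even_period (idx_spec hw).1 (idx_spec hw).2.1 p

/-- The neighbors of a vertex on the cycle precede and follow it. -/
theorem adj_cases {w : Γ.V} (hw : Γ.comp {i, j} w = Γ.comp {i, j} u)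
    {c : Fin 3} (hc : c ∈ ({i, j} : Set (Fin 3))) :
    (c = col i j (idx i j u w) ∧ idx i j u w < Γ.period i j u ∧
      idx i j u (Γ.adj c w) = idx i j u w + 1) ∨
    (c = i ∧ idx i j u w = Γ.period i j u ∧ idx i j u (Γ.adj c w) = 1) ∨
    (c = col i j (idx i j u (Γ.adj c w)) ∧ idx i j u (Γ.adj c w) < Γ.period i j u ∧
      idx i j u w = idx i j u (Γ.adj c w) + 1) ∨
    (c = i ∧ idx i j u (Γ.adj c w) = Γ.period i j u ∧ idx i j u w = 1) := by
  obtain ⟨h1, h2, h3⟩ := idx_spec hw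
  have hL := two_le_period (Γ := Γ) (i := i) (j := j) (u := u)
  set n := idx i j u w
  by_cases h : c = col i j n
  · have hadj : Γ.adj c w = Γ.walk i j u (n + 1) := by rw [walk_succ, h3, h]
    rcases h2.eq_or_lt with h2 | h2
    · right; left
      have hc : c = i := by rw [h, h2, col_of_even even_period]
      have : Γ.adj c w = Γ.walk i j u 1 := by
        rw [hc, ← h3, h2, walk_period]
        rfl
      exact ⟨hc, h2, by rw [this, idx_walk le_rfl (by omega)]⟩
    · left
      exact ⟨h, h2, by rw [hadj, idx_walk (by omega) (by omega)]⟩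
  · right; right
    have hc' : c = col i j (n + 1) := by
      rcases col_cases (i := i) (j := j) n with ⟨e, e'⟩ | ⟨e, e'⟩ <;>
        rcases hc with hc | hc <;> simp_all
    obtain ⟨m, hm⟩ : ∃ m, n = m + 1 := ⟨n - 1, by omega⟩
    have hcm : c = col i j m := by rw [hc', hm, col_add_two]
    have hadj : Γ.adj c w = Γ.walk i j u m := by rw [← h3, hm, hcm, adj_walk_succ]
    rcases Nat.eq_zero_or_pos m with rfl | hpos
    · right
      exact ⟨hcm, by rw [hadj, walk_zero, idx_self], hm⟩
    · left
      have : idx i j u (Γ.adj c w) = m := by rw [hadj, idx_walk hpos (by omega)]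
      exact ⟨by rw [this, hcm], by omega, by omega⟩

theorem fan_adj {w : Γ.V} (hw : Γ.comp {i, j} w = Γ.comp {i, j} u)
    {c : Fin 3} (hc : c ∈ ({i, j} : Set (Fin 3))) {p : stdSimplex ℝ (Fin 3)} (hp : p.1 c = 0) :
    fan i j u (Γ.adj c w) p = fan i j u w p := by
  have hw' : Γ.comp {i, j} (Γ.adj c w) = Γ.comp {i, j} u := by rw [Γ.comp_adj hc, hw]
  obtain ⟨h1, -, -⟩ := idx_spec hw
  obtain ⟨h1', -, -⟩ := idx_spec hw'
  rw [fan, fan]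
  rcases adj_cases hw hc with ⟨a, b, e⟩ | ⟨a, b, e⟩ | ⟨a, b, e⟩ | ⟨a, b, e⟩
  · rw [e]
    exact (fanMap_succ h1 b even_period (a ▸ hp)).symm
  · rw [e, b]
    exact (fanMap_last two_le_period (a ▸ hp)).symm
  · rw [e]
    refine fanMap_succ h1' b even_period ?_
    rwa [← a]
  · rw [e, b]
    exact fanMap_last two_le_period (a ▸ hp)

/-- The map to the half disc identifies exactly those points of the fan around the corner
opposite to the side `i j` that are identified in the carrier by edges of colors `i` and `j`. -/
theorem fan_eq_iff (hij : i ≠ j) {w w' : Γ.V} (hw : Γ.comp {i, j} w = Γ.comp {i, j} u)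
    (hw' : Γ.comp {i, j} w' = Γ.comp {i, j} u) {p p' : stdSimplex ℝ (Fin 3)} :
    fan i j u w p = fan i j u w' p' ↔
      p = p' ∧ Γ.comp (zeros p ∩ {i, j}) w = Γ.comp (zeros p ∩ {i, j}) w' := by
  classical
  constructor
  · intro h
    obtain ⟨a1, a2, a3⟩ := idx_spec hw
    obtain ⟨b1, b2, b3⟩ := idx_spec hw'
    obtain ⟨h1, h2⟩ := eq_of_fanMap_eq hij two_le_period even_period a1 a2 b1 b2 h
    subst h1
    refine ⟨rfl, ?_⟩
    rcases h2 with ⟨c1, c2⟩ | h2 | ⟨c1, c2⟩ | ⟨c1, c2⟩ | ⟨c1, c2, c3⟩ | ⟨c1, c2, c3⟩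
    · have : zeros p ∩ {i, j} = {i, j} := by
        refine inter_eq_right.2 ?_
        rintro k (rfl | rfl)
        · exact c1
        · exact c2
      rw [this, hw, hw']
    · rw [← a3, h2, b3]
    · rw [← a3, ← b3, c1, walk_succ, Γ.comp_adj]
      exact ⟨c2, col_mem _⟩
    · rw [← a3, ← b3, c1, walk_succ, Γ.comp_adj]
      exact ⟨c2, col_mem _⟩
    · rw [← a3, ← b3, c1, c2, walk_period, walk_succ, walk_zero, col_zero, Γ.comp_adj]
      exact ⟨c3, Or.inl rfl⟩
    · rw [← a3, ← b3, c1, c2, walk_period, walk_succ, walk_zero, col_zero, Γ.comp_adj]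
      exact ⟨c3, Or.inl rfl⟩
  · rintro ⟨rfl, h⟩
    have := eq_of_comp_eq
      (fun v => if Γ.comp {i, j} v = Γ.comp {i, j} u then fan i j u v p else 0)
      (fun c hc v => by
        simp only [Γ.comp_adj hc.2]
        split_ifs with hv
        · exact fan_adj hv hc.2 hc.1
        · rfl) h
    simpa [hw, hw'] using this

theorem continuous_fan (w : Γ.V) : Continuous (fan i j u w) := continuous_fanMap _ _

theorem exists_fan_eq (hij : i ≠ j) {z : ℂ} (hz : z ∈ halfDisc) :
    ∃ w p, Γ.comp {i, j} w = Γ.comp {i, j} u ∧ fan i j u w p = z := by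
  obtain ⟨n, h1, h2, p, hp⟩ := exists_fanMap_eq hij two_le_period even_period hz
  exact ⟨Γ.walk i j u n, p, comp_walk n, by rw [fan, idx_walk h1 h2, hp]⟩

/-- Maps on the triangles of a fan that agree on common sides define a map on the half disc. -/
theorem exists_fan_lift (hij : i ≠ j) {X : Type*} [TopologicalSpace X]
    (f : Γ.V → stdSimplex ℝ (Fin 3) → X) (hf : ∀ w, Continuous (f w))
    (hadj : ∀ c ∈ ({i, j} : Set (Fin 3)), ∀ w p, p.1 c = 0 → f (Γ.adj c w) p = f w p) :
    ∃ Ξ : C(halfDisc, X), ∀ w p (hw : Γ.comp {i, j} w = Γ.comp {i, j} u),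
      Ξ ⟨fan i j u w p, fan_mem hij hw p⟩ = f w p := by
  let F : C((Σ _ : {w : Γ.V // Γ.comp {i, j} w = Γ.comp {i, j} u}, stdSimplex ℝ (Fin 3)),
      halfDisc) := ⟨fun x => ⟨fan i j u x.1.1 x.2, fan_mem hij x.1.2 x.2⟩,
        continuous_sigma fun w => (continuous_fan w.1).subtype_mk _⟩
  let G : C((Σ _ : {w : Γ.V // Γ.comp {i, j} w = Γ.comp {i, j} u}, stdSimplex ℝ (Fin 3)), X) :=
    ⟨fun x => f x.1.1 x.2, continuous_sigma fun w => hf w.1⟩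
  -- the union of the triangles is compact, so that the map to the half disc is closed
  have hF : IsQuotientMap F := by
    refine F.continuous.isClosedMap.isQuotientMap F.continuous ?_
    rintro ⟨z, hz⟩
    obtain ⟨w, p, hw, rfl⟩ := exists_fan_eq (u := u) hij hz
    exact ⟨⟨⟨w, hw⟩, p⟩, rfl⟩
  have hfac : Function.FactorsThrough G F := by
    rintro ⟨⟨w, hw⟩, p⟩ ⟨⟨w', hw'⟩, p'⟩ h
    obtain ⟨h1, h2⟩ := (fan_eq_iff hij hw hw').1 (congrArg Subtype.val h)
    subst h1
    exact eq_of_comp_eq (fun v => f v p) (fun c hc v => hadj c hc.2 v p hc.1) h2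
  refine ⟨hF.lift G hfac, fun w p hw => ?_⟩
  exact DFunLike.congr_fun (hF.lift_comp G hfac) (⟨⟨w, hw⟩, p⟩ : Σ _ : _, _)

end

end ColoredGraph

/-! ### Cancellation of a 1-dipole -/

namespace ColoredGraph

section
variable {d : ℕ}

open Classical in
/-- The graph obtained by deleting two vertices and joining the loose ends of equal colors. -/
noncomputable def removePair (Γ : ColoredGraph d) (u v : Γ.V) (huv : u ≠ v) : ColoredGraph d where
  V := {w : Γ.V // w ≠ u ∧ w ≠ v}
  finite_V := inferInstance
  adj k w := ⟨if Γ.adj k w.1 = u then Γ.adj k v else if Γ.adj k w.1 = v then Γ.adj k u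
      else Γ.adj k w.1, by
    have hw := w.2
    split_ifs with h1 h2
    · refine ⟨fun h => hw.2 ?_, Γ.adj_ne k v⟩
      rw [← Γ.adj_adj k w.1, h1, ← h, Γ.adj_adj]
    · refine ⟨Γ.adj_ne k u, fun h => hw.1 ?_⟩
      rw [← Γ.adj_adj k w.1, h2, ← h, Γ.adj_adj]
    · exact ⟨h1, h2⟩⟩
  adj_adj k w := by
    apply Subtype.ext
    dsimp only
    by_cases h1 : Γ.adj k w.1 = u
    · have hw : w.1 = Γ.adj k u := (Γ.adj_adj k w.1).symm.trans (congrArg (Γ.adj k) h1)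
      simp [hw, Γ.adj_adj, huv.symm]
    · by_cases h2 : Γ.adj k w.1 = v
      · have hw : w.1 = Γ.adj k v := (Γ.adj_adj k w.1).symm.trans (congrArg (Γ.adj k) h2)
        simp [hw, Γ.adj_adj, huv.symm]
      · simp [h1, h2, Γ.adj_adj, w.2.1, w.2.2]
  adj_ne k w := by
    intro h
    have h := congrArg Subtype.val h
    dsimp only at h
    split_ifs at h with h1 h2
    · rw [← h, Γ.adj_adj] at h1
      exact huv h1.symm
    · rw [← h, Γ.adj_adj] at h2
      exact huv h2
    · exact Γ.adj_ne k _ h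

variable {Γ : ColoredGraph d} {u v : Γ.V} {huv : u ≠ v}

theorem removePair_adj_left {k : Fin (d + 1)} {w : (Γ.removePair u v huv).V}
    (h : Γ.adj k w.1 = u) : ((Γ.removePair u v huv).adj k w).1 = Γ.adj k v := if_pos h

theorem removePair_adj_right {k : Fin (d + 1)} {w : (Γ.removePair u v huv).V}
    (h : Γ.adj k w.1 = v) : ((Γ.removePair u v huv).adj k w).1 = Γ.adj k u := by
  have : Γ.adj k w.1 ≠ u := fun h' => huv (h'.symm.trans h)
  exact (if_neg this).trans (if_pos h)

theorem removePair_adj_other {k : Fin (d + 1)} {w : (Γ.removePair u v huv).V}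
    (h : Γ.adj k w.1 ≠ u) (h' : Γ.adj k w.1 ≠ v) :
    ((Γ.removePair u v huv).adj k w).1 = Γ.adj k w.1 :=
  (if_neg h).trans (if_neg h')

theorem removePair_comp_eq_of_adj {k : Fin (d + 1)} {S : Set (Fin (d + 1))} (hk : k ∈ S)
    {w w' : (Γ.removePair u v huv).V} (h : w'.1 = Γ.adj k w.1) :
    (Γ.removePair u v huv).comp S w = (Γ.removePair u v huv).comp S w' := by
  have : (Γ.removePair u v huv).adj k w = w' := Subtype.ext (by
    rw [removePair_adj_other (by rw [← h]; exact w'.2.1) (by rw [← h]; exact w'.2.2), h])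
  rw [← this, comp_adj _ hk]

theorem removePair_comp_eq_of_cut {k : Fin (d + 1)} {S : Set (Fin (d + 1))} (hk : k ∈ S)
    {w w' : (Γ.removePair u v huv).V} (h : Γ.adj k u = w.1) (h' : Γ.adj k v = w'.1) :
    (Γ.removePair u v huv).comp S w = (Γ.removePair u v huv).comp S w' := by
  have : (Γ.removePair u v huv).adj k w = w' := Subtype.ext (by
    rw [removePair_adj_left (by rw [← h, Γ.adj_adj]), h'])
  rw [← this, comp_adj _ hk]

end

section
variable {Γ : ColoredGraph 2} {i j : Fin 3}

/-- The map from the half disc to the carrier that covers the fan of a two-colored cycle. -/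
noncomputable def fanInv (hij : i ≠ j) (a : Γ.V) : C(halfDisc, Γ.Carrier) :=
  (exists_fan_lift (u := a) hij Γ.point continuous_point (fun _ _ w _ hp => point_adj hp w)).choose

theorem fanInv_fan (hij : i ≠ j) {a w : Γ.V} (hw : Γ.comp {i, j} w = Γ.comp {i, j} a)
    (p : stdSimplex ℝ (Fin 3)) :
    fanInv hij a ⟨fan i j a w p, fan_mem hij hw p⟩ = Γ.point w p :=
  (exists_fan_lift (u := a) hij Γ.point continuous_point
    (fun _ _ w _ hp => point_adj hp w)).choose_spec w p hw

theorem exists_of_fanInv_eq (hij : i ≠ j) {a y : Γ.V} {q : stdSimplex ℝ (Fin 3)} {z : halfDisc}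
    (h : fanInv hij a z = Γ.point y q) : ∃ w, Γ.comp {i, j} w = Γ.comp {i, j} a ∧
      fan i j a w q = z.1 ∧ Γ.comp (zeros q) w = Γ.comp (zeros q) y := by
  obtain ⟨w, p, hw, hz⟩ := exists_fan_eq (u := a) hij z.2
  have hz' : z = ⟨fan i j a w p, fan_mem hij hw p⟩ := Subtype.ext hz.symm
  rw [hz', fanInv_fan hij hw, point_eq_iff] at h
  obtain ⟨rfl, h⟩ := h
  exact ⟨w, hw, hz, h⟩

open Classical in
/-- The map from a fan with the triangle of `a` left out to the carrier that covers also that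
triangle, and moves no point on the outer sides. -/
noncomputable def blow (hij : i ≠ j) (a w : Γ.V) (p : stdSimplex ℝ (Fin 3)) : Γ.Carrier :=
  if h : arcMap i j (Γ.period i j a) (idx i j a w) p ∈ halfDisc then fanInv hij a ⟨_, h⟩
  else Γ.point w p

theorem idx_lt {a w : Γ.V} (hw : Γ.comp {i, j} w = Γ.comp {i, j} a) (hne : w ≠ a) :
    idx i j a w < Γ.period i j a :=
  (idx_spec hw).2.1.lt_of_ne fun h => hne ((idx_eq_period hw).1 h)

theorem arc_mem (hij : i ≠ j) {a w : Γ.V} (hw : Γ.comp {i, j} w = Γ.comp {i, j} a) (hne : w ≠ a)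
    (p : stdSimplex ℝ (Fin 3)) : arcMap i j (Γ.period i j a) (idx i j a w) p ∈ halfDisc :=
  arcMap_mem hij (idx_spec hw).1 (idx_lt hw hne) p

theorem blow_eq (hij : i ≠ j) {a w : Γ.V} (hw : Γ.comp {i, j} w = Γ.comp {i, j} a) (hne : w ≠ a)
    (p : stdSimplex ℝ (Fin 3)) : blow hij a w p = fanInv hij a ⟨_, arc_mem hij hw hne p⟩ :=
  dif_pos _

theorem continuous_blow (hij : i ≠ j) {a w : Γ.V} (hw : Γ.comp {i, j} w = Γ.comp {i, j} a)
    (hne : w ≠ a) : Continuous (blow hij a w) := by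
  have : blow hij a w = fun p => fanInv hij a ⟨_, arc_mem hij hw hne p⟩ :=
    funext fun p => blow_eq hij hw hne p
  rw [this]
  exact (fanInv hij a).continuous.comp ((continuous_arcMap _ _).subtype_mk _)

theorem fan_self {a : Γ.V} {p : stdSimplex ℝ (Fin 3)} (hp : rad i j p = 1) :
    fan i j a a p = ((p.1 j - p.1 i : ℝ) : ℂ) := by
  rw [fan, idx_self, fanMap, if_neg (lt_irrefl _), hp]
  simp

theorem fan_of_ne {a w : Γ.V} (hw : Γ.comp {i, j} w = Γ.comp {i, j} a) (hne : w ≠ a)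
    {p : stdSimplex ℝ (Fin 3)} (hp : rad i j p = 1) :
    fan i j a w p = arcMap i j (Γ.period i j a) (idx i j a w) p := by
  rw [fan, fanMap, if_pos (idx_lt hw hne), hp]
  simp

theorem norm_fan_of_ne {a w : Γ.V} (hw : Γ.comp {i, j} w = Γ.comp {i, j} a) (hne : w ≠ a)
    {p : stdSimplex ℝ (Fin 3)} (hp : rad i j p = 1) : ‖fan i j a w p‖ = 1 := by
  rw [fan_of_ne hw hne hp, norm_arcMap, hp]

theorem blow_of_rad_eq_one (hij : i ≠ j) {a w : Γ.V} (hw : Γ.comp {i, j} w = Γ.comp {i, j} a)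
    (hne : w ≠ a) {p : stdSimplex ℝ (Fin 3)} (hp : rad i j p = 1) :
    blow hij a w p = Γ.point w p := by
  rw [blow_eq hij hw hne, ← fanInv_fan hij hw]
  congr 1
  exact Subtype.ext (fan_of_ne hw hne hp).symm

theorem exists_simplex_real (hij : i ≠ j) {t : ℝ} (h : |t| ≤ 1) :
    ∃ p : stdSimplex ℝ (Fin 3), rad i j p = 1 ∧ p.1 j - p.1 i = t := by
  rw [abs_le] at h
  obtain ⟨n, hn, hn1, p, hr, hp⟩ := exists_polar (i := i) (j := j) hij le_rfl zero_le_one le_rfl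
    (by linarith : 0 ≤ (1 - t) / 2) (by push_cast; linarith)
  obtain rfl : n = 1 := by omega
  refine ⟨p, hr, ?_⟩
  have := hp one_pos
  rw [frac, hr, show col i j (1 + 1) = i from rfl] at this
  push_cast at this
  rw [rad] at hr
  linarith

/-- Across the diameter, the fans of two triangles with a common side fit together. -/
theorem fanInv_real (hij : i ≠ j) {c : Fin 3} (hic : i ≠ c) (hjc : j ≠ c) (a : Γ.V) {z : halfDisc}
    (hz : z.1.im = 0) : fanInv hij (Γ.adj c a) z = fanInv hij a z := by
  have hre : z.1 = (z.1.re : ℂ) := Complex.ext rfl hz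
  have habs : |z.1.re| ≤ 1 := by
    have := z.2.1
    rwa [hre, Complex.norm_real, Real.norm_eq_abs] at this
  obtain ⟨p, hp, ht⟩ := exists_simplex_real hij habs
  have hpc : p.1 c = 0 := by
    have := sum_coords hij hic hjc p
    rw [rad] at hp
    linarith
  have hz' : ∀ b : Γ.V, z = ⟨fan i j b b p, fan_mem hij rfl p⟩ := fun b =>
    Subtype.ext (by change z.1 = fan i j b b p; rw [fan_self hp, ht]; exact hre)
  have h1 := fanInv_fan hij (a := Γ.adj c a) rfl p
  have h2 := fanInv_fan hij (a := a) rfl p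
  rw [← hz'] at h1 h2
  rw [h1, h2, point_adj hpc]

end

end ColoredGraph

namespace ColoredGraph

section
variable (Γ : ColoredGraph 2) (c : Fin 3) (u : Γ.V)

/-- The graph obtained by deleting the edge of color `c` at `u` and joining the loose ends of equal
colors. -/
noncomputable def cancel : ColoredGraph 2 := Γ.removePair u (Γ.adj c u) (Γ.adj_ne c u).symm

variable {Γ c u} {i j : Fin 3}

/-- The vertex `a` is an end of the edge of color `c` at `u`. -/
def IsEnd (c : Fin 3) (u a : Γ.V) : Prop := a = u ∨ a = Γ.adj c u

theorem IsEnd.adj {a : Γ.V} (ha : IsEnd c u a) : IsEnd c u (Γ.adj c a) := by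
  rcases ha with rfl | rfl
  · exact Or.inr rfl
  · exact Or.inl (Γ.adj_adj _ _)

theorem IsEnd.eq_or {a b : Γ.V} (ha : IsEnd c u a) (hb : IsEnd c u b) :
    b = a ∨ b = Γ.adj c a := by
  rcases ha with rfl | rfl
  · exact hb
  · rw [Γ.adj_adj]
    exact hb.symm

theorem IsEnd.comp_ne {a : Γ.V} (ha : IsEnd c u a)
    (hne : Γ.comp {i, j} u ≠ Γ.comp {i, j} (Γ.adj c u)) :
    Γ.comp {i, j} a ≠ Γ.comp {i, j} (Γ.adj c a) := by
  rcases ha with rfl | rfl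
  · exact hne
  · rw [Γ.adj_adj]
    exact hne.symm

theorem cancel_ne {a : Γ.V} (ha : IsEnd c u a) (w : (Γ.cancel c u).V) : w.1 ≠ a := by
  rcases ha with rfl | rfl
  · exact w.2.1
  · exact w.2.2

theorem cancel_adj_end {a : Γ.V} (ha : IsEnd c u a) {k : Fin 3} {w : (Γ.cancel c u).V}
    (h : Γ.adj k w.1 = a) : ((Γ.cancel c u).adj k w).1 = Γ.adj k (Γ.adj c a) := by
  rcases ha with rfl | rfl
  · exact removePair_adj_left h
  · rw [Γ.adj_adj]
    exact removePair_adj_right h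

theorem cancel_adj {k : Fin 3} {w : (Γ.cancel c u).V} (h : ¬ IsEnd c u (Γ.adj k w.1)) :
    ((Γ.cancel c u).adj k w).1 = Γ.adj k w.1 :=
  removePair_adj_other (fun e => h (Or.inl e)) (fun e => h (Or.inr e))

theorem cancel_comp_of_adj {k : Fin 3} {S : Set (Fin 3)} (hk : k ∈ S)
    {w w' : (Γ.cancel c u).V} (h : w'.1 = Γ.adj k w.1) :
    (Γ.cancel c u).comp S w = (Γ.cancel c u).comp S w' :=
  removePair_comp_eq_of_adj hk h

theorem cancel_comp_of_cut {a : Γ.V} (ha : IsEnd c u a) {k : Fin 3} {S : Set (Fin 3)} (hk : k ∈ S)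
    {w w' : (Γ.cancel c u).V} (h : w.1 = Γ.adj k a) (h' : w'.1 = Γ.adj k (Γ.adj c a)) :
    (Γ.cancel c u).comp S w = (Γ.cancel c u).comp S w' := by
  rcases ha with rfl | rfl
  · exact removePair_comp_eq_of_cut hk h.symm h'.symm
  · rw [Γ.adj_adj] at h'
    exact (removePair_comp_eq_of_cut hk h'.symm h.symm).symm

theorem not_isEnd_adj {a : Γ.V} (ha : IsEnd c u a)
    (hne : Γ.comp {i, j} u ≠ Γ.comp {i, j} (Γ.adj c u)) {k : Fin 3}
    (hk : k ∈ ({i, j} : Set (Fin 3))) : ¬ IsEnd c u (Γ.adj k a) := by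
  intro h
  rcases ha.eq_or h with h | h
  · exact Γ.adj_ne k a h
  · refine ha.comp_ne hne ?_
    rw [← h, Γ.comp_adj hk]

theorem cancel_mem {w : Γ.V} (h : ¬ IsEnd c u w) : w ≠ u ∧ w ≠ Γ.adj c u := not_or.1 h

/-- Components with at most one color besides that of the canceled edge. -/
theorem cancel_comp_eq_of_subset_pair (hne : Γ.comp {i, j} u ≠ Γ.comp {i, j} (Γ.adj c u))
    {k : Fin 3} (hk : k ∈ ({i, j} : Set (Fin 3))) {S : Set (Fin 3)} (hS : S ⊆ {c, k})
    {w w' : (Γ.cancel c u).V} (h : Γ.comp S w.1 = Γ.comp S w'.1) :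
    (Γ.cancel c u).comp S w = (Γ.cancel c u).comp S w' := by
  classical
  have hu : IsEnd c u u := Or.inl rfl
  -- both removed vertices are sent to the component of the new edge of color `k`
  let F : Γ.V → (Γ.cancel c u).Comp S := fun y =>
    if hy : IsEnd c u y then (Γ.cancel c u).comp S ⟨_, cancel_mem (not_isEnd_adj hu hne hk)⟩
    else (Γ.cancel c u).comp S ⟨y, cancel_mem hy⟩
  have hF1 : ∀ y, IsEnd c u y → F y =
      (Γ.cancel c u).comp S ⟨_, cancel_mem (not_isEnd_adj hu hne hk)⟩ := fun y hy => dif_pos hy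
  have hF2 : ∀ y (hy : ¬ IsEnd c u y), F y = (Γ.cancel c u).comp S ⟨y, cancel_mem hy⟩ :=
    fun y hy => dif_neg hy
  have key : ∀ c' ∈ S, ∀ y, IsEnd c u y → F (Γ.adj c' y) = F y := by
    intro c' hc' y hy
    rcases hS hc' with rfl | rfl
    · rw [hF1 _ hy, hF1 _ hy.adj]
    · rw [hF1 _ hy, hF2 _ (not_isEnd_adj hy hne hk)]
      rcases hu.eq_or hy with rfl | rfl
      · rfl
      · exact (cancel_comp_of_cut hu hc' rfl rfl).symm
  have := eq_of_comp_eq F (fun c' hc' y => by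
    by_cases hy : IsEnd c u y
    · exact key c' hc' y hy
    · by_cases hy' : IsEnd c u (Γ.adj c' y)
      · have := key c' hc' _ hy'
        rw [Γ.adj_adj] at this
        exact this.symm
      · rw [hF2 _ hy, hF2 _ hy']
        exact (cancel_comp_of_adj hc' rfl).symm) h
  rwa [hF2 _ (not_or.2 w.2), hF2 _ (not_or.2 w'.2)] at this

/-- Components with the other two colors, away from the canceled edge. -/
theorem cancel_comp_eq_of_subset {S : Set (Fin 3)} (hS : S ⊆ {i, j})
    {w w' : (Γ.cancel c u).V} (hw : ∀ a, IsEnd c u a → Γ.comp {i, j} w.1 ≠ Γ.comp {i, j} a)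
    (h : Γ.comp S w.1 = Γ.comp S w'.1) :
    (Γ.cancel c u).comp S w = (Γ.cancel c u).comp S w' := by
  let F : Γ.V → Prop := fun y => Γ.comp {i, j} y = Γ.comp {i, j} w.1 ∧
    ∀ hy : y ≠ u ∧ y ≠ Γ.adj c u, (Γ.cancel c u).comp S w = (Γ.cancel c u).comp S ⟨y, hy⟩
  have key : ∀ c' ∈ S, ∀ y, F y → F (Γ.adj c' y) := by
    rintro c' hc' y ⟨h1, h2⟩
    refine ⟨(Γ.comp_adj (hS hc') y).trans h1, fun hy => ?_⟩
    have hy' : y ≠ u ∧ y ≠ Γ.adj c u :=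
      ⟨fun e => hw u (Or.inl rfl) (by rw [← h1, e]), fun e => hw _ (Or.inr rfl) (by rw [← h1, e])⟩
    rw [h2 hy']
    exact cancel_comp_of_adj hc' rfl
  have := eq_of_comp_eq F (fun c' hc' y => propext
    ⟨fun hy => by simpa only [Γ.adj_adj] using key c' hc' _ hy, key c' hc' y⟩) h
  exact (this.mp ⟨rfl, fun _ => rfl⟩).2 w'.2

/-- Deleting a vertex of a cycle leaves a path, which is joined to the other path. -/
theorem cancel_comp_eq_of_fan
    (hne : Γ.comp {i, j} u ≠ Γ.comp {i, j} (Γ.adj c u)) {a : Γ.V} (ha : IsEnd c u a)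
    {w : (Γ.cancel c u).V} (hw : Γ.comp {i, j} w.1 = Γ.comp {i, j} a) :
    (Γ.cancel c u).comp {i, j} w = (Γ.cancel c u).comp {i, j}
      ⟨Γ.adj i u, cancel_mem (not_isEnd_adj (Or.inl rfl) hne (Or.inl rfl))⟩ := by
  have key : ∀ n, n + 1 < Γ.period i j a → ∀ hn : Γ.walk i j a (n + 1) ≠ u ∧
      Γ.walk i j a (n + 1) ≠ Γ.adj c u, (Γ.cancel c u).comp {i, j} ⟨_, hn⟩ =
        (Γ.cancel c u).comp {i, j}
          ⟨Γ.adj i a, cancel_mem (not_isEnd_adj ha hne (Or.inl rfl))⟩ := by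
    intro n
    induction n with
    | zero => intro _ _; rfl
    | succ n ih =>
      intro hlt hn
      have hn' : ¬ IsEnd c u (Γ.walk i j a (n + 1)) := by
        intro h
        rcases ha.eq_or h with h | h
        · have := idx_walk (Γ := Γ) (i := i) (j := j) (u := a) (n := n + 1) (by omega) (by omega)
          rw [h, idx_self] at this
          omega
        · have := comp_walk (Γ := Γ) (i := i) (j := j) (u := a) (n + 1)
          rw [h] at this
          exact ha.comp_ne hne this.symm
      rw [← ih (by omega) (cancel_mem hn')]
      exact (cancel_comp_of_adj (col_mem (n + 1)) rfl).symm
  have h1 : (Γ.cancel c u).comp {i, j} w = (Γ.cancel c u).comp {i, j}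
      ⟨Γ.adj i a, cancel_mem (not_isEnd_adj ha hne (Or.inl rfl))⟩ := by
    obtain ⟨n1, n2, n3⟩ := idx_spec hw
    have n4 := idx_lt hw (cancel_ne ha w)
    obtain ⟨m, hm⟩ : ∃ m, idx i j a w.1 = m + 1 := ⟨idx i j a w.1 - 1, by omega⟩
    rw [hm] at n3 n4
    rw [← key m n4 (n3 ▸ w.2)]
    congr 1
    exact Subtype.ext n3.symm
  rw [h1]
  rcases IsEnd.eq_or (Or.inl rfl : IsEnd c u u) ha with rfl | rfl
  · rfl
  · exact (cancel_comp_of_cut (Or.inl rfl) (Or.inl rfl) rfl rfl).symm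

theorem arcMap_adj {a w : Γ.V} (hw : Γ.comp {i, j} w = Γ.comp {i, j} a) (hwa : w ≠ a)
    {k : Fin 3} (hk : k ∈ ({i, j} : Set (Fin 3))) (hwa' : Γ.adj k w ≠ a)
    {p : stdSimplex ℝ (Fin 3)} (hp : p.1 k = 0) :
    arcMap i j (Γ.period i j a) (idx i j a (Γ.adj k w)) p =
      arcMap i j (Γ.period i j a) (idx i j a w) p := by
  have hw' : Γ.comp {i, j} (Γ.adj k w) = Γ.comp {i, j} a := by rw [Γ.comp_adj hk, hw]
  rcases adj_cases hw hk with ⟨e1, e2, e3⟩ | ⟨e1, e2, e3⟩ | ⟨e1, e2, e3⟩ | ⟨e1, e2, e3⟩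
  · rw [e3]
    exact (arcMap_succ (e1 ▸ hp)).symm
  · exact absurd ((idx_eq_period hw).1 e2) hwa
  · rw [e3]
    exact arcMap_succ (by rwa [← e1])
  · exact absurd ((idx_eq_period hw').1 e2) hwa'

/-- The sides of the fan next to the triangle that is left out go to the two halves of the diameter,
according to their color. -/
theorem arcMap_of_adj_eq (hij : i ≠ j) {a w : Γ.V} {k : Fin 3} (hk : k ∈ ({i, j} : Set (Fin 3)))
    (h : Γ.adj k w = a) {p : stdSimplex ℝ (Fin 3)} (hp : p.1 k = 0) :
    arcMap i j (Γ.period i j a) (idx i j a w) p =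
      ((if k = i then rad i j p else -rad i j p : ℝ) : ℂ) := by
  have hw : Γ.comp {i, j} w = Γ.comp {i, j} a := by rw [← h, Γ.comp_adj hk]
  have hwa : w ≠ a := fun e => Γ.adj_ne k w (h.trans e.symm)
  rcases adj_cases hw hk with ⟨e1, e2, e3⟩ | ⟨e1, e2, e3⟩ | ⟨e1, e2, e3⟩ | ⟨e1, e2, e3⟩
  · rw [h, idx_self] at e3
    have hki : k ≠ i := by
      rintro rfl
      rcases col_cases (i := k) (j := j) (idx k j a w) with ⟨f1, f2⟩ | ⟨f1, f2⟩
      · rw [← e3, col_of_even even_period] at f2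
        exact hij f2
      · exact hij (e1.trans f1)
    rw [if_neg hki, e3, arcMap_last (idx_spec hw).1 (e1 ▸ hp)]
    simp
  · exact absurd ((idx_eq_period hw).1 e2) hwa
  · rw [h, idx_self] at e2
    exact absurd e2 (lt_irrefl _)
  · rw [if_pos e1, e3, arcMap_one (e1 ▸ hp)]

theorem eq_or_eq_or_eq_third {c : Fin 3} (hij : i ≠ j) (hic : i ≠ c) (hjc : j ≠ c) (k : Fin 3) :
    k = i ∨ k = j ∨ k = c := by
  revert i j c k
  decide

theorem zeros_subset {c : Fin 3} (hij : i ≠ j) (hic : i ≠ c) (hjc : j ≠ c)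
    {q : stdSimplex ℝ (Fin 3)} (hq : q.1 c ≠ 0) : zeros q ⊆ {i, j} := by
  intro k hk
  rcases eq_or_eq_or_eq_third hij hic hjc k with rfl | rfl | rfl
  · exact Or.inl rfl
  · exact Or.inr rfl
  · exact absurd hk hq

/-- The interior points of two half discs have the same image only on their common diameter. -/
theorem eq_of_fanInv_eq (hij : i ≠ j) (hic : i ≠ c) (hjc : j ≠ c)
    (hne : Γ.comp {i, j} u ≠ Γ.comp {i, j} (Γ.adj c u)) {a b : Γ.V} (ha : IsEnd c u a)
    (hb : IsEnd c u b) {z z' : halfDisc} (hz : ‖z.1‖ < 1) (hz' : ‖z'.1‖ < 1)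
    (h : fanInv hij a z = fanInv hij b z') : z = z' ∧ (a = b ∨ z.1.im = 0) := by
  obtain ⟨y', q, hy', e'⟩ := exists_fan_eq (u := b) hij z'.2
  have e2 : z' = ⟨fan i j b y' q, fan_mem hij hy' q⟩ := Subtype.ext e'.symm
  rw [e2, fanInv_fan hij hy'] at h
  obtain ⟨y, hy, e, hyy⟩ := exists_of_fanInv_eq hij h
  rcases (q.2.1 c).eq_or_lt with hq | hq
  · have hr : rad i j q = 1 := by
      have := sum_coords hij hic hjc q
      rw [rad]
      linarith
    obtain rfl : y = a := by
      by_contra hya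
      have := norm_fan_of_ne hy hya hr
      rw [e] at this
      exact hz.ne this
    obtain rfl : y' = b := by
      by_contra hya
      have := norm_fan_of_ne hy' hya hr
      rw [e'] at this
      exact hz'.ne this
    rw [fan_self hr] at e e'
    refine ⟨Subtype.ext (e.symm.trans e'), Or.inr ?_⟩
    rw [← e, Complex.ofReal_im]
  · have hS : zeros q ⊆ {i, j} := zeros_subset hij hic hjc hq.ne'
    have hyy' := comp_mono hS hyy
    rw [hy, hy'] at hyy'
    have hab : a = b := by
      rcases ha.eq_or hb with h | h
      · exact h.symm
      · rw [h] at hyy'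
        exact absurd hyy' (ha.comp_ne hne)
    subst hab
    refine ⟨Subtype.ext ?_, Or.inl rfl⟩
    rw [← e, ← e', fan_eq_iff hij hy hy', inter_eq_left.2 hS]
    exact ⟨rfl, hyy⟩

/-- The interior of the half disc does not meet the simplices outside of the fan, nor the points
on outer sides other than that of the central triangle. -/
theorem point_of_fanInv_eq (hij : i ≠ j) (hic : i ≠ c) (hjc : j ≠ c) {a : Γ.V}
    (ha : IsEnd c u a) {z : halfDisc} (hz : ‖z.1‖ < 1) {w : Γ.V} {q : stdSimplex ℝ (Fin 3)}
    (h : fanInv hij a z = Γ.point w q) :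
    (q.1 c = 0 ∧ IsEnd c u w) ∨ (q.1 c ≠ 0 ∧ Γ.comp {i, j} w = Γ.comp {i, j} a) := by
  obtain ⟨y, hy, e, hyy⟩ := exists_of_fanInv_eq hij h
  by_cases hq : q.1 c = 0
  · left
    refine ⟨hq, ?_⟩
    have hs := sum_coords hij hic hjc q
    have hr : rad i j q = 1 := by
      rw [rad]
      linarith
    obtain rfl : y = a := by
      by_contra hya
      have := norm_fan_of_ne hy hya hr
      rw [e] at this
      exact hz.ne this
    rw [fan_self hr] at e
    have hlt : |q.1 j - q.1 i| < 1 := by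
      rwa [← e, Complex.norm_real, Real.norm_eq_abs] at hz
    rw [abs_lt] at hlt
    have hS : zeros q ⊆ {c} := by
      intro k hk
      rcases eq_or_eq_or_eq_third hij hic hjc k with rfl | rfl | rfl
      · exact absurd hk (fun hk : q.1 k = 0 => by linarith)
      · exact absurd hk (fun hk : q.1 k = 0 => by linarith)
      · rfl
    have := eq_of_comp_eq (fun x => IsEnd c u x) (fun c' hc' x => propext (by
      obtain rfl := hS hc'
      refine ⟨fun hx => ?_, IsEnd.adj⟩
      have := hx.adj
      rwa [Γ.adj_adj] at this)) hyy
    exact this.mp ha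
  · right
    refine ⟨hq, ?_⟩
    have hS : zeros q ⊆ {i, j} := zeros_subset hij hic hjc hq
    rw [← comp_mono hS hyy, hy]

/-- The points of the diameter that are not at the center are on the first and the last side. -/
theorem arcMap_im_eq_zero {L n : ℕ} (hn : 1 ≤ n) (hnL : n < L) (hL : Even L)
    {p : stdSimplex ℝ (Fin 3)} (hr : 0 < rad i j p) (h : (arcMap i j L n p).im = 0) :
    (((n : ℝ) - 1 + frac i j n p) / (L - 1) = 0 ∧ n = 1 ∧ p.1 i = 0) ∨
    (((n : ℝ) - 1 + frac i j n p) / (L - 1) = 1 ∧ n + 1 = L ∧ p.1 j = 0) := by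
  have hm := angle_mem (n := n) (L := L) hn hnL (frac_nonneg (i := i) (j := j) n p)
    (frac_le_one n p)
  rw [arcMap, Complex.im_ofReal_mul, Complex.exp_ofReal_mul_I_im] at h
  have hsin := (mul_eq_zero.1 h).resolve_left hr.ne'
  set θ := ((n : ℝ) - 1 + frac i j n p) / (L - 1) with hθ
  have hn' : (1 : ℝ) ≤ n := by exact_mod_cast hn
  have hL' : (n : ℝ) + 1 ≤ L := by exact_mod_cast hnL
  have hL0 : (L : ℝ) - 1 ≠ 0 := by linarith
  have hf0 := frac_nonneg (i := i) (j := j) n p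
  have hf1 := frac_le_one (i := i) (j := j) n p
  rcases hm.2.eq_or_lt with h1 | h1
  · right
    have hθ1 : θ = 1 := by
      have := Real.pi_pos
      field_simp at h1
      linarith
    refine ⟨hθ1, ?_⟩
    rw [hθ, div_eq_one_iff_eq hL0] at hθ1
    have e1 : n + 1 = L := by
      have : (L : ℝ) ≤ n + 1 := by linarith
      have : L ≤ n + 1 := by exact_mod_cast this
      omega
    refine ⟨e1, ?_⟩
    have e2 : frac i j n p = 1 := by
      rw [← e1] at hθ1
      push_cast at hθ1
      linarith
    rw [frac, div_eq_one_iff_eq hr.ne', rad_eq n] at e2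
    have e3 : col i j n = j := by
      rw [← col_add_two, show n + 2 = L + 1 by omega, col_succ_of_even hL]
    rw [← e3]
    linarith
  · left
    have hθ0 : θ = 0 := by
      rcases hm.1.eq_or_lt with h2 | h2
      · exact (mul_eq_zero.1 h2.symm).resolve_left Real.pi_ne_zero
      · exact absurd hsin (Real.sin_pos_of_pos_of_lt_pi h2 h1).ne'
    refine ⟨hθ0, ?_⟩
    rw [hθ, div_eq_zero_iff, or_iff_left hL0] at hθ0
    have e1 : n = 1 := by
      have : (n : ℝ) ≤ 1 := by linarith
      have : n ≤ 1 := by exact_mod_cast this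
      omega
    refine ⟨e1, ?_⟩
    have e2 : frac i j n p = 0 := by linarith
    rw [frac, div_eq_zero_iff, or_iff_left hr.ne', e1] at e2
    exact e2

end

end ColoredGraph

namespace ColoredGraph

section
variable {Γ : ColoredGraph 2} {c : Fin 3} {u : Γ.V} {i j : Fin 3}

open Classical in
variable (c u) in
/-- The map of the simplices of the graph without the edge of color `c` at `u` to the carrier of
the whole graph: the fans at both ends of the edge, with one triangle left out, spread over the
whole fan. -/
noncomputable def spread (hij : i ≠ j) (w : Γ.V) (p : stdSimplex ℝ (Fin 3)) : Γ.Carrier :=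
  if Γ.comp {i, j} w = Γ.comp {i, j} u then blow hij u w p
  else if Γ.comp {i, j} w = Γ.comp {i, j} (Γ.adj c u) then blow hij (Γ.adj c u) w p
  else Γ.point w p

theorem spread_end (hij : i ≠ j) (hne : Γ.comp {i, j} u ≠ Γ.comp {i, j} (Γ.adj c u))
    {a w : Γ.V} (ha : IsEnd c u a) (hw : Γ.comp {i, j} w = Γ.comp {i, j} a)
    (p : stdSimplex ℝ (Fin 3)) : spread c u hij w p = blow hij a w p := by
  rcases ha with rfl | rfl
  · exact if_pos hw
  · rw [spread, if_neg (fun h => hne (h.symm.trans hw)), if_pos hw]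

theorem spread_other (hij : i ≠ j) {w : Γ.V}
    (hw : ∀ a, IsEnd c u a → Γ.comp {i, j} w ≠ Γ.comp {i, j} a)
    (p : stdSimplex ℝ (Fin 3)) : spread c u hij w p = Γ.point w p := by
  rw [spread, if_neg (hw _ (Or.inl rfl)), if_neg (hw _ (Or.inr rfl))]

theorem spread_outer (hij : i ≠ j) (hic : i ≠ c) (hjc : j ≠ c)
    (hne : Γ.comp {i, j} u ≠ Γ.comp {i, j} (Γ.adj c u)) (w : (Γ.cancel c u).V)
    {p : stdSimplex ℝ (Fin 3)} (hp : p.1 c = 0) : spread c u hij w.1 p = Γ.point w.1 p := by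
  by_cases h : ∃ a, IsEnd c u a ∧ Γ.comp {i, j} w.1 = Γ.comp {i, j} a
  · obtain ⟨a, ha, hw⟩ := h
    rw [spread_end hij hne ha hw, blow_of_rad_eq_one hij hw (cancel_ne ha w)]
    have := sum_coords hij hic hjc p
    rw [rad]
    linarith
  · push Not at h
    exact spread_other hij h p

theorem spread_eq (hij : i ≠ j) (hne : Γ.comp {i, j} u ≠ Γ.comp {i, j} (Γ.adj c u))
    {a : Γ.V} (ha : IsEnd c u a) {w : (Γ.cancel c u).V}
    (hw : Γ.comp {i, j} w.1 = Γ.comp {i, j} a) (p : stdSimplex ℝ (Fin 3)) :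
    spread c u hij w.1 p = fanInv hij a ⟨_, arc_mem hij hw (cancel_ne ha w) p⟩ := by
  rw [spread_end hij hne ha hw, blow_eq hij hw (cancel_ne ha w)]

theorem continuous_spread (hij : i ≠ j) (hne : Γ.comp {i, j} u ≠ Γ.comp {i, j} (Γ.adj c u))
    (w : (Γ.cancel c u).V) : Continuous (spread c u hij w.1) := by
  by_cases h : ∃ a, IsEnd c u a ∧ Γ.comp {i, j} w.1 = Γ.comp {i, j} a
  · obtain ⟨a, ha, hw⟩ := h
    rw [show spread c u hij w.1 = blow hij a w.1 from funext fun p => spread_end hij hne ha hw p]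
    exact continuous_blow hij hw (cancel_ne ha w)
  · push Not at h
    rw [show spread c u hij w.1 = Γ.point w.1 from funext fun p => spread_other hij h p]
    exact continuous_point _

theorem spread_surjective (hij : i ≠ j) (hne : Γ.comp {i, j} u ≠ Γ.comp {i, j} (Γ.adj c u))
    (x : Γ.Carrier) : ∃ (w : (Γ.cancel c u).V) (p : _), spread c u hij w.1 p = x := by
  obtain ⟨y, q, rfl⟩ := point_surjective x
  by_cases h : ∃ a, IsEnd c u a ∧ Γ.comp {i, j} y = Γ.comp {i, j} a
  · obtain ⟨a, ha, hy⟩ := h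
    obtain ⟨n, hn, hnL, p, hp⟩ := exists_arcMap_eq (L := Γ.period i j a) hij two_le_period
      (fan_mem (u := a) hij hy q)
    have hwa : Γ.walk i j a n ≠ a := by
      intro e
      have := idx_walk (Γ := Γ) (i := i) (j := j) (u := a) (n := n) hn hnL.le
      rw [e, idx_self] at this
      omega
    have hend : ¬ IsEnd c u (Γ.walk i j a n) := by
      intro h
      rcases ha.eq_or h with h | h
      · exact hwa h
      · exact ha.comp_ne hne (by rw [← h, comp_walk])
    refine ⟨⟨_, cancel_mem hend⟩, p, ?_⟩
    rw [spread_eq hij hne ha (w := ⟨_, cancel_mem hend⟩) (comp_walk n), ← fanInv_fan hij hy]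
    congr 1
    refine Subtype.ext ?_
    dsimp only
    rw [idx_walk hn hnL.le, hp]
  · push Not at h
    refine ⟨⟨y, fun e => h y (Or.inl e) rfl, fun e => h y (Or.inr e) rfl⟩, q, ?_⟩
    exact spread_other hij h q

/-- Triangles that are neighbors in the graph after cancellation agree on their common side. -/
theorem spread_adj (hij : i ≠ j) (hic : i ≠ c) (hjc : j ≠ c)
    (hne : Γ.comp {i, j} u ≠ Γ.comp {i, j} (Γ.adj c u)) (w : (Γ.cancel c u).V) {k : Fin 3}
    {p : stdSimplex ℝ (Fin 3)} (hp : p.1 k = 0) :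
    spread c u hij ((Γ.cancel c u).adj k w).1 p = spread c u hij w.1 p := by
  by_cases hkc : k = c
  · subst hkc
    rw [spread_outer hij hic hjc hne _ hp, spread_outer hij hic hjc hne _ hp, cancel_adj,
      point_adj hp]
    intro h
    have := h.adj
    rw [Γ.adj_adj] at this
    exact cancel_ne this w rfl
  have hk : k ∈ ({i, j} : Set (Fin 3)) := by
    rcases eq_or_eq_or_eq_third hij hic hjc k with h | h | h
    · exact Or.inl h
    · exact Or.inr h
    · exact absurd h hkc
  by_cases hend : IsEnd c u (Γ.adj k w.1)
  -- both triangles meet the diameters of their half discs in the same point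
  · obtain ⟨a, ha⟩ : ∃ a, a = Γ.adj k w.1 := ⟨_, rfl⟩
    rw [← ha] at hend
    have e1 := cancel_adj_end hend ha.symm
    have h1 : Γ.comp {i, j} w.1 = Γ.comp {i, j} a := by rw [ha, Γ.comp_adj hk]
    have h2 : Γ.comp {i, j} ((Γ.cancel c u).adj k w).1 = Γ.comp {i, j} (Γ.adj c a) := by
      rw [e1, Γ.comp_adj hk]
    have v1 := arcMap_of_adj_eq hij hk ha.symm hp
    have v2 := arcMap_of_adj_eq (a := Γ.adj c a) (w := ((Γ.cancel c u).adj k w).1) hij hk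
      (by rw [e1, Γ.adj_adj]) hp
    rw [spread_eq hij hne hend h1, spread_eq hij hne hend.adj h2, fanInv_real hij hic hjc]
    · congr 1
      exact Subtype.ext (v2.trans v1.symm)
    · change Complex.im (arcMap _ _ _ _ _) = 0
      rw [v2, Complex.ofReal_im]
  · have e1 := cancel_adj hend
    by_cases h : ∃ a, IsEnd c u a ∧ Γ.comp {i, j} w.1 = Γ.comp {i, j} a
    · obtain ⟨a, ha, hw⟩ := h
      have hw' : Γ.comp {i, j} ((Γ.cancel c u).adj k w).1 = Γ.comp {i, j} a := by
        rw [e1, Γ.comp_adj hk, hw]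
      rw [spread_eq hij hne ha hw, spread_eq hij hne ha hw']
      congr 1
      refine Subtype.ext ?_
      dsimp only
      rw [e1]
      exact arcMap_adj hw (cancel_ne ha w) hk (fun e => hend (e ▸ ha)) hp
    · push Not at h
      have h' : ∀ a, IsEnd c u a → Γ.comp {i, j} ((Γ.cancel c u).adj k w).1 ≠ Γ.comp {i, j} a := by
        intro a ha
        rw [e1, Γ.comp_adj hk]
        exact h a ha
      rw [spread_other hij h, spread_other hij h', e1, point_adj hp]

/-- Away from the outer sides, a point of the fans is not identified with points elsewhere. -/
theorem spread_ne (hij : i ≠ j) (hic : i ≠ c) (hjc : j ≠ c)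
    (hne : Γ.comp {i, j} u ≠ Γ.comp {i, j} (Γ.adj c u)) {a : Γ.V} (ha : IsEnd c u a)
    {w w' : (Γ.cancel c u).V} (hw : Γ.comp {i, j} w.1 = Γ.comp {i, j} a)
    {p p' : stdSimplex ℝ (Fin 3)} (hp : p.1 c ≠ 0)
    (hw' : p'.1 c = 0 ∨ ∀ a, IsEnd c u a → Γ.comp {i, j} w'.1 ≠ Γ.comp {i, j} a) :
    spread c u hij w.1 p ≠ spread c u hij w'.1 p' := by
  intro h
  have hz : rad i j p < 1 := by
    have := sum_coords hij hic hjc p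
    have := (p.2.1 c).lt_of_ne' hp
    rw [rad]
    linarith
  have e : spread c u hij w'.1 p' = Γ.point w'.1 p' := by
    rcases hw' with h | h
    · exact spread_outer hij hic hjc hne w' h
    · exact spread_other hij h p'
  rw [e, spread_eq hij hne ha hw] at h
  rcases point_of_fanInv_eq hij hic hjc ha (by rwa [norm_arcMap]) h with h | ⟨h1, h2⟩
  · exact cancel_ne h.2 w' rfl
  · exact (hw'.resolve_left h1) a ha h2

/-- For two triangles of the fans at the ends of the canceled edge, points off the outer sides are
identified only if they are identified after cancellation. -/
theorem spread_injective_of_end (hij : i ≠ j) (hic : i ≠ c) (hjc : j ≠ c)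
    (hne : Γ.comp {i, j} u ≠ Γ.comp {i, j} (Γ.adj c u)) {a b : Γ.V} (ha : IsEnd c u a)
    (hb : IsEnd c u b) {w w' : (Γ.cancel c u).V} (hw : Γ.comp {i, j} w.1 = Γ.comp {i, j} a)
    (hw' : Γ.comp {i, j} w'.1 = Γ.comp {i, j} b)
    {p p' : stdSimplex ℝ (Fin 3)} (hp : p.1 c ≠ 0) (hp' : p'.1 c ≠ 0)
    (h : spread c u hij w.1 p = spread c u hij w'.1 p') :
    p = p' ∧ (Γ.cancel c u).comp (zeros p) w = (Γ.cancel c u).comp (zeros p) w' := by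
  have hz : ∀ p : stdSimplex ℝ (Fin 3), p.1 c ≠ 0 → rad i j p < 1 := by
    intro p hp
    have := sum_coords hij hic hjc p
    have := (p.2.1 c).lt_of_ne' hp
    rw [rad]
    linarith
  rw [spread_eq hij hne ha hw, spread_eq hij hne hb hw'] at h
  obtain ⟨h1, h2⟩ := eq_of_fanInv_eq hij hic hjc hne ha hb (by rw [norm_arcMap]; exact hz p hp)
    (by rw [norm_arcMap]; exact hz p' hp') h
  have h1 := congrArg Subtype.val h1
  dsimp only at h1 h2
  obtain ⟨n1, n2, n3⟩ := idx_spec hw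
  obtain ⟨n1', n2', n3'⟩ := idx_spec hw'
  have n4 := idx_lt hw (cancel_ne ha w)
  have n4' := idx_lt hw' (cancel_ne hb w')
  obtain ⟨hr, hθ⟩ := eq_of_arcMap_eq n1 n4 n1' n4' h1
  rcases (rad_nonneg (i := i) (j := j) p).eq_or_lt with h0 | h0
  -- at the center, the union of the two paths counts
  · obtain ⟨rfl, hi, hj⟩ := eq_of_rad_eq_zero hij h0.symm (hr ▸ h0.symm)
    refine ⟨rfl, comp_mono (C := {i, j}) ?_ ?_⟩
    · rintro k (rfl | rfl)
      · exact hi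
      · exact hj
    · rw [cancel_comp_eq_of_fan hne ha hw, cancel_comp_eq_of_fan hne hb hw']
  -- in the same fan, equal polar coordinates occur on common sides only
  have hθ := hθ h0
  rcases h2 with rfl | h2
  · have hL : (Γ.period i j a : ℝ) - 1 ≠ 0 := by
      have : (2 : ℝ) ≤ Γ.period i j a := by exact_mod_cast two_le_period
      linarith
    rw [div_left_inj' hL] at hθ
    obtain ⟨rfl, h3⟩ := eq_of_polar_eq (n := idx i j a w.1) (n' := idx i j a w'.1) hij hr h0
      (by linarith)
    refine ⟨rfl, ?_⟩
    rcases h3 with h3 | ⟨h3, h4⟩ | ⟨h3, h4⟩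
    · congr 1
      exact Subtype.ext (by rw [← n3, h3, n3'])
    · refine cancel_comp_of_adj h4 ?_
      rw [h3, walk_succ, n3] at n3'
      exact n3'.symm
    · refine (cancel_comp_of_adj h4 ?_).symm
      rw [h3, walk_succ, n3'] at n3
      exact n3.symm
  -- on the common diameter, both triangles are the first or both are the last of their fans
  · have h2' := h1 ▸ h2
    have hab : a = b ∨ b = Γ.adj c a := (ha.eq_or hb).imp_left Eq.symm
    have hcut : ∀ k, p.1 k = 0 → w.1 = Γ.adj k a → w'.1 = Γ.adj k b →
        (Γ.cancel c u).comp (zeros p) w = (Γ.cancel c u).comp (zeros p) w' := by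
      intro k hk e e'
      rcases hab with rfl | rfl
      · congr 1
        exact Subtype.ext (e.trans e'.symm)
      · exact cancel_comp_of_cut ha hk e e'
    rcases arcMap_im_eq_zero n1 n4 even_period h0 h2 with ⟨e1, e2, e3⟩ | ⟨e1, e2, e3⟩
    · rcases arcMap_im_eq_zero n1' n4' even_period (hr ▸ h0) h2' with ⟨f1, f2, f3⟩ | ⟨f1, f2, f3⟩
      · refine ⟨simplex_ext hij (e3.trans f3.symm) ?_, hcut i e3 ?_ ?_⟩
        · rw [rad, rad] at hr
          linarith
        · rw [← n3, e2]
          rfl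
        · rw [← n3', f2]
          rfl
      · linarith
    · rcases arcMap_im_eq_zero n1' n4' even_period (hr ▸ h0) h2' with ⟨f1, f2, f3⟩ | ⟨f1, f2, f3⟩
      · linarith
      · have last : ∀ (b : Γ.V) n, n + 1 = Γ.period i j b → Γ.walk i j b n = Γ.adj j b := by
          intro b n hn
          have := adj_walk_succ (Γ := Γ) (i := i) (j := j) (u := b) n
          rw [hn, walk_period, ← col_add_two, show n + 2 = Γ.period i j b + 1 by omega,
            col_succ_of_even even_period] at this
          exact this.symm
        refine ⟨simplex_ext hij ?_ (e3.trans f3.symm), hcut j e3 ?_ ?_⟩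
        · rw [rad, rad] at hr
          linarith
        · rw [← n3, last _ _ e2]
        · rw [← n3', last _ _ f2]

/-- The map identifies exactly the points that are identified after cancellation. Points are treated
according to whether they lie on outer sides, in one of the two fans, or elsewhere. -/
theorem spread_injective (hij : i ≠ j) (hic : i ≠ c) (hjc : j ≠ c)
    (hne : Γ.comp {i, j} u ≠ Γ.comp {i, j} (Γ.adj c u)) {w w' : (Γ.cancel c u).V}
    {p p' : stdSimplex ℝ (Fin 3)} (h : spread c u hij w.1 p = spread c u hij w'.1 p') :
    p = p' ∧ (Γ.cancel c u).comp (zeros p) w = (Γ.cancel c u).comp (zeros p) w' := by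
  have hout : ∀ (w : (Γ.cancel c u).V) (p : stdSimplex ℝ (Fin 3)), p.1 c = 0 ∨
      (p.1 c ≠ 0 ∧ ∃ a, IsEnd c u a ∧ Γ.comp {i, j} w.1 = Γ.comp {i, j} a) ∨
      (p.1 c ≠ 0 ∧ ∀ a, IsEnd c u a → Γ.comp {i, j} w.1 ≠ Γ.comp {i, j} a) := by
    intro w p
    by_cases h1 : p.1 c = 0
    · exact Or.inl h1
    · by_cases h2 : ∃ a, IsEnd c u a ∧ Γ.comp {i, j} w.1 = Γ.comp {i, j} a
      · exact Or.inr (Or.inl ⟨h1, h2⟩)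
      · push Not at h2
        exact Or.inr (Or.inr ⟨h1, h2⟩)
  have houter : ∀ (w : (Γ.cancel c u).V) (p : stdSimplex ℝ (Fin 3)), (p.1 c = 0 ∨
      (p.1 c ≠ 0 ∧ ∀ a, IsEnd c u a → Γ.comp {i, j} w.1 ≠ Γ.comp {i, j} a)) →
      spread c u hij w.1 p = Γ.point w.1 p := by
    rintro w p (h | h)
    · exact spread_outer hij hic hjc hne w h
    · exact spread_other hij h.2 p
  -- neither point is an interior point of the two fans
  have hrest : ∀ h1 : p.1 c = 0 ∨
      (p.1 c ≠ 0 ∧ ∀ a, IsEnd c u a → Γ.comp {i, j} w.1 ≠ Γ.comp {i, j} a),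
      ∀ h2 : p'.1 c = 0 ∨
      (p'.1 c ≠ 0 ∧ ∀ a, IsEnd c u a → Γ.comp {i, j} w'.1 ≠ Γ.comp {i, j} a),
      p = p' ∧ (Γ.cancel c u).comp (zeros p) w = (Γ.cancel c u).comp (zeros p) w' := by
    intro h1 h2
    rw [houter w p h1, houter w' p' h2, point_eq_iff] at h
    obtain ⟨rfl, h⟩ := h
    refine ⟨rfl, ?_⟩
    rcases h1 with h1 | h1
    · obtain ⟨k, hk, hS⟩ : ∃ k ∈ ({i, j} : Set (Fin 3)), zeros p ⊆ {c, k} := by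
        have hs := sum_coords hij hic hjc p
        by_cases hi : p.1 i = 0
        · refine ⟨i, Or.inl rfl, fun l hl => ?_⟩
          rcases eq_or_eq_or_eq_third hij hic hjc l with rfl | rfl | rfl
          · exact Or.inr rfl
          · have hl : p.1 l = 0 := hl
            linarith
          · exact Or.inl rfl
        · refine ⟨j, Or.inr rfl, fun l hl => ?_⟩
          rcases eq_or_eq_or_eq_third hij hic hjc l with rfl | rfl | rfl
          · exact absurd hl hi
          · exact Or.inr rfl
          · exact Or.inl rfl
      exact cancel_comp_eq_of_subset_pair hne hk hS h
    · exact cancel_comp_eq_of_subset (zeros_subset hij hic hjc h1.1) h1.2 h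
  rcases hout w p with h1 | ⟨h1, a, ha, hw⟩ | h1 <;>
    rcases hout w' p' with h2 | ⟨h2, b, hb, hw'⟩ | h2
  · exact hrest (Or.inl h1) (Or.inl h2)
  · exact absurd h.symm (spread_ne hij hic hjc hne hb hw' h2 (Or.inl h1))
  · exact hrest (Or.inl h1) (Or.inr h2)
  · exact absurd h (spread_ne hij hic hjc hne ha hw h1 (Or.inl h2))
  · exact spread_injective_of_end hij hic hjc hne ha hb hw hw' h1 h2 h
  · exact absurd h (spread_ne hij hic hjc hne ha hw h1 (Or.inr h2.2))
  · exact hrest (Or.inr h1) (Or.inl h2)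
  · exact absurd h.symm (spread_ne hij hic hjc hne hb hw' h2 (Or.inr h1.2))
  · exact hrest (Or.inr h1) (Or.inr h2)

/-- Canceling an edge of color `c` that joins distinct cycles of the other two colors does not
change the carrier. -/
theorem nonempty_cancel_homeomorph (hij : i ≠ j) (hic : i ≠ c) (hjc : j ≠ c)
    (hne : Γ.comp {i, j} u ≠ Γ.comp {i, j} (Γ.adj c u)) :
    Nonempty ((Γ.cancel c u).Carrier ≃ₜ Γ.Carrier) :=
  nonempty_carrier_homeomorph (fun w p => spread c u hij w.1 p) (continuous_spread hij hne)
    (spread_surjective hij hne) (fun w _ _ hp => spread_adj hij hic hjc hne w hp)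
    (fun _ _ _ _ h => spread_injective hij hic hjc hne h)

theorem card_cancel_lt : Nat.card (Γ.cancel c u).V < Nat.card Γ.V := by
  exact Finite.card_subtype_lt (x := u) fun h => h.1 rfl

end

variable (Γ : ColoredGraph 2)

/-- All vertices are on one cycle, for each pair of colors. -/
def IsContracted : Prop := ∀ i j : Fin 3, i ≠ j → ∀ u v : Γ.V, Γ.comp {i, j} u = Γ.comp {i, j} v

/-- In a connected graph that is not contracted, some edge joins distinct cycles of the other two
colors and can be canceled. Since this reduces the number of vertices, it comes to an end. -/
theorem exists_isContracted [PreconnectedSpace Γ.Carrier] : ∃ Γ' : ColoredGraph 2,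
    Γ'.IsContracted ∧ Nonempty (Γ'.Carrier ≃ₜ Γ.Carrier) := by
  obtain ⟨n, hn⟩ : ∃ n, Nat.card Γ.V = n := ⟨_, rfl⟩
  induction n using Nat.strong_induction_on generalizing Γ with
  | _ n ih =>
    by_cases h : ∃ i j c : Fin 3, i ≠ j ∧ i ≠ c ∧ j ≠ c ∧
        ∃ u : Γ.V, Γ.comp {i, j} u ≠ Γ.comp {i, j} (Γ.adj c u)
    · obtain ⟨i, j, c, hij, hic, hjc, u, hne⟩ := h
      obtain ⟨e⟩ := nonempty_cancel_homeomorph hij hic hjc hne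
      have : PreconnectedSpace (Γ.cancel c u).Carrier :=
        ⟨by simpa using (isPreconnected_univ.image e.symm e.symm.continuous.continuousOn)⟩
      obtain ⟨Γ', h1, ⟨e'⟩⟩ := ih _ (hn ▸ card_cancel_lt) (Γ.cancel c u) rfl
      exact ⟨Γ', h1, ⟨e'.trans e⟩⟩
    · push Not at h
      refine ⟨Γ, fun i j hij u v => ?_, ⟨Homeomorph.refl _⟩⟩
      obtain ⟨c, hic, hjc⟩ := exists_third i j
      refine eq_of_comp_eq (C := univ) (Γ.comp {i, j}) (fun k _ w => ?_) (comp_univ_eq u v)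
      rcases eq_or_eq_or_eq_third hij hic hjc k with rfl | rfl | rfl
      · exact Γ.comp_adj (Or.inl rfl) w
      · exact Γ.comp_adj (Or.inr rfl) w
      · exact (h i j k hij hic hjc w).symm

end ColoredGraph

/-! ### The regular embedding of a graph into its carrier -/

namespace ColoredGraph

/-- The disc and the half disc are homeomorphic as convex bodies, with the boundaries
corresponding to each other. -/
theorem exists_closedBall_homeomorph_halfDisc :
    ∃ δ : Metric.closedBall (0 : ℂ) 1 ≃ₜ halfDisc,
      ∀ z : Metric.closedBall (0 : ℂ) 1, ‖(z : ℂ)‖ = 1 ↔ ‖(δ z : ℂ)‖ = 1 ∨ (δ z : ℂ).im = 0 := by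
  have hint : interior halfDisc = {z : ℂ | ‖z‖ < 1 ∧ 0 < z.im} := by
    have : halfDisc = Metric.closedBall (0 : ℂ) 1 ∩ {z | 0 ≤ z.im} := by
      ext z
      simp [halfDisc]
    rw [this, interior_inter, interior_closedBall _ one_ne_zero, Complex.interior_setOfPred_le_im]
    ext z
    simp
  have hmem : (Complex.I / 2) ∈ interior halfDisc := by
    rw [hint]
    constructor
    · simp
      norm_num
    · simp
  obtain ⟨h, -, h2, h3⟩ := exists_homeomorph_image_interior_closure_frontier_eq_unitBall
    convex_halfDisc ⟨_, hmem⟩ isCompact_halfDisc.isBounded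
  rw [isCompact_halfDisc.isClosed.closure_eq] at h2
  have e : ∀ x, x ∈ halfDisc ↔ h x ∈ Metric.closedBall (0 : ℂ) 1 := fun x => by
    rw [← h2, h.injective.mem_set_image]
  refine ⟨(h.subtype e).symm, fun z => ?_⟩
  obtain ⟨x, rfl⟩ := (h.subtype e).surjective z
  rw [Homeomorph.symm_apply_apply]
  have h4 : h x.1 ∈ Metric.sphere (0 : ℂ) 1 ↔ x.1 ∈ frontier halfDisc := by
    rw [← h3, h.injective.mem_set_image]
  rw [mem_sphere_zero_iff_norm, frontier, isCompact_halfDisc.isClosed.closure_eq, hint] at h4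
  refine h4.trans ?_
  have hx := x.2
  constructor
  · rintro ⟨-, h5⟩
    by_contra! h6
    exact h5 ⟨hx.1.lt_of_ne h6.1, hx.2.lt_of_ne' h6.2⟩
  · rintro h5
    refine ⟨hx, fun h6 => ?_⟩
    rcases h5 with h5 | h5
    · exact h6.1.ne h5
    · exact h6.2.ne' h5

section
variable {i j c : Fin 3}

/-- The outer sides of the triangles of a fan form the boundary of the half disc. -/
theorem fan_mem_boundary {Γ : ColoredGraph 2} {u w : Γ.V} (hij : i ≠ j)
    (hw : Γ.comp {i, j} w = Γ.comp {i, j} u) (p : stdSimplex ℝ (Fin 3)) :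
    (‖fan i j u w p‖ = 1 ∨ (fan i j u w p).im = 0) ↔ rad i j p = 1 := by
  obtain ⟨h1, h2, -⟩ := idx_spec hw
  have h0 := rad_nonneg (i := i) (j := j) p
  have hle := rad_le_one hij p
  constructor
  · intro h
    by_contra hne
    have hlt := hle.lt_of_ne hne
    rw [fan, fanMap] at h
    set b := (if idx i j u w < Γ.period i j u then arcMap i j (Γ.period i j u) (idx i j u w) p
      else ((p.1 j - p.1 i : ℝ) : ℂ)) with hb
    have hbn : ‖b‖ ≤ rad i j p ∧ 0 ≤ b.im := by
      rw [hb]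
      split_ifs with hL
      · exact ⟨(norm_arcMap _ _ p).le, (arcMap_mem hij h1 hL p).2⟩
      · refine ⟨?_, by rw [Complex.ofReal_im]⟩
        rw [Complex.norm_real, Real.norm_eq_abs, rad, abs_le]
        have := p.2.1 i
        have := p.2.1 j
        constructor <;> linarith
    rcases h with h | h
    · have h3 := norm_add_le (((1 - rad i j p : ℝ) : ℂ) * (Complex.I / 2)) b
      rw [h, norm_mul, Complex.norm_real, Real.norm_of_nonneg (by linarith)] at h3
      simp only [norm_div, Complex.norm_I, Complex.norm_ofNat] at h3
      linarith
    · rw [Complex.add_im, Complex.im_ofReal_mul] at h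
      simp at h
      linarith
  · intro h
    by_cases hwu : w = u
    · right
      rw [hwu, fan_self h, Complex.ofReal_im]
    · exact Or.inl (norm_fan_of_ne hw hwu h)

/-- The affine rescaling in each of the two halves of a triangle that maps it to the quadrangle
of the points for which the coordinate `c` is largest. -/
noncomputable def quad (i j c : Fin 3) (p : stdSimplex ℝ (Fin 3)) :
    stdSimplex ℝ (Fin 3) :=
  ⟨fun k => (p.1 k + if k = c then max (p.1 i) (p.1 j) else 0) / (1 + max (p.1 i) (p.1 j)), by
    have hM : 0 ≤ max (p.1 i) (p.1 j) :=
  le_max_of_le_left (p.2.1 i)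
    refine ⟨fun k => div_nonneg ?_ (by linarith), ?_⟩
    · have := p.2.1 k
      split_ifs <;> linarith
    · rw [← Finset.sum_div, Finset.sum_add_distrib, p.2.2]
      simp only [Finset.sum_ite_eq', Finset.mem_univ, if_true]
      exact div_self (by linarith)⟩

theorem quad_coords (hic : i ≠ c) (hjc : j ≠ c) (p : stdSimplex ℝ (Fin 3)) :
    (quad i j c p).1 i = p.1 i / (1 + max (p.1 i) (p.1 j)) ∧
    (quad i j c p).1 j = p.1 j / (1 + max (p.1 i) (p.1 j)) ∧
    (quad i j c p).1 c = (p.1 c + max (p.1 i) (p.1 j)) / (1 + max (p.1 i) (p.1 j)) := by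
  simp [quad, hic, hjc]

theorem max_coord_nonneg (p : stdSimplex ℝ (Fin 3)) : 0 ≤ max (p.1 i) (p.1 j) :=
  le_max_of_le_left (p.2.1 i)

theorem continuous_quad : Continuous (quad i j c) := by
  refine Continuous.subtype_mk (continuous_pi fun k => ?_) _
  refine Continuous.div ?_ ?_ fun p => ?_
  · refine (continuous_coord k).add ?_
    split_ifs
    · exact (continuous_coord i).max (continuous_coord j)
    · exact continuous_const
  · exact continuous_const.add ((continuous_coord i).max (continuous_coord j))
  · have := max_coord_nonneg (i := i) (j := j) p
    linarith

/-- The rescaled triangle touches the sides of colors `i` and `j` but not the side of color `c`. -/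
theorem zeros_quad (hij : i ≠ j) (hic : i ≠ c) (hjc : j ≠ c)
    (p : stdSimplex ℝ (Fin 3)) :
    zeros (quad i j c p) = zeros p ∩ {i, j} := by
  obtain ⟨h1, h2, h3⟩ := quad_coords hic hjc p
  have hM := max_coord_nonneg (i := i) (j := j) p
  have hM' : 1 + max (p.1 i) (p.1 j) ≠ 0 := by linarith
  have hs := sum_coords hij hic hjc p
  ext k
  rcases eq_or_eq_or_eq_third hij hic hjc k with rfl | rfl | rfl
  · simp [zeros, h1, hM']
  · simp [zeros, h2, hM']
  · simp only [zeros, mem_ofPred_eq, h3, div_eq_zero_iff, hM', or_false, mem_inter_iff,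
      mem_insert_iff, hic.symm, mem_singleton_iff, hjc.symm, and_false, iff_false]
    intro h
    have := p.2.1 k
    have := le_max_left (p.1 i) (p.1 j)
    have := le_max_right (p.1 i) (p.1 j)
    linarith

theorem quad_le (hic : i ≠ c) (hjc : j ≠ c) (p : stdSimplex ℝ (Fin 3)) :
    (quad i j c p).1 i ≤ (quad i j c p).1 c ∧
    (quad i j c p).1 j ≤ (quad i j c p).1 c := by
  obtain ⟨h1, h2, h3⟩ := quad_coords hic hjc p
  have hM := max_coord_nonneg (i := i) (j := j) p
  have := p.2.1 c
  rw [h1, h2, h3]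
  constructor <;> gcongr
  · linarith [le_max_left (p.1 i) (p.1 j)]
  · linarith [le_max_right (p.1 i) (p.1 j)]

/-- The side of color `c` becomes the part of the boundary on which the largest coordinate is
attained twice. -/
theorem quad_eq_iff (hic : i ≠ c) (hjc : j ≠ c)
    (p : stdSimplex ℝ (Fin 3)) : ((quad i j c p).1 c = (quad i j c p).1 i ∨
    (quad i j c p).1 c = (quad i j c p).1 j) ↔ p.1 c = 0 := by
  obtain ⟨h1, h2, h3⟩ := quad_coords hic hjc p
  have hM := max_coord_nonneg (i := i) (j := j) p
  have hM' : 1 + max (p.1 i) (p.1 j) ≠ 0 := by linarith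
  have h0 := p.2.1 c
  rw [h1, h2, h3, div_left_inj' hM', div_left_inj' hM']
  have := le_max_left (p.1 i) (p.1 j)
  have := le_max_right (p.1 i) (p.1 j)
  constructor
  · rintro (h | h) <;> linarith
  · intro h
    rcases max_choice (p.1 i) (p.1 j) with e | e
    · left
      linarith
    · right
      linarith

theorem quad_injective (hij : i ≠ j) (hic : i ≠ c) (hjc : j ≠ c) :
    Function.Injective (quad i j c) := by
  intro p p' h
  obtain ⟨h1, h2, -⟩ := quad_coords hic hjc p
  obtain ⟨h1', h2', -⟩ := quad_coords hic hjc p'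
  have hM := max_coord_nonneg (i := i) (j := j) p
  have hM' := max_coord_nonneg (i := i) (j := j) p'
  rw [h] at h1 h2
  rw [h1] at h1'
  rw [h2] at h2'
  set M := max (p.1 i) (p.1 j) with hMdef
  set M' := max (p'.1 i) (p'.1 j) with hMdef'
  have e : M / (1 + M) = M' / (1 + M') := by
    have e1 := max_div_div_right (show 0 ≤ 1 + M by linarith) (p.1 i) (p.1 j)
    have e2 := max_div_div_right (show 0 ≤ 1 + M' by linarith) (p'.1 i) (p'.1 j)
    rw [hMdef, ← e1, h1', h2', e2]
  have e' : M = M' := by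
    rw [div_eq_div_iff (by linarith) (by linarith)] at e
    linarith
  rw [e', div_left_inj' (by linarith)] at h1' h2'
  exact simplex_ext hij h1' h2'

theorem exists_quad_eq (hij : i ≠ j) (hic : i ≠ c) (hjc : j ≠ c) {q : stdSimplex ℝ (Fin 3)}
    (h1 : q.1 i ≤ q.1 c) (h2 : q.1 j ≤ q.1 c) :
    ∃ p, quad i j c p = q := by
  have hs := sum_coords hij hic hjc q
  have hi := q.2.1 i
  have hj := q.2.1 j
  set m := max (q.1 i) (q.1 j) with hm
  have hm0 : 0 ≤ m := le_max_of_le_left hi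
  have hmc : m ≤ q.1 c := max_le h1 h2
  have hm1 : 0 < 1 - m := by
    rcases max_choice (q.1 i) (q.1 j) with e | e <;> rw [← hm] at e <;> linarith
  let p : stdSimplex ℝ (Fin 3) := ⟨fun k => (q.1 k - if k = c then m else 0) / (1 - m), by
    refine ⟨fun k => div_nonneg ?_ hm1.le, ?_⟩
    · split_ifs with hk
      · rw [hk]
        linarith
      · rw [sub_zero]
        exact q.2.1 k
    · rw [← Finset.sum_div, Finset.sum_sub_distrib, q.2.2]
      simp only [Finset.sum_ite_eq', Finset.mem_univ, if_true]
      exact div_self hm1.ne'⟩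
  have pi : p.1 i = q.1 i / (1 - m) := by simp [p, hic]
  have pj : p.1 j = q.1 j / (1 - m) := by simp [p, hjc]
  obtain ⟨e1, e2, -⟩ := quad_coords hic hjc p
  have hM : 1 + max (p.1 i) (p.1 j) = 1 / (1 - m) := by
    rw [pi, pj, max_div_div_right hm1.le, ← hm]
    field_simp
    ring
  refine ⟨p, simplex_ext hij ?_ ?_⟩
  · rw [e1, hM, pi]
    field_simp
  · rw [e2, hM, pj]
    field_simp

/-- The cell of a two-colored cycle: its interior consists of the points of the triangles along
the cycle for which the coordinate of the third color is largest. -/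
theorem exists_cell (hij : i ≠ j) (hic : i ≠ c) (hjc : j ≠ c) {Γ : ColoredGraph 2} (u : Γ.V) :
    ∃ D : C(Metric.closedBall (0 : ℂ) 1, Γ.Carrier), Function.Injective D ∧
      (∀ z : Metric.closedBall (0 : ℂ) 1, ‖(z : ℂ)‖ = 1 → ∃ w q,
        Γ.comp {i, j} w = Γ.comp {i, j} u ∧ q.1 i ≤ q.1 c ∧ q.1 j ≤ q.1 c ∧
          (q.1 c = q.1 i ∨ q.1 c = q.1 j) ∧ D z = Γ.point w q) ∧
      (∀ z : Metric.closedBall (0 : ℂ) 1, ‖(z : ℂ)‖ < 1 → ∃ w q,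
        Γ.comp {i, j} w = Γ.comp {i, j} u ∧ q.1 i < q.1 c ∧ q.1 j < q.1 c ∧ D z = Γ.point w q) ∧
      ∀ w q, Γ.comp {i, j} w = Γ.comp {i, j} u → q.1 i ≤ q.1 c → q.1 j ≤ q.1 c →
        ∃ z, D z = Γ.point w q := by
  obtain ⟨Ξ, hΞ⟩ := exists_fan_lift (u := u) hij (fun w p => Γ.point w (quad i j c p))
    (fun w => (continuous_point w).comp continuous_quad) (by
      intro k hk w p hp
      refine point_adj ?_ w
      have : k ∈ zeros (quad i j c p) := by
        rw [zeros_quad hij hic hjc]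
        exact ⟨hp, hk⟩
      exact this)
  obtain ⟨δ, hδ⟩ := exists_closedBall_homeomorph_halfDisc
  have hex : ∀ z, ∃ w p, ∃ hw : Γ.comp {i, j} w = Γ.comp {i, j} u,
      δ z = ⟨fan i j u w p, fan_mem hij hw p⟩ := fun z => by
    obtain ⟨w, p, hw, h⟩ := exists_fan_eq (u := u) hij (δ z).2
    exact ⟨w, p, hw, Subtype.ext h.symm⟩
  have hrad : ∀ p : stdSimplex ℝ (Fin 3), rad i j p = 1 ↔ p.1 c = 0 := fun p => by
    have := sum_coords hij hic hjc p
    rw [rad]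
    constructor <;> intro <;> linarith
  refine ⟨Ξ.comp ⟨δ, δ.continuous⟩, ?_, ?_, ?_, ?_⟩
  · intro z z' h
    obtain ⟨w, p, hw, e⟩ := hex z
    obtain ⟨w', p', hw', e'⟩ := hex z'
    change Ξ (δ z) = Ξ (δ z') at h
    rw [e, e', hΞ w p hw, hΞ w' p' hw', point_eq_iff] at h
    obtain ⟨h1, h2⟩ := h
    have h1 := quad_injective hij hic hjc h1
    rw [zeros_quad hij hic hjc] at h2
    refine δ.injective ?_
    rw [e, e']
    exact Subtype.ext ((fan_eq_iff hij hw hw').2 ⟨h1, h2⟩)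
  · intro z hz
    obtain ⟨w, p, hw, e⟩ := hex z
    rw [hδ, e] at hz
    have hp := (hrad p).1 ((fan_mem_boundary hij hw p).1 hz)
    refine ⟨w, _, hw, (quad_le hic hjc p).1, (quad_le hic hjc p).2,
      (quad_eq_iff hic hjc p).2 hp, ?_⟩
    change Ξ (δ z) = _
    rw [e, hΞ w p hw]
  · intro z hz
    obtain ⟨w, p, hw, e⟩ := hex z
    have hz := (hδ z).not.1 hz.ne
    rw [e] at hz
    have hp := mt (hrad p).2 (mt (fan_mem_boundary hij hw p).2 hz)
    have h3 := mt (quad_eq_iff hic hjc p).1 hp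
    push Not at h3
    refine ⟨w, _, hw, (quad_le hic hjc p).1.lt_of_ne' h3.1,
      (quad_le hic hjc p).2.lt_of_ne' h3.2, ?_⟩
    change Ξ (δ z) = _
    rw [e, hΞ w p hw]
  · intro w q hw h1 h2
    obtain ⟨p, rfl⟩ := exists_quad_eq hij hic hjc h1 h2
    refine ⟨δ.symm ⟨fan i j u w p, fan_mem hij hw p⟩, ?_⟩
    change Ξ (δ _) = _
    rw [Homeomorph.apply_symm_apply, hΞ w p hw]

end

end ColoredGraph

namespace ColoredGraph

section
variable {Γ : ColoredGraph 2} {i j c k : Fin 3}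

/-- The point of the triangle with coordinate `s` of color `c` and equal other coordinates. -/
noncomputable def midPt (c : Fin 3) (s : unitInterval) : stdSimplex ℝ (Fin 3) :=
  ⟨fun k => if k = c then s.1 else (1 - s.1) / 2, by
    refine ⟨fun k => ?_, ?_⟩
    · dsimp only
      split_ifs
      · exact s.2.1
      · linarith [s.2.2]
    · rw [Finset.sum_ite, Finset.filter_eq' Finset.univ c, if_pos (Finset.mem_univ c),
        Finset.filter_ne' Finset.univ c]
      simp
      ring⟩

theorem midPt_self (c : Fin 3) (s : unitInterval) : (midPt c s).1 c = s := if_pos rfl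

theorem midPt_ne (h : k ≠ c) (s : unitInterval) : (midPt c s).1 k = (1 - s) / 2 := if_neg h

theorem continuous_midPt (c : Fin 3) : Continuous (midPt c) := by
  refine Continuous.subtype_mk (continuous_pi fun k => ?_) _
  split_ifs
  · exact continuous_subtype_val
  · exact (continuous_const.sub continuous_subtype_val).div_const 2

/-- The distance from the middle of an edge, scaled so that it is `1 / 3` at its ends. -/
noncomputable def midDist (t : unitInterval) : unitInterval :=
  ⟨|1 - 2 * t.1| / 3, by positivity, by
    have h0 := t.2.1
    have h1 := t.2.2
    rw [div_le_one three_pos, abs_le]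
    constructor <;> linarith⟩

theorem midDist_le (t : unitInterval) : (midDist t : ℝ) ≤ 1 / 3 := by
  have h0 := t.2.1
  have h1 := t.2.2
  change |1 - 2 * t.1| / 3 ≤ 1 / 3
  gcongr
  rw [abs_le]
  constructor <;> linarith

theorem midDist_lt {t : unitInterval} (h0 : t ≠ 0) (h1 : t ≠ 1) : (midDist t : ℝ) < 1 / 3 := by
  have h0 := t.2.1.lt_of_ne' (fun h => h0 (Subtype.ext h))
  have h1 := t.2.2.lt_of_ne (fun h => h1 (Subtype.ext h))
  change |1 - 2 * t.1| / 3 < 1 / 3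
  gcongr
  rw [abs_lt]
  constructor <;> linarith

theorem midDist_zero : (midDist 0 : ℝ) = 1 / 3 := by
  change |1 - 2 * (0 : ℝ)| / 3 = 1 / 3
  norm_num

theorem midDist_symm (t : unitInterval) : midDist (unitInterval.symm t) = midDist t := by
  refine Subtype.ext ?_
  change |1 - 2 * (1 - t.1)| / 3 = |1 - 2 * t.1| / 3
  rw [← abs_neg]
  ring_nf

theorem continuous_midDist : Continuous midDist := by
  refine Continuous.subtype_mk ?_ _
  exact ((continuous_const.sub (continuous_const.mul continuous_subtype_val)).abs).div_const 3

theorem midDist_eq_zero {t : unitInterval} : (midDist t : ℝ) = 0 ↔ (t : ℝ) = 1 / 2 := by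
  change |1 - 2 * t.1| / 3 = 0 ↔ _
  rw [div_eq_zero_iff, abs_eq_zero]
  constructor
  · rintro (h | h) <;> linarith
  · intro h
    left
    linarith

theorem midDist_inj {t t' : unitInterval} (h : midDist t = midDist t') :
    t = t' ∨ t' = unitInterval.symm t := by
  have h : |1 - 2 * t.1| / 3 = |1 - 2 * t'.1| / 3 := congrArg Subtype.val h
  rw [div_left_inj' three_ne_zero, abs_eq_abs] at h
  rcases h with h | h
  · left
    refine Subtype.ext ?_
    linarith
  · right
    refine Subtype.ext ?_
    change (t' : ℝ) = 1 - t
    linarith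

theorem exists_midDist {s : unitInterval} (hs : (s : ℝ) ≤ 1 / 3) :
    ∃ t : unitInterval, (t : ℝ) ≤ 1 / 2 ∧ midDist t = s := by
  have h0 := s.2.1
  refine ⟨⟨(1 - 3 * s) / 2, by linarith, by linarith⟩, by dsimp only; linarith, Subtype.ext ?_⟩
  change |1 - 2 * ((1 - 3 * s.1) / 2)| / 3 = s.1
  rw [show 1 - 2 * ((1 - 3 * s.1) / 2) = 3 * s.1 by ring, abs_of_nonneg (by linarith)]
  ring

open Classical in
variable (Γ) in
/-- The edge of color `c` at `v`, in the two triangles of its ends. -/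
noncomputable def arcPath (c : Fin 3) (v : Γ.V) : C(unitInterval, Γ.Carrier) where
  toFun t := if (t : ℝ) ≤ 1 / 2 then Γ.point v (midPt c (midDist t))
    else Γ.point (Γ.adj c v) (midPt c (midDist t))
  continuous_toFun := by
    have h := (continuous_midPt c).comp continuous_midDist
    refine Continuous.if_le ((continuous_point _).comp h) ((continuous_point _).comp h)
      continuous_subtype_val continuous_const fun t ht => ?_
    refine (point_adj ?_ v).symm
    rw [midPt_self, midDist_eq_zero, ht]

theorem exists_arcPath_eq (c : Fin 3) (v : Γ.V) (t : unitInterval) : ∃ w,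
    (w = v ∨ w = Γ.adj c v) ∧ Γ.arcPath c v t = Γ.point w (midPt c (midDist t)) := by
  by_cases h : (t : ℝ) ≤ 1 / 2
  · exact ⟨v, Or.inl rfl, if_pos h⟩
  · exact ⟨_, Or.inr rfl, if_neg h⟩

theorem arcPath_of_le (c : Fin 3) (v : Γ.V) {t : unitInterval} (h : (t : ℝ) ≤ 1 / 2) :
    Γ.arcPath c v t = Γ.point v (midPt c (midDist t)) := if_pos h

theorem arcPath_of_ge (c : Fin 3) (v : Γ.V) {t : unitInterval} (h : 1 / 2 ≤ (t : ℝ)) :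
    Γ.arcPath c v t = Γ.point (Γ.adj c v) (midPt c (midDist t)) := by
  rcases h.eq_or_lt with h | h
  · rw [arcPath_of_le c v h.ge, point_adj]
    rw [midPt_self, midDist_eq_zero, ← h]
  · exact if_neg (not_le.2 h)

theorem zeros_midPt_subset (c : Fin 3) {s : unitInterval} (hs : (s : ℝ) ≤ 1 / 3) :
    zeros (midPt c s) ⊆ {c} := by
  intro k hk
  by_contra h
  have hk : (midPt c s).1 k = 0 := hk
  rw [midPt_ne h] at hk
  linarith

theorem comp_singleton_eq {w w' : Γ.V} (h : Γ.comp {c} w = Γ.comp {c} w') :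
    w' = w ∨ w' = Γ.adj c w := by
  have := eq_of_comp_eq (fun v => v = w ∨ v = Γ.adj c w) (fun c' hc' v => propext (by
    obtain rfl := hc'
    constructor
    · rintro (h | h)
      · right
        rw [← h, Γ.adj_adj]
      · left
        rw [← Γ.adj_adj c' v, h, Γ.adj_adj]
    · rintro (h | h)
      · right
        rw [h]
      · left
        rw [h, Γ.adj_adj])) h
  exact this.mp (Or.inl rfl)

theorem exists_midPt_eq {a b : Fin 3} (hab : a ≠ b) (hac : a ≠ c) (hbc : b ≠ c)
    {q : stdSimplex ℝ (Fin 3)} (h : q.1 a = q.1 b) (hle : q.1 c ≤ q.1 b) :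
    ∃ t : unitInterval, (t : ℝ) ≤ 1 / 2 ∧ midPt c (midDist t) = q := by
  have hs := sum_coords hab hac hbc q
  obtain ⟨t, ht, h'⟩ := exists_midDist (s := ⟨q.1 c, q.2.1 c, by linarith [q.2.1 a, q.2.1 b]⟩)
    (by dsimp only; linarith)
  refine ⟨t, ht, ?_⟩
  rw [h']
  refine simplex_ext hab ?_ ?_
  · rw [midPt_ne hac]
    dsimp only
    linarith
  · rw [midPt_ne hbc]
    dsimp only
    linarith

/-- On the dual graph, the largest coordinate is attained twice. -/
theorem midPt_not_strict (c k : Fin 3) {s : unitInterval} (hs : (s : ℝ) ≤ 1 / 3) :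
    ¬ ∀ l, l ≠ k → (midPt c s).1 l < (midPt c s).1 k := by
  intro h
  by_cases hk : k = c
  · subst hk
    obtain ⟨l, hl, -⟩ := exists_third k k
    have := h l hl.symm
    rw [midPt_self, midPt_ne hl.symm] at this
    linarith
  · obtain ⟨l, hl, hl'⟩ := exists_third k c
    have := h l hl.symm
    rw [midPt_ne hk, midPt_ne hl'.symm] at this
    exact lt_irrefl _ this

theorem midPt_inj {c c' : Fin 3} {s s' : unitInterval} (hs : (s : ℝ) < 1 / 3)
    (hs' : (s' : ℝ) ≤ 1 / 3) (h : midPt c s = midPt c' s') : c' = c := by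
  by_contra hne
  have h1 := midPt_self c' s'
  rw [← h, midPt_ne hne] at h1
  linarith

theorem arcPath_injective (c : Fin 3) (v : Γ.V) : Function.Injective (Γ.arcPath c v) := by
  have key : ∀ t : unitInterval, (t : ℝ) ≤ 1 / 2 →
      Γ.arcPath c v t = Γ.arcPath c v (unitInterval.symm t) → t = unitInterval.symm t := by
    intro t ht h
    have hs : (1 : ℝ) / 2 ≤ unitInterval.symm t := by
      rw [unitInterval.coe_symm_eq]
      linarith
    rw [arcPath_of_le c v ht, arcPath_of_ge c v hs, midDist_symm, point_eq_iff] at h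
    by_contra hne
    have hz : zeros (midPt c (midDist t)) = ∅ := by
      refine eq_empty_of_forall_notMem fun k hk => ?_
      obtain rfl := zeros_midPt_subset c (midDist_le t) hk
      have hk : (midPt k (midDist t)).1 k = 0 := hk
      rw [midPt_self, midDist_eq_zero] at hk
      refine hne (Subtype.ext ?_)
      rw [unitInterval.coe_symm_eq]
      linarith
    rw [hz] at h
    have := eq_of_comp_eq id (fun c hc => absurd hc (notMem_empty c)) h.2
    exact Γ.adj_ne c v this.symm
  intro t t' h
  obtain ⟨w, -, e⟩ := exists_arcPath_eq c v t
  obtain ⟨w', -, e'⟩ := exists_arcPath_eq c v t'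
  have h' := h
  rw [e, e', point_eq_iff] at h'
  have h1 : midDist t = midDist t' := Subtype.ext (by
    rw [← midPt_self c (midDist t), h'.1, midPt_self])
  rcases midDist_inj h1 with h1 | h1
  · exact h1
  · subst h1
    rcases le_total (t : ℝ) (1 / 2) with ht | ht
    · exact key t ht h
    · have := key (unitInterval.symm t) (by rw [unitInterval.coe_symm_eq]; linarith)
        (by rw [unitInterval.symm_symm]; exact h.symm)
      rw [unitInterval.symm_symm] at this
      exact this.symm

theorem add_one_ne (i : Fin 3) : i ≠ i + 1 ∧ i ≠ i + 2 ∧ i + 1 ≠ i + 2 := by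
  revert i
  decide

theorem exists_cell' (i : Fin 3) (q : Γ.Comp {i, i + 1}) :
    ∃ D : C(Metric.closedBall (0 : ℂ) 1, Γ.Carrier), Function.Injective D ∧
      (∀ z : Metric.closedBall (0 : ℂ) 1, ‖(z : ℂ)‖ = 1 → ∃ w p, Γ.comp {i, i + 1} w = q ∧
        p.1 i ≤ p.1 (i + 2) ∧ p.1 (i + 1) ≤ p.1 (i + 2) ∧
        (p.1 (i + 2) = p.1 i ∨ p.1 (i + 2) = p.1 (i + 1)) ∧ D z = Γ.point w p) ∧
      (∀ z : Metric.closedBall (0 : ℂ) 1, ‖(z : ℂ)‖ < 1 → ∃ w p, Γ.comp {i, i + 1} w = q ∧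
        p.1 i < p.1 (i + 2) ∧ p.1 (i + 1) < p.1 (i + 2) ∧ D z = Γ.point w p) ∧
      ∀ w p, Γ.comp {i, i + 1} w = q → p.1 i ≤ p.1 (i + 2) → p.1 (i + 1) ≤ p.1 (i + 2) →
        ∃ z, D z = Γ.point w p := by
  induction q using Quotient.inductionOn with
  | h v => exact exists_cell (add_one_ne i).1 (add_one_ne i).2.1 (add_one_ne i).2.2 v

variable (Γ) in
/-- The closed face of a two-colored cycle. -/
noncomputable def cell (i : Fin 3) (q : Γ.Comp {i, i + 1}) :
    C(Metric.closedBall (0 : ℂ) 1, Γ.Carrier) := (exists_cell' i q).choose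

theorem cell_spec (i : Fin 3) (q : Γ.Comp {i, i + 1}) : Function.Injective (Γ.cell i q) ∧
      (∀ z : Metric.closedBall (0 : ℂ) 1, ‖(z : ℂ)‖ = 1 → ∃ w p, Γ.comp {i, i + 1} w = q ∧
        p.1 i ≤ p.1 (i + 2) ∧ p.1 (i + 1) ≤ p.1 (i + 2) ∧
        (p.1 (i + 2) = p.1 i ∨ p.1 (i + 2) = p.1 (i + 1)) ∧ Γ.cell i q z = Γ.point w p) ∧
      (∀ z : Metric.closedBall (0 : ℂ) 1, ‖(z : ℂ)‖ < 1 → ∃ w p, Γ.comp {i, i + 1} w = q ∧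
        p.1 i < p.1 (i + 2) ∧ p.1 (i + 1) < p.1 (i + 2) ∧ Γ.cell i q z = Γ.point w p) ∧
      ∀ w p, Γ.comp {i, i + 1} w = q → p.1 i ≤ p.1 (i + 2) → p.1 (i + 1) ≤ p.1 (i + 2) →
        ∃ z, Γ.cell i q z = Γ.point w p :=
  (exists_cell' i q).choose_spec

/-- Every graph is regularly embedded in its carrier: its vertices are the barycenters of the
triangles, its edges cross the sides of the triangles in their midpoints, and its faces are the
closed dual cells of the vertices of the complex. -/
noncomputable def regularEmbedding (Γ : ColoredGraph 2) : Γ.RegularEmbedding 1 Γ.Carrier where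
  pt v := Γ.point v (midPt 0 (midDist 0))
  pt_injective v v' h := by
    have h := (point_eq_iff.1 h).2
    have hz : zeros (midPt 0 (midDist 0)) = ∅ := by
      refine eq_empty_of_forall_notMem fun k hk => ?_
      obtain rfl := zeros_midPt_subset 0 (midDist_le 0) hk
      have hk : (midPt 0 (midDist 0)).1 0 = 0 := hk
      rw [midPt_self, midDist_zero] at hk
      norm_num at hk
    rw [hz] at h
    exact eq_of_comp_eq id (fun c hc => absurd hc (notMem_empty c)) h
  arc := Γ.arcPath
  arc_zero c v := by
    rw [arcPath_of_le c v (by norm_num)]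
    congr 1
    refine Subtype.ext (funext fun k => ?_)
    change (if k = c then _ else _) = (if k = 0 then _ else _)
    rw [midDist_zero]
    norm_num
  arc_symm c v t := by
    have hs := unitInterval.coe_symm_eq t
    rcases le_total (t : ℝ) (1 / 2) with ht | ht
    · rw [arcPath_of_le _ _ ht, arcPath_of_ge c v (by linarith), midDist_symm]
    · rw [arcPath_of_ge _ _ ht, arcPath_of_le c v (by linarith), midDist_symm, Γ.adj_adj]
  arc_injective := arcPath_injective
  arc_disjoint c v c' v' t t' h0 h1 h := by
    obtain ⟨w, hw, e⟩ := exists_arcPath_eq c v t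
    obtain ⟨w', hw', e'⟩ := exists_arcPath_eq c' v' t'
    rw [e, e', point_eq_iff] at h
    obtain rfl := midPt_inj (midDist_lt h0 h1) (midDist_le t') h.1
    refine ⟨rfl, ?_⟩
    have h2 := comp_mono (zeros_midPt_subset _ (midDist_le t)) h.2
    have h3 : ∀ v w : Γ.V, (w = v ∨ w = Γ.adj c' v) → Γ.comp {c'} w = Γ.comp {c'} v := by
      rintro v _ (rfl | rfl)
      · rfl
      · exact Γ.comp_adj (mem_singleton c') v
    rw [h3 _ _ hw, h3 _ _ hw'] at h2
    exact comp_singleton_eq h2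
  disc i q := Γ.cell i q
  disc_injective i q := (cell_spec i q).1
  disc_boundary i q := by
    obtain ⟨-, h1, h2, h3⟩ := cell_spec i q
    obtain ⟨hij, hik, hjk⟩ := add_one_ne i
    ext x
    simp only [mem_iUnion, mem_image, mem_range]
    constructor
    · rintro ⟨z, hz, rfl⟩
      obtain ⟨w, p, hw, l1, l2, l3, e⟩ := h1 z hz
      rcases l3 with l3 | l3
      · obtain ⟨t, ht, rfl⟩ := exists_midPt_eq hik hij hjk.symm l3.symm l2
        exact ⟨w, hw, _, Or.inr rfl, t, (arcPath_of_le _ _ ht).trans e.symm⟩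
      · obtain ⟨t, ht, rfl⟩ := exists_midPt_eq hjk hij.symm hik.symm l3.symm l1
        exact ⟨w, hw, _, Or.inl rfl, t, (arcPath_of_le _ _ ht).trans e.symm⟩
    · rintro ⟨v, hv, c, hc, t, rfl⟩
      obtain ⟨w, hw, e⟩ := exists_arcPath_eq c v t
      have hmem : c ∈ ({i, i + 1} : Set (Fin 3)) := hc
      have hwq : Γ.comp {i, i + 1} w = q := by
        rcases hw with rfl | rfl
        · exact hv
        · exact (Γ.comp_adj hmem v).trans hv
      have hd := midDist_le t
      have hle : (midPt c (midDist t)).1 i ≤ (midPt c (midDist t)).1 (i + 2) ∧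
          (midPt c (midDist t)).1 (i + 1) ≤ (midPt c (midDist t)).1 (i + 2) := by
        rcases hmem with rfl | rfl
        · rw [midPt_self, midPt_ne hij.symm, midPt_ne hik.symm]
          exact ⟨by linarith, le_rfl⟩
        · rw [midPt_self, midPt_ne hij, midPt_ne hjk.symm]
          exact ⟨le_rfl, by linarith⟩
      obtain ⟨z, hz⟩ := h3 w _ hwq hle.1 hle.2
      refine ⟨z, ?_, hz.trans e.symm⟩
      by_contra hz1
      have hz1 : ‖(z : ℂ)‖ < 1 := (mem_closedBall_zero_iff.1 z.2).lt_of_ne hz1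
      obtain ⟨w', p', -, l1, l2, e'⟩ := h2 z hz1
      rw [hz, point_eq_iff] at e'
      refine midPt_not_strict c (i + 2) hd fun l hl => ?_
      rw [e'.1]
      rcases eq_or_eq_or_eq_third hij hik hjk l with rfl | rfl | rfl
      · exact l1
      · exact l2
      · exact absurd rfl hl
  disc_interior i q z hz c v := by
    rintro ⟨t, ht⟩
    obtain ⟨hij, hik, hjk⟩ := add_one_ne i
    obtain ⟨w, -, e⟩ := exists_arcPath_eq c v t
    obtain ⟨w', p', -, l1, l2, e'⟩ := (cell_spec i q).2.2.1 z hz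
    have := e.symm.trans (ht.trans e')
    rw [point_eq_iff] at this
    refine midPt_not_strict c (i + 2) (midDist_le t) fun l hl => ?_
    rw [this.1]
    rcases eq_or_eq_or_eq_third hij hik hjk l with rfl | rfl | rfl
    · exact l1
    · exact l2
    · exact absurd rfl hl
  disc_disjoint i q i' q' z z' hz hz' h := by
    obtain ⟨hij, hik, hjk⟩ := add_one_ne i
    obtain ⟨hij', hik', hjk'⟩ := add_one_ne i'
    obtain ⟨w, p, hw, l1, l2, e⟩ := (cell_spec i q).2.2.1 z hz
    obtain ⟨w', p', hw', l1', l2', e'⟩ := (cell_spec i' q').2.2.1 z' hz'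
    obtain ⟨rfl, h2⟩ := point_eq_iff.1 (e.symm.trans (h.trans e'))
    have hi : i = i' := by
      rcases eq_or_eq_or_eq_third hij hik hjk (i' + 2) with hh | hh | hh
      · rw [hh] at l1' l2'
        rcases eq_or_eq_or_eq_third hij' hik' hjk' (i + 2) with g | g | g
        · rw [← g] at l1'; linarith
        · rw [← g] at l2'; linarith
        · rw [hh] at g; exact absurd g hik.symm
      · rw [hh] at l1' l2'
        rcases eq_or_eq_or_eq_third hij' hik' hjk' (i + 2) with g | g | g
        · rw [← g] at l1'; linarith
        · rw [← g] at l2'; linarith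
        · rw [hh] at g; exact absurd g hjk.symm
      · exact (add_right_cancel hh).symm
    subst hi
    have hpos : p.1 (i + 2) ≠ 0 := by
      have := p.2.1 i
      linarith
    have := comp_mono (zeros_subset hij hik hjk hpos) h2
    rw [hw, hw'] at this
    rw [this]
  disc_cover x := by
    obtain ⟨v, p, rfl⟩ := point_surjective x
    obtain ⟨k, -, hk⟩ := Finset.exists_max_image Finset.univ (fun k => p.1 k)
      ⟨0, Finset.mem_univ 0⟩
    obtain ⟨i, rfl⟩ : ∃ i : Fin 3, k = i + 2 := ⟨k + 1, by clear * -; revert k; decide⟩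
    obtain ⟨z, hz⟩ := (cell_spec i (Γ.comp {i, i + 1} v)).2.2.2 v p rfl (hk _ (Finset.mem_univ _))
      (hk _ (Finset.mem_univ _))
    exact ⟨i, _, z, hz⟩

/-- Regular embeddings are carried along by homeomorphisms. -/
noncomputable def RegularEmbedding.map {d : ℕ} {Γ : ColoredGraph d} {ε : Equiv.Perm (Fin (d + 1))}
    {S T : Type*}
    [TopologicalSpace S] [TopologicalSpace T] (E : Γ.RegularEmbedding ε S) (h : S ≃ₜ T) :
    Γ.RegularEmbedding ε T where
  pt v := h (E.pt v)
  pt_injective := h.injective.comp E.pt_injective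
  arc c v := (h : C(S, T)).comp (E.arc c v)
  arc_zero c v := congrArg h (E.arc_zero c v)
  arc_symm c v t := congrArg h (E.arc_symm c v t)
  arc_injective c v := h.injective.comp (E.arc_injective c v)
  arc_disjoint c v c' v' t t' h0 h1 e := E.arc_disjoint c v c' v' t t' h0 h1 (h.injective e)
  disc i q := (h : C(S, T)).comp (E.disc i q)
  disc_injective i q := h.injective.comp (E.disc_injective i q)
  disc_boundary i q := by
    have := congrArg (h '' ·) (E.disc_boundary i q)
    simp only [image_iUnion, ← range_comp] at this
    rw [← image_comp] at this
    exact this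
  disc_interior i q z hz c v := by
    rintro ⟨t, ht⟩
    exact E.disc_interior i q z hz c v ⟨t, h.injective ht⟩
  disc_disjoint i q i' q' z z' hz hz' e := E.disc_disjoint i q i' q' z z' hz hz' (h.injective e)
  disc_cover x := by
    obtain ⟨i, q, z, hz⟩ := E.disc_cover (h.symm x)
    exact ⟨i, q, z, by simp [hz]⟩

end

end ColoredGraph

/-! ### Semi-equivelar gems from contracted graphs -/

namespace ColoredGraph

theorem compl_singleton_eq {i j c : Fin 3} (hij : i ≠ j) (hic : i ≠ c) (hjc : j ≠ c) :
    ({c}ᶜ : Set (Fin 3)) = {i, j} := by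
  ext k
  rcases eq_or_eq_or_eq_third hij hic hjc k with rfl | rfl | rfl
  · simp [hic]
  · simp [hjc]
  · simp [hic.symm, hjc.symm]

section
variable {Γ : ColoredGraph 2}

theorem IsContracted.card_V (h : Γ.IsContracted) [Nonempty Γ.V] :
    (Nat.card Γ.V : ℤ) = 6 - 2 * euler Γ.Carrier := by
  have h1 : ∀ k : Fin 3, Nat.card (Γ.Comp {k}ᶜ) = 1 := by
    intro k
    obtain ⟨i, hi⟩ : ∃ i, i ≠ k := ⟨k + 1, by revert k; decide⟩
    obtain ⟨j, hj⟩ := exists_third i k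
    rw [compl_singleton_eq hj.1 hi hj.2.symm, Nat.card_eq_one_iff_unique]
    refine ⟨⟨fun a b => ?_⟩, (inferInstance : Nonempty Γ.V).map (Γ.comp _)⟩
    induction a using Quotient.inductionOn with
    | h a =>
      induction b using Quotient.inductionOn with
      | h b => exact h i j hj.1 a b
  have h2 := euler_carrier Γ
  simp only [h1, Fin.sum_univ_three] at h2
  have : ((Nat.card Γ.V : ℤ) : ℚ) = ((6 - 2 * euler Γ.Carrier : ℤ) : ℚ) := by
    push_cast
    linarith
  exact_mod_cast this

theorem IsContracted.cycleLength_eq (h : Γ.IsContracted) {i j : Fin 3} (hij : i ≠ j) (v : Γ.V) :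
    Γ.cycleLength i j v = Nat.card Γ.V :=
  Nat.card_congr (Equiv.subtypeUnivEquiv fun w => h i j hij w v)

theorem isSemiEquivelarGem_of_cycleLength {K : Type} [TopologicalSpace K]
    (hK : IsClosedConnectedSurface K) (hΓ : Γ.Represents K) {n : ℕ}
    (hn : ∀ i v, Γ.cycleLength i (i + 1) v = n) : Γ.IsSemiEquivelarGem K K fun _ => n := by
  obtain ⟨e⟩ := hΓ
  exact ⟨⟨e⟩, hK, 1, ⟨Γ.regularEmbedding.map e⟩, fun v => ⟨0, Or.inl fun i => hn i v⟩⟩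

/-- If the graph is connected, so is its carrier, as adjacent simplices meet. -/
theorem preconnectedSpace_carrier {d : ℕ} {Γ : ColoredGraph d}
    (h : ∀ u v, Γ.comp univ u = Γ.comp univ v) (hd : 0 < d) : PreconnectedSpace Γ.Carrier := by
  rw [preconnectedSpace_iff_clopen]
  intro s hs
  have hcon : ∀ v p q, Γ.point v p ∈ s ↔ Γ.point v q ∈ s := by
    intro v p q
    have : PreconnectedSpace (stdSimplex ℝ (Fin (d + 1))) :=
      Subtype.preconnectedSpace (convex_stdSimplex ℝ _).isPreconnected
    rcases isClopen_iff.1 (hs.preimage (continuous_point v)) with h | h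
    · exact iff_of_false (fun h' => (h ▸ h' : p ∈ (∅ : Set _)))
        (fun h' => (h ▸ h' : q ∈ (∅ : Set _)))
    · exact iff_of_true (h ▸ mem_univ p : p ∈ Γ.point v ⁻¹' s)
        (h ▸ mem_univ q : q ∈ Γ.point v ⁻¹' s)
  have hF : ∀ u v p, Γ.point u p ∈ s ↔ Γ.point v p ∈ s := by
    intro u v p
    refine iff_of_eq (eq_of_comp_eq (fun u => Γ.point u p ∈ s) (fun c _ v => ?_) (h u v))
    obtain ⟨k, hk⟩ : ∃ k : Fin (d + 1), k ≠ c := by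
      have : Nontrivial (Fin (d + 1)) := Fin.nontrivial_iff_two_le.2 (by omega)
      exact exists_ne c
    have hp : (Pi.single k 1 : Fin (d + 1) → ℝ) c = 0 := Pi.single_eq_of_ne hk.symm 1
    rw [hcon (Γ.adj c v) p ⟨_, single_mem_stdSimplex ℝ k⟩,
      hcon v p ⟨_, single_mem_stdSimplex ℝ k⟩, point_adj hp]
  rcases s.eq_empty_or_nonempty with h0 | ⟨x, hx⟩
  · exact Or.inl h0
  · right
    refine eq_univ_of_forall fun y => ?_
    obtain ⟨u, p, rfl⟩ := point_surjective x
    obtain ⟨v, q, rfl⟩ := point_surjective y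
    rwa [hcon v q p, hF v u p]

/-- There is only one graph with two vertices. -/
theorem nonempty_homeomorph_of_card_eq_two {Γ' : ColoredGraph 2}
    (h : Nat.card Γ.V = 2) (h' : Nat.card Γ'.V = 2) : Nonempty (Γ.Carrier ≃ₜ Γ'.Carrier) := by
  obtain ⟨e⟩ := Finite.card_eq.1 (h.trans h'.symm)
  refine nonempty_carrier_homeomorph_of_equiv e fun c v => ?_
  obtain ⟨x, y, -, hxy⟩ := Nat.card_eq_two_iff.1 h'
  have key : ∀ a b c : Γ'.V, a ≠ c → b ≠ c → a = b := by
    have hm : ∀ a, a = x ∨ a = y := fun a => by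
      have : a ∈ ({x, y} : Set Γ'.V) := hxy ▸ mem_univ a
      exact this
    intro a b c hac hbc
    rcases hm a with rfl | rfl <;> rcases hm b with rfl | rfl <;> rcases hm c with rfl | rfl <;>
      simp_all
  exact key _ _ (e v) (e.injective.ne (Γ.adj_ne c v)) (Γ'.adj_ne c (e v))

end

/-- The graph of the cube; the color of an edge is its direction. -/
def cube : ColoredGraph 2 where
  V := Fin 3 → Bool
  finite_V := inferInstance
  adj c v := Function.update v c (!v c)
  adj_adj c v := by simp
  adj_ne c v h := by
    have := congrFun h c
    simp at this

theorem cube_adj (c : Fin 3) (v : Fin 3 → Bool) :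
    cube.adj c v = Function.update v c (!v c) := rfl

theorem cube_comp_eq_iff {i j c : Fin 3} (hij : i ≠ j) (hic : i ≠ c) (hjc : j ≠ c)
    {v w : Fin 3 → Bool} : cube.comp {i, j} w = cube.comp {i, j} v ↔ w c = v c := by
  constructor
  · intro h
    refine eq_of_comp_eq (Γ := cube) (fun v : Fin 3 → Bool => v c) (fun k hk v => ?_) h
    have hkc : c ≠ k := by
      rcases hk with rfl | rfl
      · exact hic.symm
      · exact hjc.symm
    exact Function.update_of_ne hkc _ _
  · intro h
    have key : ∀ a ∈ ({i, j} : Set (Fin 3)), ∀ (v : Fin 3 → Bool) (b : Bool),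
        cube.comp {i, j} (Function.update v a b) = cube.comp {i, j} v := by
      intro a ha v b
      by_cases hb : b = v a
      · rw [hb, Function.update_eq_self]
      · rw [show b = !v a by cases b <;> cases hv : v a <;> simp_all]
        exact cube.comp_adj ha v
    have : w = Function.update (Function.update v i (w i)) j (w j) := by
      funext k
      rcases eq_or_eq_or_eq_third hij hic hjc k with rfl | rfl | rfl
      · simp [hij]
      · simp
      · simp [hic.symm, hjc.symm, h]
    rw [this, key j (Or.inr rfl), key i (Or.inl rfl)]

theorem cube_cycleLength (i : Fin 3) (v : cube.V) : cube.cycleLength i (i + 1) v = 4 := by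
  have h : ∀ c (v : Fin 3 → Bool), Fintype.card {w : Fin 3 → Bool // w c = v c} = 4 := by decide
  rw [← h (i + 2) v, ← Nat.card_eq_fintype_card]
  obtain ⟨hij, hik, hjk⟩ := add_one_ne i
  exact Nat.card_congr (Equiv.subtypeEquivRight fun w => cube_comp_eq_iff hij hik hjk)

theorem euler_cube : euler cube.Carrier = 2 := by
  have h1 : ∀ k : Fin 3, Nat.card (cube.Comp {k}ᶜ) = 2 := by
    intro k
    obtain ⟨i, hi⟩ : ∃ i, i ≠ k := ⟨k + 1, by revert k; decide⟩
    obtain ⟨j, hj⟩ := exists_third i k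
    rw [compl_singleton_eq hj.1 hi hj.2.symm]
    have e : cube.Comp {i, j} ≃ Bool := Equiv.ofBijective
      (Quotient.lift (fun v : Fin 3 → Bool => v k) fun v w h =>
        (cube_comp_eq_iff hj.1 hi hj.2.symm).1 (Quotient.sound h)) (by
        constructor
        · intro a b
          induction a using Quotient.inductionOn with
          | h a =>
            induction b using Quotient.inductionOn with
            | h b => exact (cube_comp_eq_iff hj.1 hi hj.2.symm).2
        · intro b
          exact ⟨cube.comp _ (fun _ : Fin 3 => b), rfl⟩)
    rw [Nat.card_congr e, Nat.card_eq_fintype_card, Fintype.card_bool]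
  have h2 := euler_carrier cube
  have h3 : Nat.card cube.V = 8 := by
    change Nat.card (Fin 3 → Bool) = 8
    rw [Nat.card_eq_fintype_card]
    rfl
  simp only [h1, h3, Fin.sum_univ_three] at h2
  have : (euler cube.Carrier : ℚ) = (2 : ℤ) := by
    rw [h2]
    norm_num
  exact_mod_cast this

theorem preconnectedSpace_cube : PreconnectedSpace cube.Carrier := by
  have key : ∀ u v : Fin 3 → Bool, cube.comp univ u = cube.comp univ v := by
    have h0 : ∀ u v : Fin 3 → Bool, u 0 = v 0 → cube.comp univ u = cube.comp univ v :=
      fun u v h => comp_mono (subset_univ {1, 2})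
        ((cube_comp_eq_iff (i := 1) (j := 2) (c := 0) (by decide) (by decide) (by decide)).2 h)
    intro u v
    by_cases h : u 0 = v 0
    · exact h0 u v h
    · rw [← cube.comp_adj (mem_univ 0) v]
      refine h0 u _ ?_
      rw [cube_adj, Function.update_self]
      cases hu : u 0 <;> cases hv : v 0 <;> simp_all
  exact preconnectedSpace_carrier key two_pos

/-- The graph with two vertices and the cube are gems of the same space. -/
theorem nonempty_homeomorph_cube {Γ : ColoredGraph 2} (h : Nat.card Γ.V = 2) :
    Nonempty (cube.Carrier ≃ₜ Γ.Carrier) := by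
  have := preconnectedSpace_cube
  obtain ⟨Γ', h1, ⟨e⟩⟩ := cube.exists_isContracted
  have : Nonempty Γ'.V := by
    obtain ⟨v, -, -⟩ := point_surjective (e.symm (cube.point (fun _ : Fin 3 => true) (midPt 0 0)))
    exact ⟨v⟩
  have h2 := h1.card_V
  rw [euler_congr e, euler_cube] at h2
  obtain ⟨e'⟩ := nonempty_homeomorph_of_card_eq_two (Γ := Γ') (Γ' := Γ) (by omega) h
  exact ⟨e.symm.trans e'⟩

/-- A surface with a gem has a contracted gem, whose faces are all equally large. -/
theorem exists_semiEquivelar {K : Type} [TopologicalSpace K] (hK : IsClosedConnectedSurface K)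
    (h : ∃ Γ : ColoredGraph 2, Γ.Represents K) :
    ∃ n : ℕ, (n : ℤ) = 6 - 2 * euler K ∧ 2 ≤ n ∧
      (∃ Γ : ColoredGraph 2, Γ.IsSemiEquivelarGem K K (fun _ => n) ∧ Γ.IsGenusMinimal K) ∧
      (n = 2 → ∃ Γ : ColoredGraph 2, Γ.IsSemiEquivelarGem K K (fun _ => 4) ∧
        Γ.IsGenusMinimal K) := by
  have := hK.1
  obtain ⟨Γ₀, ⟨e₀⟩⟩ := h
  have : PreconnectedSpace Γ₀.Carrier :=
    ⟨by simpa using (isPreconnected_univ.image e₀.symm e₀.symm.continuous.continuousOn)⟩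
  obtain ⟨Γ, hΓ, ⟨e₁⟩⟩ := Γ₀.exists_isContracted
  have e := e₁.trans e₀
  have hne : Nonempty Γ.V := by
    obtain ⟨x⟩ := hK.1.toNonempty
    obtain ⟨v, -, -⟩ := point_surjective (e.symm x)
    exact ⟨v⟩
  have hcard := hΓ.card_V
  rw [euler_congr e] at hcard
  refine ⟨Nat.card Γ.V, hcard, ?_, ⟨Γ, ?_, Represents.isGenusMinimal ⟨e⟩⟩, fun h2 => ?_⟩
  · obtain ⟨v⟩ := hne
    have : Nontrivial Γ.V := ⟨_, _, Γ.adj_ne 0 v⟩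
    exact Finite.one_lt_card
  · exact isSemiEquivelarGem_of_cycleLength hK ⟨e⟩ fun i v =>
      hΓ.cycleLength_eq (add_one_ne i).1 v
  · obtain ⟨e'⟩ := nonempty_homeomorph_cube h2
    have hrep : cube.Represents K := ⟨e'.trans e⟩
    exact ⟨cube, isSemiEquivelarGem_of_cycleLength hK hrep cube_cycleLength, hrep.isGenusMinimal⟩

end ColoredGraph

/-! ### Gems of the sphere, the projective plane and the torus -/

namespace ColoredGraph

/-- The components of the graph of the cube are its faces. -/
theorem cube_comp_eq {S : Set (Fin 3)} {v w : Fin 3 → Bool} (h : ∀ c ∉ S, w c = v c) :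
    cube.comp S w = cube.comp S v := by
  have key : ∀ a (u : Fin 3 → Bool), (a ∉ S → w a = u a) →
      cube.comp S (Function.update u a (w a)) = cube.comp S u := by
    intro a u hu
    by_cases ha : a ∈ S
    · by_cases hb : w a = u a
      · rw [hb, Function.update_eq_self]
      · rw [show w a = !u a by cases h1 : w a <;> cases h2 : u a <;> simp_all]
        exact cube.comp_adj ha u
    · rw [hu ha, Function.update_eq_self]
  have hw : w = Function.update (Function.update (Function.update v 0 (w 0)) 1 (w 1)) 2 (w 2) := by
    funext k
    fin_cases k <;> simp [Function.update]
  conv_lhs => rw [hw]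
  rw [key 2, key 1, key 0]
  · exact h 0
  · intro ha
    rw [Function.update_of_ne (by decide), h 1 ha]
  · intro ha
    rw [Function.update_of_ne (by decide), Function.update_of_ne (by decide), h 2 ha]

/-- The point of the octahedron with absolute coordinates `p` in the octant `v`. -/
noncomputable def octant (v : Fin 3 → Bool) (p : stdSimplex ℝ (Fin 3)) :
    EuclideanSpace ℝ (Fin 3) := WithLp.toLp 2 fun c => if v c then -p.1 c else p.1 c

theorem octant_apply (v : Fin 3 → Bool) (p : stdSimplex ℝ (Fin 3)) (c : Fin 3) :
    octant v p c = if v c then -p.1 c else p.1 c := rfl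

theorem abs_octant (v : Fin 3 → Bool) (p : stdSimplex ℝ (Fin 3)) (c : Fin 3) :
    |octant v p c| = p.1 c := by
  rw [octant_apply]
  split_ifs
  · rw [abs_neg, abs_of_nonneg (p.2.1 c)]
  · exact abs_of_nonneg (p.2.1 c)

theorem octant_ne_zero (v : Fin 3 → Bool) (p : stdSimplex ℝ (Fin 3)) : octant v p ≠ 0 := by
  intro h
  have h0 : ∀ c, p.1 c = 0 := fun c => by rw [← abs_octant v p c, h]; simp
  have := p.2.2
  simp [h0] at this

theorem continuous_octant (v : Fin 3 → Bool) : Continuous (octant v) := by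
  refine (PiLp.continuous_toLp 2 _).comp (continuous_pi fun c => ?_)
  split_ifs
  · exact (continuous_coord c).neg
  · exact continuous_coord c

/-- Radial projection of the octahedron to the sphere. -/
noncomputable def spherePt (v : Fin 3 → Bool) (p : stdSimplex ℝ (Fin 3)) : TwoSphere :=
  ⟨‖octant v p‖⁻¹ • octant v p, by
    rw [mem_sphere_zero_iff_norm, norm_smul, norm_inv, norm_norm,
      inv_mul_cancel₀ (norm_ne_zero_iff.2 (octant_ne_zero v p))]⟩

theorem continuous_spherePt (v : Fin 3 → Bool) : Continuous (spherePt v) :=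
  Continuous.subtype_mk (((continuous_octant v).norm.inv₀ fun p =>
    norm_ne_zero_iff.2 (octant_ne_zero v p)).smul (continuous_octant v)) _

theorem octant_eq_of_spherePt_eq {v w : Fin 3 → Bool} {p q : stdSimplex ℝ (Fin 3)}
    (h : spherePt v p = spherePt w q) : p = q ∧ octant v p = octant w q := by
  have h : ‖octant v p‖⁻¹ • octant v p = ‖octant w q‖⁻¹ • octant w q := congrArg Subtype.val h
  have hv := norm_pos_iff.2 (octant_ne_zero v p)
  have hw := norm_pos_iff.2 (octant_ne_zero w q)
  have h1 : ∀ c, ‖octant v p‖⁻¹ * p.1 c = ‖octant w q‖⁻¹ * q.1 c := by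
    intro c
    have := congrArg (fun x : EuclideanSpace ℝ (Fin 3) => |x c|) h
    simpa [abs_mul, abs_octant, abs_of_pos hv, abs_of_pos hw] using this
  have h2 : ‖octant v p‖⁻¹ = ‖octant w q‖⁻¹ := by
    have := Finset.sum_congr rfl fun c (_ : c ∈ Finset.univ) => h1 c
    rwa [← Finset.mul_sum, ← Finset.mul_sum, p.2.2, q.2.2, mul_one, mul_one] at this
  have h0 : ‖octant w q‖⁻¹ ≠ 0 := inv_ne_zero hw.ne'
  refine ⟨Subtype.ext (funext fun c => ?_), ?_⟩
  · have := h1 c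
    rw [h2] at this
    exact mul_left_cancel₀ h0 this
  · rw [h2] at h
    exact smul_right_injective _ h0 h

theorem exists_spherePt_eq (x : TwoSphere) : ∃ v p, spherePt v p = x := by
  have hx : ‖x.1‖ = 1 := mem_sphere_zero_iff_norm.1 x.2
  set s : ℝ := ∑ c, |x.1 c| with hs
  have hs0 : 0 < s := by
    refine (Finset.sum_nonneg fun c _ => abs_nonneg _).lt_of_ne' fun h => ?_
    rw [Finset.sum_eq_zero_iff_of_nonneg fun c _ => abs_nonneg _] at h
    have : x.1 = 0 := by
      ext c
      exact abs_eq_zero.1 (h c (Finset.mem_univ c))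
    rw [this, norm_zero] at hx
    exact zero_ne_one hx
  let v : Fin 3 → Bool := fun c => decide (x.1 c < 0)
  let p : stdSimplex ℝ (Fin 3) := ⟨fun c => |x.1 c| / s,
    fun c => div_nonneg (abs_nonneg _) hs0.le, by rw [← Finset.sum_div, ← hs, div_self hs0.ne']⟩
  have ho : octant v p = s⁻¹ • x.1 := by
    ext c
    rw [octant_apply]
    change (if decide (x.1 c < 0) = true then -(|x.1 c| / s) else |x.1 c| / s) = s⁻¹ * x.1 c
    simp only [decide_eq_true_eq]
    split_ifs with h
    · rw [abs_of_neg h]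
      ring
    · rw [abs_of_nonneg (not_lt.1 h)]
      ring
  refine ⟨v, p, Subtype.ext ?_⟩
  change ‖octant v p‖⁻¹ • octant v p = x.1
  rw [ho, norm_smul, hx, mul_one, norm_inv, Real.norm_of_nonneg hs0.le, inv_inv, smul_smul,
    mul_inv_cancel₀ hs0.ne', one_smul]

theorem spherePt_congr {v w : Fin 3 → Bool} {p : stdSimplex ℝ (Fin 3)}
    (h : octant v p = octant w p) : spherePt v p = spherePt w p := by
  refine Subtype.ext ?_
  change ‖octant v p‖⁻¹ • octant v p = _
  rw [h]
  rfl

theorem octant_update {c : Fin 3} {p : stdSimplex ℝ (Fin 3)} (hp : p.1 c = 0) (v : Fin 3 → Bool)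
    (b : Bool) : octant (Function.update v c b) p = octant v p := by
  ext k
  rw [octant_apply, octant_apply]
  by_cases hk : k = c
  · subst hk
    rw [hp]
    simp
  · rw [Function.update_of_ne hk]

theorem eq_of_octant_eq {v w : Fin 3 → Bool} {p : stdSimplex ℝ (Fin 3)} {c : Fin 3}
    (h : octant v p c = octant w p c) (hc : p.1 c ≠ 0) : v c = w c := by
  rw [octant_apply, octant_apply] at h
  have hc' : p.1 c ≠ -p.1 c := fun e => hc (by linarith)
  cases hv : v c <;> cases hw : w c <;> simp_all

/-- The simplices of the cube graph are the octants of the sphere. -/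
theorem cube_represents : cube.Represents TwoSphere := by
  refine nonempty_carrier_homeomorph (Γ := cube) (fun v p => spherePt v p) continuous_spherePt
    exists_spherePt_eq ?_ ?_
  · exact fun v c p hp => spherePt_congr (octant_update hp (v : Fin 3 → Bool) _)
  · intro v w p q h
    obtain ⟨rfl, h⟩ := octant_eq_of_spherePt_eq h
    exact ⟨rfl, cube_comp_eq fun c hc => eq_of_octant_eq (congrFun (congrArg WithLp.ofLp h) c) hc⟩

section

/-- The products of pairs of coordinates, which are the same at antipodal points. -/
def veronese : ProjectivePlane → Fin 3 × Fin 3 → ℝ :=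
  Quot.lift (fun x a => x.1 a.1 * x.1 a.2) (by
    rintro x _ rfl
    funext a
    change _ = (-x.1) a.1 * (-x.1) a.2
    simp)

theorem continuous_veronese : Continuous veronese := by
  refine continuous_quot_lift _ (continuous_pi fun a => ?_)
  exact ((EuclideanSpace.proj (𝕜 := ℝ) a.1).continuous.comp continuous_subtype_val).mul
    ((EuclideanSpace.proj (𝕜 := ℝ) a.2).continuous.comp continuous_subtype_val)

theorem eq_or_eq_neg_of_veronese_eq {x y : TwoSphere}
    (h : veronese (Quot.mk _ x) = veronese (Quot.mk _ y)) : y = x ∨ y = -x := by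
  have h' : ∀ a b, x.1 a * x.1 b = y.1 a * y.1 b := fun a b => congrFun h (a, b)
  obtain ⟨c, hc⟩ : ∃ c, x.1 c ≠ 0 := by
    by_contra! h0
    have : x.1 = 0 := by
      ext c
      exact h0 c
    have hx : ‖x.1‖ = 1 := mem_sphere_zero_iff_norm.1 x.2
    rw [this, norm_zero] at hx
    exact zero_ne_one hx
  rcases mul_self_eq_mul_self_iff.1 (h' c c) with e | e
  · left
    refine Subtype.ext ?_
    ext b
    have := h' c b
    rw [← e] at this
    exact (mul_left_cancel₀ hc this).symm
  · right
    refine Subtype.ext ?_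
    ext b
    change y.1 b = -x.1 b
    have hy : y.1 c ≠ 0 := fun h0 => hc (by rw [e, h0, neg_zero])
    have h2 := h' c b
    rw [e, neg_mul, ← mul_neg] at h2
    rw [← mul_left_cancel₀ hy h2]

instance : T2Space ProjectivePlane := by
  refine T2Space.of_injective_continuous (fun a b h => ?_) continuous_veronese
  induction a using Quot.ind with
  | mk x =>
    induction b using Quot.ind with
    | mk y =>
      rcases eq_or_eq_neg_of_veronese_eq h with rfl | h
      · rfl
      · exact Quot.sound h

/-- The edges of a complete graph on four vertices. -/
def halfCubeAdj (c : Fin 3) (v : Bool × Bool) : Bool × Bool :=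
  if c = 0 then (!v.1, !v.2) else if c = 1 then (!v.1, v.2) else (v.1, !v.2)

/-- The quotient of the cube by the antipodal map, a complete graph on four vertices: the octants
are represented by those with positive first coordinate. -/
def halfCube : ColoredGraph 2 where
  V := Bool × Bool
  finite_V := inferInstance
  adj := halfCubeAdj
  adj_adj := by decide
  adj_ne := by decide

/-- The signs of the octant of a vertex. -/
def signs (v : Bool × Bool) : Fin 3 → Bool := ![false, v.1, v.2]

theorem halfCube_comp_eq {S : Set (Fin 3)} {v w : Bool × Bool} (h1 : 1 ∉ S → v.1 = w.1)
    (h2 : 2 ∉ S → v.2 = w.2) : halfCube.comp S v = halfCube.comp S w := by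
  have key1 : halfCube.comp S v = halfCube.comp S (w.1, v.2) := by
    by_cases h : 1 ∈ S
    · by_cases h' : v.1 = w.1
      · rw [← h']
      · rw [← halfCube.comp_adj h v]
        congr 1
        exact Prod.ext (by change (!v.1) = w.1; revert h'; cases v.1 <;> cases w.1 <;> decide) rfl
    · rw [← h1 h]
  have key2 : halfCube.comp S (w.1, v.2) = halfCube.comp S w := by
    by_cases h : 2 ∈ S
    · by_cases h' : v.2 = w.2
      · rw [h']
      · rw [← halfCube.comp_adj h w]
        congr 1
        exact Prod.ext rfl (by change v.2 = !w.2; revert h'; cases v.2 <;> cases w.2 <;> decide)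
    · rw [h2 h]
  rw [key1, key2]

theorem halfCube_isContracted : halfCube.IsContracted := by
  intro i j hij v w
  have key : ∀ c ∈ ({i, j} : Set (Fin 3)), ∀ v, halfCube.comp {i, j} (halfCube.adj c v) =
      halfCube.comp {i, j} v := fun c hc v => halfCube.comp_adj hc v
  have : ∀ i j : Fin 3, i ≠ j → ∀ v w : Bool × Bool, w = v ∨ w = halfCubeAdj i v ∨
      w = halfCubeAdj j v ∨ w = halfCubeAdj i (halfCubeAdj j v) := by decide
  rcases this i j hij v w with h | h | h | h <;> rw [h]
  · exact (key i (Or.inl rfl) v).symm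
  · exact (key j (Or.inr rfl) v).symm
  · exact ((key i (Or.inl rfl) _).trans (key j (Or.inr rfl) v)).symm

theorem neg_octant (v : Fin 3 → Bool) (p : stdSimplex ℝ (Fin 3)) :
    octant (fun c => !v c) p = -octant v p := by
  ext c
  change octant (fun c => !v c) p c = -octant v p c
  rw [octant_apply, octant_apply]
  cases v c <;> simp

theorem neg_spherePt (v : Fin 3 → Bool) (p : stdSimplex ℝ (Fin 3)) :
    spherePt (fun c => !v c) p = -spherePt v p := by
  refine Subtype.ext ?_
  change ‖octant (fun c => !v c) p‖⁻¹ • octant (fun c => !v c) p = -(‖octant v p‖⁻¹ • octant v p)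
  rw [neg_octant, norm_neg, smul_neg]

/-- Each pair of opposite octants is represented by the octant with positive first coordinate;
across the side of color zero, the adjacent octant is replaced by its antipode. -/
theorem halfCube_represents : halfCube.Represents ProjectivePlane := by
  refine nonempty_carrier_homeomorph (Γ := halfCube) (fun v p => Quot.mk _ (spherePt (signs v) p))
    (fun v => continuous_quot_mk.comp (continuous_spherePt _)) ?_ ?_ ?_
  · intro x
    induction x using Quot.ind with
    | mk x =>
      obtain ⟨v, p, rfl⟩ := exists_spherePt_eq x
      cases h : v 0
      · refine ⟨(v 1, v 2), p, ?_⟩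
        congr 2
        funext c
        fin_cases c <;> simp [signs, h]
      · refine ⟨(!v 1, !v 2), p, ?_⟩
        refine (Quot.sound ?_).symm
        rw [← neg_spherePt]
        congr 1
        funext c
        fin_cases c <;> simp [signs, h]
  · intro v c p hp
    have h : c = 0 ∨ c = 1 ∨ c = 2 := by
      clear * -
      revert c
      decide
    rcases h with rfl | rfl | rfl
    · refine (Quot.sound ?_).symm
      rw [← neg_spherePt]
      have e : signs (halfCubeAdj 0 v) = Function.update (fun c => !signs v c) 0 false := by
        funext c
        fin_cases c <;> rfl
      exact spherePt_congr ((congrArg (octant · p) e).trans (octant_update hp _ _))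
    · have e : signs (halfCubeAdj 1 v) = Function.update (signs v) 1 (!signs v 1) := by
        funext c
        fin_cases c <;> rfl
      exact congrArg _ (spherePt_congr ((congrArg (octant · p) e).trans (octant_update hp _ _)))
    · have e : signs (halfCubeAdj 2 v) = Function.update (signs v) 2 (!signs v 2) := by
        funext c
        fin_cases c <;> rfl
      exact congrArg _ (spherePt_congr ((congrArg (octant · p) e).trans (octant_update hp _ _)))
  · intro v w p q h
    rcases eq_or_eq_neg_of_veronese_eq (congrArg veronese h) with h | h
    · obtain ⟨rfl, h⟩ := octant_eq_of_spherePt_eq h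
      refine ⟨rfl, halfCube_comp_eq (fun hc => ?_) fun hc => ?_⟩
      · exact (eq_of_octant_eq (congrFun (congrArg WithLp.ofLp h) 1) hc).symm
      · exact (eq_of_octant_eq (congrFun (congrArg WithLp.ofLp h) 2) hc).symm
    · rw [← neg_spherePt] at h
      obtain ⟨rfl, h⟩ := octant_eq_of_spherePt_eq h
      refine ⟨rfl, ?_⟩
      have h := fun c => eq_of_octant_eq (c := c) (congrFun (congrArg WithLp.ofLp h) c)
      have h0 : (0 : Fin 3) ∈ zeros q := by
        by_contra h'
        have := h 0 h'
        simp [signs] at this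
      rw [← halfCube.comp_adj h0 v]
      exact halfCube_comp_eq (fun hc => (h 1 hc).symm) fun hc => (h 2 hc).symm

theorem euler_projectivePlane : euler ProjectivePlane = 1 := by
  obtain ⟨e⟩ := halfCube_represents
  have : Nonempty halfCube.V := ⟨((true, true) : Bool × Bool)⟩
  have h := halfCube_isContracted.card_V
  have h4 : Nat.card halfCube.V = 4 := by
    change Nat.card (Bool × Bool) = 4
    rw [Nat.card_eq_fintype_card]
    rfl
  rw [h4, euler_congr e] at h
  push_cast at h
  omega

end

end ColoredGraph

namespace ColoredGraph

/-- The point of the circle at distance `r` from the base point, as a part of the whole length, in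
one of the two directions. -/
noncomputable def circlePt (b : Bool) (r : ℝ) : Circle :=
  Circle.exp (if b then -(2 * Real.pi * r) else 2 * Real.pi * r)

theorem continuous_circlePt (b : Bool) : Continuous (circlePt b) := by
  refine Circle.exp.continuous.comp ?_
  split_ifs <;> fun_prop

/-- The two directions agree at the base point and at the opposite point. -/
theorem circlePt_flip (b : Bool) {r : ℝ} (hr : r = 0 ∨ r = 1 / 2) :
    circlePt (!b) r = circlePt b r := by
  have key : Circle.exp (-(2 * Real.pi * r)) = Circle.exp (2 * Real.pi * r) := by
    rcases hr with rfl | rfl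
    · simp
    · rw [show 2 * Real.pi * (1 / 2) = -(2 * Real.pi * (1 / 2)) + 2 * Real.pi by ring,
        Circle.exp_add, Circle.exp_two_pi, mul_one]
      ring_nf
  cases b
  · exact key
  · exact key.symm

theorem eq_of_circlePt_eq {b b' : Bool} {r r' : ℝ} (h0 : 0 ≤ r) (h1 : r ≤ 1 / 2) (h0' : 0 ≤ r')
    (h1' : r' ≤ 1 / 2) (h : circlePt b r = circlePt b' r') :
    r = r' ∧ (r ≠ 0 → r ≠ 1 / 2 → b = b') := by
  have hpi := Real.pi_pos
  have h := congrArg (fun z : Circle => (z : ℂ)) h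
  simp only [circlePt, Circle.coe_exp] at h
  have hre := congrArg Complex.re h
  have him := congrArg Complex.im h
  rw [Complex.exp_ofReal_mul_I_re, Complex.exp_ofReal_mul_I_re] at hre
  rw [Complex.exp_ofReal_mul_I_im, Complex.exp_ofReal_mul_I_im] at him
  have hcos : ∀ (b : Bool) (r : ℝ), Real.cos (if b then -(2 * Real.pi * r) else 2 * Real.pi * r) =
      Real.cos (2 * Real.pi * r) := by
    intro b r
    cases b <;> simp
  rw [hcos, hcos] at hre
  have e := Real.injOn_cos ⟨by positivity, by nlinarith⟩ ⟨by positivity, by nlinarith⟩ hre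
  have e : r = r' := mul_left_cancel₀ (by positivity) e
  subst e
  refine ⟨rfl, fun hr0 hr1 => ?_⟩
  have hr0 := h0.lt_of_ne' hr0
  have hr1 := h1.lt_of_ne hr1
  have hsin : 0 < Real.sin (2 * Real.pi * r) :=
    Real.sin_pos_of_pos_of_lt_pi (by positivity) (by nlinarith)
  cases b <;> cases b' <;> simp at him ⊢ <;> linarith

theorem exists_circlePt_eq (z : Circle) : ∃ b r, 0 ≤ r ∧ r ≤ 1 / 2 ∧ circlePt b r = z := by
  have hpi := Real.pi_pos
  have h1 := Complex.neg_pi_lt_arg (z : ℂ)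
  have h2 := Complex.arg_le_pi (z : ℂ)
  have hz := Circle.exp_arg z
  set θ := Complex.arg (z : ℂ)
  rcases le_total 0 θ with h | h
  · refine ⟨false, θ / (2 * Real.pi), by positivity, ?_, ?_⟩
    · rw [div_le_iff₀ (by positivity)]
      linarith
    · rw [← hz, circlePt, if_neg Bool.false_ne_true, mul_div_cancel₀]
      positivity
  · refine ⟨true, -θ / (2 * Real.pi), div_nonneg (by linarith) (by positivity), ?_, ?_⟩
    · rw [div_le_iff₀ (by positivity)]
      linarith
    · rw [← hz, circlePt, if_pos rfl, mul_div_cancel₀ _ (by positivity), neg_neg]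

/-- The edges of the graph of the barycentric subdivision of a square. A triangle is given by
whether its horizontal distances from the center of the torus are smaller than the vertical ones,
and by the signs of its horizontal and its vertical coordinates. -/
def torusAdj (c : Fin 3) (v : Bool × Bool × Bool) : Bool × Bool × Bool :=
  if c = 1 then (!v.1, v.2.1, v.2.2)
  else if (c = 0) = (v.1 = false) then (v.1, !v.2.1, v.2.2)
  else (v.1, v.2.1, !v.2.2)

/-- The graph of the barycentric subdivision of a square with opposite sides identified. -/
def torusGraph : ColoredGraph 2 where
  V := Bool × Bool × Bool
  finite_V := inferInstance
  adj := torusAdj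
  adj_adj := by decide
  adj_ne := by decide

/-- The larger absolute value of the two coordinates of a point of a triangle of the subdivision, in
the square with sides of length one and center zero. -/
noncomputable def outerDist (p : stdSimplex ℝ (Fin 3)) : ℝ := (p.1 1 + p.1 2) / 2

/-- The smaller absolute value of the two coordinates of a point of a triangle of the subdivision,
in the same square. -/
noncomputable def innerDist (p : stdSimplex ℝ (Fin 3)) : ℝ := p.1 2 / 2

/-- The position of a point of a triangle in the torus. -/
noncomputable def torusPt (v : Bool × Bool × Bool) (p : stdSimplex ℝ (Fin 3)) : Torus :=
  (circlePt v.2.1 (if v.1 then innerDist p else outerDist p),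
    circlePt v.2.2 (if v.1 then outerDist p else innerDist p))

theorem dist_mem (p : stdSimplex ℝ (Fin 3)) :
    0 ≤ innerDist p ∧ innerDist p ≤ outerDist p ∧ outerDist p ≤ 1 / 2 := by
  have hs := p.2.2
  rw [Fin.sum_univ_three] at hs
  have h0 := p.2.1 0
  have h1 := p.2.1 1
  have h2 := p.2.1 2
  rw [innerDist, outerDist]
  refine ⟨?_, ?_, ?_⟩ <;> linarith

theorem dist_eq_iff (p : stdSimplex ℝ (Fin 3)) : (p.1 0 = 0 ↔ outerDist p = 1 / 2) ∧
    (p.1 1 = 0 ↔ innerDist p = outerDist p) ∧ (p.1 2 = 0 ↔ innerDist p = 0) := by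
  have hs := p.2.2
  rw [Fin.sum_univ_three] at hs
  rw [innerDist, outerDist]
  refine ⟨⟨fun _ => ?_, fun _ => ?_⟩, ⟨fun _ => ?_, fun _ => ?_⟩, ⟨fun _ => ?_, fun _ => ?_⟩⟩ <;>
    linarith

theorem continuous_torusPt (v : Bool × Bool × Bool) : Continuous (torusPt v) := by
  have h1 : Continuous outerDist :=
    ((continuous_coord 1).add (continuous_coord 2)).div_const 2
  have h2 : Continuous innerDist := (continuous_coord 2).div_const 2
  refine ((continuous_circlePt _).comp ?_).prodMk ((continuous_circlePt _).comp ?_) <;>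
    split_ifs <;> assumption

theorem torusPt_adj (v : Bool × Bool × Bool) (c : Fin 3) (p : stdSimplex ℝ (Fin 3))
    (hp : p.1 c = 0) : torusPt (torusAdj c v) p = torusPt v p := by
  obtain ⟨h0, h1, h2⟩ := dist_eq_iff p
  obtain ⟨w, s, t⟩ := v
  have hc : c = 0 ∨ c = 1 ∨ c = 2 := by
    clear * -
    revert c
    decide
  rcases hc with rfl | rfl | rfl
  · have e := h0.1 hp
    cases w
    · exact Prod.ext (circlePt_flip s (Or.inr e)) rfl
    · exact Prod.ext rfl (circlePt_flip t (Or.inr e))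
  · have e := h1.1 hp
    cases w <;> simp [torusPt, torusAdj, e]
  · have e := h2.1 hp
    cases w
    · exact Prod.ext rfl (circlePt_flip t (Or.inl e))
    · exact Prod.ext (circlePt_flip s (Or.inl e)) rfl

/-- The sign of the coordinate with the larger or with the smaller absolute value. -/
def signAt (outer : Bool) (v : Bool × Bool × Bool) : Bool := if v.1 = outer then v.2.2 else v.2.1

/-- The center and the corner of the square lie in all eight triangles. -/
theorem torus_comp_eq_corner {S : Set (Fin 3)} (h1 : 1 ∈ S) {c : Fin 3} (hc : c = 0 ∨ c = 2)
    (hcS : c ∈ S) (v w : Bool × Bool × Bool) : torusGraph.comp S v = torusGraph.comp S w := by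
  -- the colors `c` and `1` alternate along a cycle through all vertices
  have key : ∀ c : Fin 3, c = 0 ∨ c = 2 → ∀ v w : Bool × Bool × Bool, ∃ k : Fin 4,
      w = (fun v => torusAdj c (torusAdj 1 v))^[k] v ∨
      w = torusAdj 1 ((fun v => torusAdj c (torusAdj 1 v))^[k] v) := by decide
  have hit : ∀ (k : ℕ) (v : Bool × Bool × Bool), torusGraph.comp S
      ((fun v => torusAdj c (torusAdj 1 v))^[k] v) = torusGraph.comp S v := by
    intro k
    induction k with
    | zero => intro v; rfl
    | succ k ih =>
      intro v
      rw [Function.iterate_succ_apply, ih]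
      exact (torusGraph.comp_adj hcS _).trans (torusGraph.comp_adj h1 v)
  obtain ⟨k, h | h⟩ := key c hc v w
  · rw [h, hit]
  · rw [h]
    exact ((torusGraph.comp_adj h1 _).trans (hit k v)).symm

/-- The colors zero and two change the signs of the two coordinates. -/
theorem torus_comp_eq_side {S : Set (Fin 3)} {v w : Bool × Bool × Bool} (h : v.1 = w.1)
    (h0 : 0 ∉ S → signAt true v = signAt true w) (h2 : 2 ∉ S → signAt false v = signAt false w) :
    torusGraph.comp S v = torusGraph.comp S w := by
  have key : ∀ v w : Bool × Bool × Bool, v.1 = w.1 → w =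
      (if signAt true v = signAt true w then id else torusAdj 0)
        ((if signAt false v = signAt false w then id else torusAdj 2) v) := by decide
  rw [key v w h]
  split_ifs with e0 e2 e2
  · rfl
  · exact (torusGraph.comp_adj (not_not.1 fun hn => e2 (h2 hn)) v).symm
  · exact (torusGraph.comp_adj (not_not.1 fun hn => e0 (h0 hn)) v).symm
  · exact ((torusGraph.comp_adj (not_not.1 fun hn => e0 (h0 hn)) _).trans
      (torusGraph.comp_adj (not_not.1 fun hn => e2 (h2 hn)) v)).symm

theorem torusGraph_represents : torusGraph.Represents Torus := by
  refine nonempty_carrier_homeomorph (Γ := torusGraph) (fun v p => torusPt v p)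
    continuous_torusPt ?_ torusPt_adj ?_
  · rintro ⟨x, y⟩
    obtain ⟨s, a, ha0, ha1, rfl⟩ := exists_circlePt_eq x
    obtain ⟨t, b, hb0, hb1, rfl⟩ := exists_circlePt_eq y
    have key : ∀ a b : ℝ, 0 ≤ b → b ≤ a → a ≤ 1 / 2 → ∃ p, outerDist p = a ∧ innerDist p = b := by
      intro a b h0 h1 h2
      refine ⟨⟨![1 - 2 * a, 2 * (a - b), 2 * b], fun c => ?_, ?_⟩, ?_, ?_⟩
      · fin_cases c
        · change 0 ≤ 1 - 2 * a
          linarith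
        · change 0 ≤ 2 * (a - b)
          linarith
        · change 0 ≤ 2 * b
          linarith
      · rw [Fin.sum_univ_three]
        change 1 - 2 * a + 2 * (a - b) + 2 * b = 1
        ring
      · change (2 * (a - b) + 2 * b) / 2 = a
        ring
      · change 2 * b / 2 = b
        ring
    rcases le_total b a with h | h
    · obtain ⟨p, rfl, rfl⟩ := key a b hb0 h ha1
      exact ⟨(false, s, t), p, rfl⟩
    · obtain ⟨p, rfl, rfl⟩ := key b a ha0 h hb1
      exact ⟨(true, s, t), p, rfl⟩
  · rintro ⟨w, s, t⟩ ⟨w', s', t'⟩ p q h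
    obtain ⟨p0, p1, p2⟩ := dist_mem p
    obtain ⟨q0, q1, q2⟩ := dist_mem q
    obtain ⟨hx, hx'⟩ := eq_of_circlePt_eq (by split_ifs <;> linarith) (by split_ifs <;> linarith)
      (by split_ifs <;> linarith) (by split_ifs <;> linarith) (congrArg Prod.fst h)
    obtain ⟨hy, hy'⟩ := eq_of_circlePt_eq (by split_ifs <;> linarith) (by split_ifs <;> linarith)
      (by split_ifs <;> linarith) (by split_ifs <;> linarith) (congrArg Prod.snd h)
    dsimp only at hx hx' hy hy'
    have hd : outerDist p = outerDist q ∧ innerDist p = innerDist q := by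
      cases w <;> cases w' <;> simp at hx hy <;> constructor <;> linarith
    obtain rfl : p = q := by
      rw [outerDist, outerDist, innerDist, innerDist] at hd
      exact simplex_ext (i := 1) (j := 2) (by decide) (by linarith) (by linarith)
    refine ⟨rfl, ?_⟩
    obtain ⟨e0, e1, e2⟩ := dist_eq_iff p
    -- on a diagonal of the square, the coordinates have equal absolute values
    by_cases h1 : p.1 1 = 0
    · have e := e1.1 h1
      by_cases h2 : p.1 2 = 0
      · exact torus_comp_eq_corner h1 (Or.inr rfl) h2 _ _
      · by_cases h0 : p.1 0 = 0
        · exact torus_comp_eq_corner h1 (Or.inl rfl) h0 _ _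
        · have h2' := mt e2.2 h2
          have h0' := mt e0.2 h0
          have hs : s = s' := hx' (by rw [e, ite_self, ← e]; exact h2')
            (by rw [e, ite_self]; exact h0')
          have ht : t = t' := hy' (by rw [e, ite_self, ← e]; exact h2')
            (by rw [e, ite_self]; exact h0')
          subst hs ht
          by_cases hw : w = w'
          · rw [hw]
          · refine (torusGraph.comp_adj h1 (w, s, t)).symm.trans (congrArg _ ?_)
            refine Prod.ext ?_ rfl
            change (!w) = w'
            revert hw
            cases w <;> cases w' <;> decide
    · have hlt := p1.lt_of_ne (mt e1.2 h1)
      obtain rfl : w = w' := by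
        cases w <;> cases w' <;> simp at hx ⊢ <;> linarith
      refine torus_comp_eq_side rfl (fun h0 => ?_) fun h2 => ?_
      · have h0' : outerDist p ≠ 1 / 2 := mt e0.2 h0
        cases w
        · exact hx' (by simp; linarith) h0'
        · exact hy' (by simp; linarith) h0'
      · have h2' : innerDist p ≠ 0 := mt e2.2 h2
        cases w
        · exact hy' h2' (by simp; linarith)
        · exact hx' h2' (by simp; linarith)

theorem euler_torus : euler Torus = 0 := by
  obtain ⟨e⟩ := torusGraph_represents
  have h1 : ∀ c : Fin 3, c = 0 ∨ c = 2 → ∀ S : Set (Fin 3), 1 ∈ S → c ∈ S →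
      Nat.card (torusGraph.Comp S) = 1 := by
    intro c hc S h1 hS
    rw [Nat.card_eq_one_iff_unique]
    refine ⟨⟨fun a b => ?_⟩, ⟨torusGraph.comp S ((true, true, true) : Bool × Bool × Bool)⟩⟩
    induction a using Quotient.inductionOn with
    | h a =>
      induction b using Quotient.inductionOn with
      | h b => exact torus_comp_eq_corner h1 hc hS a b
  have h2 : Nat.card (torusGraph.Comp {1}ᶜ) = 2 := by
    have e : torusGraph.Comp {1}ᶜ ≃ Bool := Equiv.ofBijective
      (Quotient.lift (fun v : Bool × Bool × Bool => v.1) fun v w h => by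
        refine eq_of_comp_eq (Γ := torusGraph) (fun v : Bool × Bool × Bool => v.1)
          (fun c hc v => ?_) (Quotient.sound h)
        have : ∀ c : Fin 3, c ≠ 1 → ∀ v, (torusAdj c v).1 = v.1 := by decide
        exact this c hc v) (by
        constructor
        · intro a b
          induction a using Quotient.inductionOn with
          | h a =>
            induction b using Quotient.inductionOn with
            | h b =>
              have h0 : (0 : Fin 3) ∈ ({1}ᶜ : Set (Fin 3)) := by simp
              have h2 : (2 : Fin 3) ∈ ({1}ᶜ : Set (Fin 3)) := by simp
              exact fun h => torus_comp_eq_side h (fun hn => absurd h0 hn) fun hn => absurd h2 hn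
        · intro b
          exact ⟨torusGraph.comp _ ((b, true, true) : Bool × Bool × Bool), rfl⟩)
    rw [Nat.card_congr e, Nat.card_eq_fintype_card, Fintype.card_bool]
  have h3 : Nat.card torusGraph.V = 8 := by
    change Nat.card (Bool × Bool × Bool) = 8
    rw [Nat.card_eq_fintype_card]
    rfl
  have h4 := euler_carrier torusGraph
  rw [euler_congr e, Fin.sum_univ_three, h2, h3,
    h1 2 (Or.inr rfl) {0}ᶜ (by simp) (by simp), h1 0 (Or.inl rfl) {2}ᶜ (by simp) (by simp)] at h4
  have : (euler Torus : ℚ) = (0 : ℤ) := by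
    rw [h4]
    norm_num
  exact_mod_cast this

end ColoredGraph

/-! ### The gem of a triangulated surface -/

namespace AbstractSimplicialComplex

section
variable {V : Type} [DecidableEq V] (X : AbstractSimplicialComplex V)

/-- The three vertices span a triangle of the complex. -/
def IsTriangle (x y z : V) : Prop := x ≠ y ∧ x ≠ z ∧ y ≠ z ∧ ({x, y, z} : Finset V) ∈ X.faces

/-- The combinatorial properties of a closed surface that the construction of its gem needs: all
maximal faces are triangles, every edge is on exactly two triangles, and the triangles around a
vertex are connected to each other across edges. The last property is stated by means of invariant
predicates on the opposite sides of the triangles. -/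
structure IsCombinatorialSurface : Prop where
  pure : ∀ s ∈ X.faces, ∃ x y z, X.IsTriangle x y z ∧ s ⊆ {x, y, z}
  two : ∀ x y z, X.IsTriangle x y z →
    ∃ z', z' ≠ z ∧ X.IsTriangle x y z' ∧ ∀ w, X.IsTriangle x y w → w = z ∨ w = z'
  link : ∀ (x : V) (F : V → V → Prop), (∀ y z, F y z → F z y) →
    (∀ y z z', X.IsTriangle x y z → X.IsTriangle x y z' → F y z → F y z') →
    ∀ y z y' z', X.IsTriangle x y z → X.IsTriangle x y' z' → F y z → F y' z'

variable {X} {x y z : V}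

theorem IsTriangle.swap_left (h : X.IsTriangle x y z) : X.IsTriangle y x z :=
  ⟨h.1.symm, h.2.2.1, h.2.1, by rw [Finset.insert_comm]; exact h.2.2.2⟩

theorem IsTriangle.swap_right (h : X.IsTriangle x y z) : X.IsTriangle x z y :=
  ⟨h.2.1, h.1, h.2.2.1.symm, by rw [Finset.pair_comm]; exact h.2.2.2⟩

variable (X) in
/-- The triangles of the barycentric subdivision: triangles with an order of their vertices. -/
abbrev Flag : Type := {t : V × V × V // X.IsTriangle t.1 t.2.1 t.2.2}

/-- A triangle with its order of vertices. -/
def IsTriangle.flag (h : X.IsTriangle x y z) : X.Flag := ⟨(x, y, z), h⟩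

/-- The other triangle on the side spanned by the first two vertices. -/
noncomputable def IsCombinatorialSurface.opp (h : X.IsCombinatorialSurface) (t : X.Flag) : X.Flag :=
  ⟨(t.1.1, t.1.2.1, (h.two _ _ _ t.2).choose), (h.two _ _ _ t.2).choose_spec.2.1⟩

theorem IsCombinatorialSurface.opp_ne (h : X.IsCombinatorialSurface) (t : X.Flag) : h.opp t ≠ t :=
  fun e => (h.two _ _ _ t.2).choose_spec.1 (congrArg (fun t : X.Flag => t.1.2.2) e)

theorem IsCombinatorialSurface.eq_or_eq_opp (h : X.IsCombinatorialSurface) {t t' : X.Flag}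
    (h1 : t'.1.1 = t.1.1) (h2 : t'.1.2.1 = t.1.2.1) : t' = t ∨ t' = h.opp t := by
  obtain ⟨⟨x, y, z⟩, ht⟩ := t
  obtain ⟨⟨x', y', z'⟩, ht'⟩ := t'
  dsimp only at h1 h2
  subst h1 h2
  refine ((h.two _ _ _ ht).choose_spec.2.2 z' ht').imp (fun e => ?_) (fun e => ?_)
  · exact Subtype.ext (Prod.ext rfl (Prod.ext rfl e))
  · exact Subtype.ext (Prod.ext rfl (Prod.ext rfl e))

/-- The face that is the vertex of color `k` of a triangle of the barycentric subdivision. -/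
def flagFace (k : Fin 3) (t : X.Flag) : Finset V :=
  match k with
  | 0 => {t.1.1}
  | 1 => {t.1.1, t.1.2.1}
  | 2 => {t.1.1, t.1.2.1, t.1.2.2}

theorem flagFace_mem (k : Fin 3) (t : X.Flag) :
    flagFace k t ∈ X.faces ∧ (flagFace k t).card = k + 1 := by
  obtain ⟨⟨x, y, z⟩, h1, h2, h3, h4⟩ := t
  match k with
  | 0 =>
    refine ⟨(X.isRelLowerSet_faces h4).2 ?_ ⟨x, by simp [flagFace]⟩, by simp [flagFace]⟩
    simp [flagFace]
  | 1 =>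
    refine ⟨(X.isRelLowerSet_faces h4).2 ?_ ⟨x, by simp [flagFace]⟩, ?_⟩
    · intro v hv
      simp only [flagFace, Finset.mem_insert, Finset.mem_singleton] at hv ⊢
      tauto
    · exact Finset.card_pair h1
  | 2 => exact ⟨h4, Finset.card_eq_three.2 ⟨x, y, z, h1, h2, h3, rfl⟩⟩

theorem exists_flagFace_eq (h : X.IsCombinatorialSurface) (k : Fin 3) {s : Finset V}
    (hs : s ∈ X.faces) (hc : s.card = k + 1) :
    ∃ t : X.Flag, flagFace k t = s := by
  obtain ⟨a, b, c, ht, hsub⟩ := h.pure s hs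
  match k with
  | 0 =>
    obtain ⟨x, rfl⟩ := Finset.card_eq_one.1 hc
    have hx : x = a ∨ x = b ∨ x = c := by simpa using hsub
    rcases hx with rfl | rfl | rfl
    · exact ⟨ht.flag, rfl⟩
    · exact ⟨ht.swap_left.flag, rfl⟩
    · exact ⟨ht.swap_right.swap_left.flag, rfl⟩
  | 1 =>
    obtain ⟨x, y, hxy, rfl⟩ := Finset.card_eq_two.1 hc
    have hx : x = a ∨ x = b ∨ x = c := by simpa using hsub (Finset.mem_insert_self x _)
    have hy : y = a ∨ y = b ∨ y = c := by
      simpa using hsub (Finset.mem_insert_of_mem (Finset.mem_singleton_self y))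
    rcases hx with rfl | rfl | rfl <;> rcases hy with rfl | rfl | rfl
    · exact absurd rfl hxy
    · exact ⟨ht.flag, rfl⟩
    · exact ⟨ht.swap_right.flag, rfl⟩
    · exact ⟨ht.swap_left.flag, rfl⟩
    · exact absurd rfl hxy
    · exact ⟨ht.swap_left.swap_right.flag, rfl⟩
    · exact ⟨ht.swap_right.swap_left.flag, rfl⟩
    · exact ⟨ht.swap_left.swap_right.swap_left.flag, rfl⟩
    · exact absurd rfl hxy
  | 2 =>
    obtain ⟨x, y, z, h1, h2, h3, rfl⟩ := Finset.card_eq_three.1 hc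
    exact ⟨⟨(x, y, z), h1, h2, h3, hs⟩, rfl⟩

variable [Finite V]

/-- The graph of the barycentric subdivision. -/
noncomputable def IsCombinatorialSurface.flagGraph (h : X.IsCombinatorialSurface) :
    ColoredGraph 2 where
  V := X.Flag
  finite_V := inferInstance
  adj c t := match c with
    | 0 => ⟨(t.1.2.1, t.1.1, t.1.2.2), t.2.swap_left⟩
    | 1 => ⟨(t.1.1, t.1.2.2, t.1.2.1), t.2.swap_right⟩
    | 2 => h.opp t
  adj_adj c t := by
    match c with
    | 0 => rfl
    | 1 => rfl
    | 2 =>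
      rcases h.eq_or_eq_opp (t := h.opp t) (t' := t) rfl rfl with e | e
      · exact absurd e.symm (h.opp_ne t)
      · exact e.symm
  adj_ne c t := by
    match c with
    | 0 => exact fun e => t.2.1.symm (congrArg (fun t : X.Flag => t.1.1) e)
    | 1 => exact fun e => t.2.2.2.1.symm (congrArg (fun t : X.Flag => t.1.2.1) e)
    | 2 => exact h.opp_ne t

variable (h : X.IsCombinatorialSurface)

theorem comp_swap_left {S : Set (Fin 3)} (h0 : 0 ∈ S) (ht : X.IsTriangle x y z) :
    h.flagGraph.comp S ⟨(y, x, z), ht.swap_left⟩ = h.flagGraph.comp S ⟨(x, y, z), ht⟩ :=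
  h.flagGraph.comp_adj h0 (⟨(x, y, z), ht⟩ : X.Flag)

theorem comp_swap_right {S : Set (Fin 3)} (h1 : 1 ∈ S) (ht : X.IsTriangle x y z) :
    h.flagGraph.comp S ⟨(x, z, y), ht.swap_right⟩ = h.flagGraph.comp S ⟨(x, y, z), ht⟩ :=
  h.flagGraph.comp_adj h1 (⟨(x, y, z), ht⟩ : X.Flag)

theorem comp_opp {S : Set (Fin 3)} (h2 : 2 ∈ S) {w : V} (ht : X.IsTriangle x y z)
    (ht' : X.IsTriangle x y w) :
    h.flagGraph.comp S ⟨(x, y, w), ht'⟩ = h.flagGraph.comp S ⟨(x, y, z), ht⟩ := by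
  rcases h.eq_or_eq_opp (t := ⟨(x, y, z), ht⟩) (t' := ⟨(x, y, w), ht'⟩) rfl rfl with e | e
  · rw [e]
  · rw [e]
    exact h.flagGraph.comp_adj h2 (⟨(x, y, z), ht⟩ : X.Flag)

/-- The components of the graph of flags with one color left out are the stars of the vertices of
the barycentric subdivision, which are the faces of the complex. -/
theorem flagGraph_comp_eq {S : Set (Fin 3)} (hS : S ≠ univ) {x' y' z' : V}
    (ht : X.IsTriangle x y z) (ht' : X.IsTriangle x' y' z') (h0 : 0 ∉ S → x' = x)
    (h1 : 1 ∉ S → (x' = x ∨ x' = y) ∧ (y' = x ∨ y' = y))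
    (h2 : 2 ∉ S → (x' = x ∨ x' = y ∨ x' = z) ∧ (y' = x ∨ y' = y ∨ y' = z) ∧
      (z' = x ∨ z' = y ∨ z' = z)) :
    h.flagGraph.comp S ⟨(x', y', z'), ht'⟩ = h.flagGraph.comp S ⟨(x, y, z), ht⟩ := by
  have n1 := ht.1
  have n2 := ht.2.1
  have n3 := ht.2.2.1
  have n1' := ht'.1
  have n2' := ht'.2.1
  have n3' := ht'.2.2.1
  by_cases s2 : 2 ∈ S
  · by_cases s1 : 1 ∈ S
    · have s0 : 0 ∉ S := by
        intro s0
        refine hS (eq_univ_of_forall fun k => ?_)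
        fin_cases k <;> assumption
      obtain rfl := h0 s0
      refine h.link x' (fun a b => ∀ hab : X.IsTriangle x' a b,
        h.flagGraph.comp S ⟨(x', a, b), hab⟩ = h.flagGraph.comp S ⟨(x', y, z), ht⟩) ?_ ?_
        y z y' z' ht ht' (fun _ => rfl) ht'
      · intro a b hF hab
        rw [← hF hab.swap_right, comp_swap_right h s1]
      · intro a b b' hab hab' hF _
        rw [← hF hab, comp_opp h s2]
    · obtain ⟨e1, e2⟩ := h1 s1
      rcases e1 with rfl | rfl
      · obtain rfl := e2.resolve_left n1'.symm
        exact comp_opp h s2 ht ht'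
      · obtain rfl := e2.resolve_right n1'.symm
        have s0 : 0 ∈ S := by
          by_contra s0
          exact n1' (h0 s0)
        rw [← comp_swap_left h s0 ht]
        exact comp_opp h s2 ht.swap_left ht'
  · obtain ⟨e1, e2, e3⟩ := h2 s2
    have s0 : x' ≠ x → 0 ∈ S := fun hx => by
      by_contra s0
      exact hx (h0 s0)
    have s1 : (x' ≠ x ∧ x' ≠ y) ∨ (y' ≠ x ∧ y' ≠ y) → 1 ∈ S := fun hx => by
      by_contra s1
      obtain ⟨f1, f2⟩ := h1 s1
      exact hx.elim (fun g => f1.elim g.1 g.2) fun g => f2.elim g.1 g.2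
    rcases e1 with rfl | rfl | rfl
    · rcases e2 with rfl | rfl | rfl
      · exact absurd rfl n1'
      · obtain rfl : z' = z := (e3.resolve_left n2'.symm).resolve_left n3'.symm
        rfl
      · obtain rfl : z' = y := (e3.resolve_left n2'.symm).resolve_right n3'.symm
        exact comp_swap_right h (s1 (Or.inr ⟨n2.symm, n3.symm⟩)) ht
    · rcases e2 with rfl | rfl | rfl
      · obtain rfl : z' = z := (e3.resolve_left n3'.symm).resolve_left n2'.symm
        exact comp_swap_left h (s0 n1') ht
      · exact absurd rfl n1'
      · obtain rfl : z' = x := e3.resolve_right fun e => e.elim n2'.symm n3'.symm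
        rw [← comp_swap_left h (s0 n1.symm) ht]
        exact comp_swap_right h (s1 (Or.inr ⟨n2.symm, n3.symm⟩)) ht.swap_left
    · have t0 := s0 n2.symm
      have t1 := s1 (Or.inl ⟨n2.symm, n3.symm⟩)
      rcases e2 with rfl | rfl | rfl
      · obtain rfl : z' = y := (e3.resolve_left n3'.symm).resolve_right n2'.symm
        rw [← comp_swap_right h t1 ht]
        exact comp_swap_left h t0 ht.swap_right
      · obtain rfl : z' = x := e3.resolve_right fun e => e.elim n3'.symm n2'.symm
        rw [← comp_swap_left h t0 ht, ← comp_swap_right h t1 ht.swap_left]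
        exact comp_swap_left h t0 ht.swap_left.swap_right
      · exact absurd rfl n1'

theorem flagGraph_comp_eq_iff (k : Fin 3) (t t' : X.Flag) :
    h.flagGraph.comp {k}ᶜ t' = h.flagGraph.comp {k}ᶜ t ↔ flagFace k t' = flagFace k t := by
  constructor
  · refine ColoredGraph.eq_of_comp_eq (Γ := h.flagGraph) (flagFace k) fun c hc t => ?_
    have hc : c ≠ k := hc
    match k, c with
    | 0, 0 => exact absurd rfl hc
    | 0, 1 => rfl
    | 0, 2 => rfl
    | 1, 0 => exact Finset.pair_comm _ _
    | 1, 1 => exact absurd rfl hc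
    | 1, 2 => rfl
    | 2, 0 => exact Finset.insert_comm _ _ _
    | 2, 1 => exact congrArg (insert _) (Finset.pair_comm _ _)
    | 2, 2 => exact absurd rfl hc
  · obtain ⟨⟨x, y, z⟩, ht⟩ := t
    obtain ⟨⟨x', y', z'⟩, ht'⟩ := t'
    intro hf
    have hmem : ∀ v ∈ flagFace k (⟨(x', y', z'), ht'⟩ : X.Flag),
        v ∈ flagFace k (⟨(x, y, z), ht⟩ : X.Flag) := fun v hv => hf ▸ hv
    refine flagGraph_comp_eq h ?_ ht ht' ?_ ?_ ?_
    · exact fun e => (e ▸ mem_univ k : k ∈ ({k}ᶜ : Set (Fin 3))) rfl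
    · intro hk
      obtain rfl : 0 = k := by simpa using hk
      simpa [flagFace] using hmem
    · intro hk
      obtain rfl : 1 = k := by simpa using hk
      simpa [flagFace] using hmem
    · intro hk
      obtain rfl : 2 = k := by simpa using hk
      simpa [flagFace] using hmem

variable (X) in
/-- The number of faces with `n` vertices. -/
noncomputable def faceCount (n : ℕ) : ℕ := {s | s ∈ X.faces ∧ s.card = n}.ncard

theorem card_comp_flagGraph (k : Fin 3) :
    Nat.card (h.flagGraph.Comp {k}ᶜ) = X.faceCount (k + 1) := by
  rw [faceCount, ← Nat.card_coe_set_eq]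
  refine Nat.card_congr (Equiv.ofBijective (Quotient.lift
    (fun t : X.Flag => (⟨flagFace k t, flagFace_mem k t⟩ :
      {s | s ∈ X.faces ∧ s.card = (k : ℕ) + 1})) fun t t' htt =>
      Subtype.ext ((flagGraph_comp_eq_iff h k t' t).1 (Quotient.sound htt))) ⟨?_, ?_⟩)
  · intro a b
    induction a using Quotient.inductionOn with
    | h a =>
      induction b using Quotient.inductionOn with
      | h b => exact fun e => (flagGraph_comp_eq_iff h k b a).2 (congrArg Subtype.val e)
  · rintro ⟨s, hs, hc⟩
    obtain ⟨t, rfl⟩ := exists_flagFace_eq h k hs hc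
    exact ⟨h.flagGraph.comp _ t, rfl⟩

variable (X) in
/-- Every triangle has six orders of its vertices. -/
theorem card_flag : Nat.card X.Flag = 6 * X.faceCount 3 := by
  classical
  have := Fintype.ofFinite V
  have e1 : Nat.card X.Flag =
      (Finset.univ.filter fun t : V × V × V => X.IsTriangle t.1 t.2.1 t.2.2).card := by
    rw [Nat.card_eq_fintype_card, Fintype.card_subtype]
  have e2 : X.faceCount 3 =
      (Finset.univ.filter fun s : Finset V => s ∈ X.faces ∧ s.card = 3).card := by
    rw [faceCount, ← Set.ncard_coe_finset]
    congr 1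
    ext s
    simp
  rw [e1, e2, mul_comm, ← smul_eq_mul, ← Finset.sum_const,
    Finset.card_eq_sum_card_fiberwise (f := fun t : V × V × V => ({t.1, t.2.1, t.2.2} : Finset V))
      (t := Finset.univ.filter fun s : Finset V => s ∈ X.faces ∧ s.card = 3)]
  · refine Finset.sum_congr rfl fun s hs => ?_
    obtain ⟨hs, hc⟩ := (Finset.mem_filter.1 hs).2
    obtain ⟨x, y, z, h1, h2, h3, rfl⟩ := Finset.card_eq_three.1 hc
    have hfib : (Finset.univ.filter fun t : V × V × V => X.IsTriangle t.1 t.2.1 t.2.2).filter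
        (fun t => ({t.1, t.2.1, t.2.2} : Finset V) = {x, y, z}) =
        {(x, y, z), (x, z, y), (y, x, z), (y, z, x), (z, x, y), (z, y, x)} := by
      have ht : X.IsTriangle x y z := ⟨h1, h2, h3, hs⟩
      ext ⟨a, b, c⟩
      simp only [Finset.mem_filter, Finset.mem_univ, true_and, Finset.mem_insert,
        Finset.mem_singleton, Prod.mk.injEq]
      constructor
      · rintro ⟨⟨n1, n2, n3, -⟩, e⟩
        have ha : a ∈ ({x, y, z} : Finset V) := by rw [← e]; simp
        have hb : b ∈ ({x, y, z} : Finset V) := by rw [← e]; simp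
        have hc : c ∈ ({x, y, z} : Finset V) := by rw [← e]; simp
        simp only [Finset.mem_insert, Finset.mem_singleton] at ha hb hc
        rcases ha with rfl | rfl | rfl <;> rcases hb with rfl | rfl | rfl <;>
          rcases hc with rfl | rfl | rfl <;> simp_all
      · have key : ∀ a b c, X.IsTriangle a b c → ({a, b, c} : Finset V) = {x, y, z} →
            X.IsTriangle a b c ∧ ({a, b, c} : Finset V) = {x, y, z} := fun _ _ _ h h' => ⟨h, h'⟩
        rintro (⟨rfl, rfl, rfl⟩ | ⟨rfl, rfl, rfl⟩ | ⟨rfl, rfl, rfl⟩ | ⟨rfl, rfl, rfl⟩ |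
          ⟨rfl, rfl, rfl⟩ | ⟨rfl, rfl, rfl⟩)
        · exact ⟨ht, rfl⟩
        · exact ⟨ht.swap_right, by ext; simp; tauto⟩
        · exact ⟨ht.swap_left, by ext; simp; tauto⟩
        · exact ⟨ht.swap_left.swap_right, by ext; simp; tauto⟩
        · exact ⟨ht.swap_right.swap_left, by ext; simp; tauto⟩
        · exact ⟨ht.swap_left.swap_right.swap_left, by ext; simp; tauto⟩
    rw [hfib]
    simp [h1, h2, h3, h1.symm, h2.symm, h3.symm]
  · intro t ht
    have ht : X.IsTriangle t.1 t.2.1 t.2.2 := by simpa using ht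
    simpa using ⟨ht.2.2.2, Finset.card_eq_three.2 ⟨_, _, _, ht.1, ht.2.1, ht.2.2.1, rfl⟩⟩

end

end AbstractSimplicialComplex

namespace AbstractSimplicialComplex

section
variable {V : Type} [DecidableEq V] {X : AbstractSimplicialComplex V}

/-- The function on the vertices with barycentric coordinates `p` in the triangle of the barycentric
subdivision given by a flag. -/
noncomputable def flagPt (t : V × V × V) (p : stdSimplex ℝ (Fin 3)) (v : V) : ℝ :=
  (if v = t.1 then p.1 0 + p.1 1 / 2 + p.1 2 / 3 else 0) +
    (if v = t.2.1 then p.1 1 / 2 + p.1 2 / 3 else 0) + (if v = t.2.2 then p.1 2 / 3 else 0)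

theorem IsTriangle.flagPt {x y z : V} (h : X.IsTriangle x y z) (p : stdSimplex ℝ (Fin 3)) :
    flagPt (x, y, z) p x = p.1 0 + p.1 1 / 2 + p.1 2 / 3 ∧
    flagPt (x, y, z) p y = p.1 1 / 2 + p.1 2 / 3 ∧ flagPt (x, y, z) p z = p.1 2 / 3 ∧
    ∀ v, v ≠ x → v ≠ y → v ≠ z → flagPt (x, y, z) p v = 0 := by
  refine ⟨?_, ?_, ?_, fun v h1 h2 h3 => ?_⟩
  · simp [AbstractSimplicialComplex.flagPt, h.1, h.2.1]
  · simp [AbstractSimplicialComplex.flagPt, h.1.symm, h.2.2.1]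
  · simp [AbstractSimplicialComplex.flagPt, h.2.1.symm, h.2.2.1.symm]
  · simp [AbstractSimplicialComplex.flagPt, h1, h2, h3]

/-- The coordinates are ordered like the vertices of the flag. -/
theorem IsTriangle.flagPt_le {x y z : V} (h : X.IsTriangle x y z) (p : stdSimplex ℝ (Fin 3))
    (v : V) : 0 ≤ AbstractSimplicialComplex.flagPt (x, y, z) p v ∧
      AbstractSimplicialComplex.flagPt (x, y, z) p v ≤ p.1 0 + p.1 1 / 2 + p.1 2 / 3 ∧
      (v ≠ x → AbstractSimplicialComplex.flagPt (x, y, z) p v ≤ p.1 1 / 2 + p.1 2 / 3) ∧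
      (v ≠ x → v ≠ y → AbstractSimplicialComplex.flagPt (x, y, z) p v ≤ p.1 2 / 3) := by
  obtain ⟨e1, e2, e3, e4⟩ := h.flagPt p
  have h0 := p.2.1 0
  have h1 := p.2.1 1
  have h2 := p.2.1 2
  by_cases hx : v = x
  · subst hx
    rw [e1]
    exact ⟨by linarith, le_rfl, fun hn => absurd rfl hn, fun hn => absurd rfl hn⟩
  by_cases hy : v = y
  · subst hy
    rw [e2]
    exact ⟨by linarith, by linarith, fun _ => le_rfl, fun _ hn => absurd rfl hn⟩
  by_cases hz : v = z
  · subst hz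
    rw [e3]
    exact ⟨by linarith, by linarith, fun _ => by linarith, fun _ _ => le_rfl⟩
  rw [e4 v hx hy hz]
  exact ⟨le_rfl, by linarith, fun _ => by linarith, fun _ _ => by linarith⟩

theorem sum_coords' (p : stdSimplex ℝ (Fin 3)) : p.1 0 + p.1 1 + p.1 2 = 1 := by
  have := p.2.2
  rwa [Fin.sum_univ_three] at this

/-- The largest coordinate of the point and the sum of its two largest coordinates determine its
barycentric coordinates in the subdivision. -/
theorem coords_eq_of_flagPt_eq {x y z x' y' z' : V} (ht : X.IsTriangle x y z)
    (ht' : X.IsTriangle x' y' z') {p q : stdSimplex ℝ (Fin 3)}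
    (h : flagPt (x, y, z) p = flagPt (x', y', z') q) : p = q := by
  have key : ∀ {x y z x' y' z' : V} (_ : X.IsTriangle x y z) (_ : X.IsTriangle x' y' z')
      {p q : stdSimplex ℝ (Fin 3)}, flagPt (x, y, z) p = flagPt (x', y', z') q →
      q.1 0 + q.1 1 / 2 + q.1 2 / 3 ≤ p.1 0 + p.1 1 / 2 + p.1 2 / 3 ∧
      (q.1 0 + q.1 1 / 2 + q.1 2 / 3) + (q.1 1 / 2 + q.1 2 / 3) ≤
        (p.1 0 + p.1 1 / 2 + p.1 2 / 3) + (p.1 1 / 2 + p.1 2 / 3) := by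
    intro x y z x' y' z' ht ht' p q h
    obtain ⟨e1, e2, -, -⟩ := ht'.flagPt q
    rw [← h] at e1 e2
    have h1 := ht.flagPt_le p x'
    have h2 := ht.flagPt_le p y'
    refine ⟨e1.symm.trans_le h1.2.1, ?_⟩
    rw [← e1, ← e2]
    by_cases hx : x' = x
    · have := h2.2.2.1 fun hy => ht'.1 (hx.trans hy.symm)
      linarith [h1.2.1]
    · linarith [h1.2.2.1 hx, h2.2.1]
  obtain ⟨h1, h2⟩ := key ht ht' h
  obtain ⟨h3, h4⟩ := key ht' ht h.symm
  have hp := sum_coords' p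
  have hq := sum_coords' q
  exact ColoredGraph.simplex_ext (i := 1) (j := 2) (by decide) (by linarith) (by linarith)

/-- Two flags with a common point agree in the vertices that are singled out by its coordinates. -/
theorem mem_of_flagPt_eq {x y z x' y' z' : V} (ht : X.IsTriangle x y z)
    (ht' : X.IsTriangle x' y' z') {p : stdSimplex ℝ (Fin 3)}
    (h : flagPt (x, y, z) p = flagPt (x', y', z') p) :
    (p.1 0 ≠ 0 → x' = x) ∧ (p.1 1 ≠ 0 → (x' = x ∨ x' = y) ∧ (y' = x ∨ y' = y)) ∧
    (p.1 2 ≠ 0 → (x' = x ∨ x' = y ∨ x' = z) ∧ (y' = x ∨ y' = y ∨ y' = z) ∧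
      (z' = x ∨ z' = y ∨ z' = z)) := by
  obtain ⟨e1, e2, e3, -⟩ := ht'.flagPt p
  rw [← h] at e1 e2 e3
  have h0 := p.2.1 0
  have h1 := p.2.1 1
  have h2 := p.2.1 2
  refine ⟨fun hp => ?_, fun hp => ?_, fun hp => ?_⟩
  · have := h0.lt_of_ne' hp
    by_contra hx
    linarith [(ht.flagPt_le p x').2.2.1 hx]
  · have := h1.lt_of_ne' hp
    have key : ∀ v, p.1 1 / 2 + p.1 2 / 3 ≤ flagPt (x, y, z) p v → v = x ∨ v = y := by
      intro v hv
      by_contra! hn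
      linarith [(ht.flagPt_le p v).2.2.2 hn.1 hn.2]
    exact ⟨key _ (by linarith), key _ (by linarith)⟩
  · have := h2.lt_of_ne' hp
    have key : ∀ v, p.1 2 / 3 ≤ flagPt (x, y, z) p v → v = x ∨ v = y ∨ v = z := by
      intro v hv
      by_contra! hn
      linarith [(ht.flagPt p).2.2.2 v hn.1 hn.2.1 hn.2.2]
    exact ⟨key _ (by linarith), key _ (by linarith), key _ (by linarith)⟩

variable [Fintype V]

theorem sum_flagPt (t : V × V × V) (p : stdSimplex ℝ (Fin 3)) : ∑ v, flagPt t p v = 1 := by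
  have := sum_coords' p
  simp only [flagPt, Finset.sum_add_distrib, Finset.sum_ite_eq', Finset.mem_univ, if_true]
  linarith

/-- The point of the realization with barycentric coordinates `p` in the triangle of the barycentric
subdivision given by a flag. -/
noncomputable def flagPoint (t : X.Flag) (p : stdSimplex ℝ (Fin 3)) : X.Realization :=
  ⟨flagPt t.1 p, fun v => (t.2.flagPt_le p v).1, sum_flagPt t.1 p,
    {t.1.1, t.1.2.1, t.1.2.2}, t.2.2.2.2, fun v hv => by
      simp only [Finset.mem_insert, Finset.mem_singleton, not_or] at hv
      exact (t.2.flagPt p).2.2.2 v hv.1 hv.2.1 hv.2.2⟩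

instance : T2Space X.Realization := inferInstanceAs (T2Space (Subtype _))

theorem continuous_flagPoint (t : X.Flag) : Continuous (flagPoint t) := by
  refine Continuous.subtype_mk (continuous_pi fun v => ?_) _
  have h := ColoredGraph.continuous_coord
  unfold flagPt
  refine (Continuous.add ?_ ?_).add ?_ <;> split_ifs
  · exact ((h 0).add ((h 1).div_const 2)).add ((h 2).div_const 3)
  · exact continuous_const
  · exact ((h 1).div_const 2).add ((h 2).div_const 3)
  · exact continuous_const
  · exact (h 2).div_const 3
  · exact continuous_const

/-- A flag that contains a point is found by ordering the vertices by the coordinates of the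
point. -/
theorem exists_flagPoint_eq (h : X.IsCombinatorialSurface) (x : X.Realization) :
    ∃ t p, flagPoint t p = x := by
  obtain ⟨F, hF0, hF1, s, hs, hsupp⟩ := x
  obtain ⟨a, b, c, ht, hsub⟩ := h.pure s hs
  have hz : ∀ v, v ≠ a → v ≠ b → v ≠ c → F v = 0 := fun v h1 h2 h3 =>
    hsupp v fun hv => by simpa [h1, h2, h3] using hsub hv
  obtain ⟨x, y, z, ht, hz, hxy, hyz⟩ : ∃ x y z, X.IsTriangle x y z ∧
      (∀ v, v ≠ x → v ≠ y → v ≠ z → F v = 0) ∧ F y ≤ F x ∧ F z ≤ F y := by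
    rcases le_total (F a) (F b) with h1 | h1 <;> rcases le_total (F b) (F c) with h2 | h2 <;>
      rcases le_total (F a) (F c) with h3 | h3
    · exact ⟨c, b, a, ht.swap_left.swap_right.swap_left, fun v i j k => hz v k j i, h2, h1⟩
    · exact ⟨c, b, a, ht.swap_left.swap_right.swap_left, fun v i j k => hz v k j i, h2, h1⟩
    · exact ⟨b, c, a, ht.swap_left.swap_right, fun v i j k => hz v k i j, h2, h3⟩
    · exact ⟨b, a, c, ht.swap_left, fun v i j k => hz v j i k, h1, h3⟩
    · exact ⟨c, a, b, ht.swap_right.swap_left, fun v i j k => hz v j k i, h3, h1⟩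
    · exact ⟨a, c, b, ht.swap_right, fun v i j k => hz v i k j, h3, h2⟩
    · exact ⟨a, b, c, ht, hz, h1, h2⟩
    · exact ⟨a, b, c, ht, hz, h1, h2⟩
  have hsum : F x + F y + F z = 1 := by
    rw [← hF1, ← Finset.sum_subset (Finset.subset_univ {x, y, z})]
    · rw [Finset.sum_insert (by simp [ht.1, ht.2.1]), Finset.sum_pair ht.2.2.1, add_assoc]
    · intro v _ hv
      simp only [Finset.mem_insert, Finset.mem_singleton, not_or] at hv
      exact hz v hv.1 hv.2.1 hv.2.2
  -- the inverse of the linear map in `flagPt`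
  let p : stdSimplex ℝ (Fin 3) := ⟨![F x - F y, 2 * (F y - F z), 3 * F z], fun k => by
    fin_cases k
    · exact sub_nonneg.2 hxy
    · exact mul_nonneg zero_le_two (sub_nonneg.2 hyz)
    · exact mul_nonneg (by norm_num) (hF0 z), by
    rw [Fin.sum_univ_three]
    change F x - F y + 2 * (F y - F z) + 3 * F z = 1
    linarith⟩
  have hp0 : p.1 0 = F x - F y := rfl
  have hp1 : p.1 1 = 2 * (F y - F z) := rfl
  have hp2 : p.1 2 = 3 * F z := rfl
  refine ⟨⟨(x, y, z), ht⟩, p, Subtype.ext (funext fun v => ?_)⟩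
  obtain ⟨e1, e2, e3, e4⟩ := ht.flagPt p
  change flagPt (x, y, z) p v = F v
  by_cases hvx : v = x
  · rw [hvx, e1]
    linarith
  by_cases hvy : v = y
  · rw [hvy, e2]
    linarith
  by_cases hvz : v = z
  · rw [hvz, e3]
    linarith
  rw [e4 v hvx hvy hvz, hz v hvx hvy hvz]

theorem flagGraph_represents (h : X.IsCombinatorialSurface) :
    h.flagGraph.Represents X.Realization := by
  refine ColoredGraph.nonempty_carrier_homeomorph (Γ := h.flagGraph) (fun t p => flagPoint t p)
    continuous_flagPoint (exists_flagPoint_eq h) ?_ ?_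
  · intro t c p hp
    refine Subtype.ext (funext fun v => ?_)
    match c with
    | 0 =>
      change flagPt (t.1.2.1, t.1.1, t.1.2.2) p v = flagPt t.1 p v
      simp only [flagPt, hp, zero_add]
      rw [add_comm (ite _ _ _) (ite _ _ _)]
    | 1 =>
      change flagPt (t.1.1, t.1.2.2, t.1.2.1) p v = flagPt t.1 p v
      simp only [flagPt, hp, zero_div, zero_add, add_zero]
      rw [add_right_comm]
    | 2 =>
      change flagPt (t.1.1, t.1.2.1, _) p v = flagPt t.1 p v
      simp [flagPt, hp]
  · rintro ⟨⟨x', y', z'⟩, ht'⟩ ⟨⟨x, y, z⟩, ht⟩ q p e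
    have e : flagPt (x, y, z) p = flagPt (x', y', z') q := (congrArg Subtype.val e).symm
    obtain rfl := coords_eq_of_flagPt_eq ht ht' e
    obtain ⟨h0, h1, h2⟩ := mem_of_flagPt_eq ht ht' e
    refine ⟨rfl, flagGraph_comp_eq h ?_ ht ht' h0 h1 h2⟩
    intro hu
    have key : ∀ k, p.1 k = 0 := fun k => (hu ▸ mem_univ k : k ∈ ColoredGraph.zeros p)
    have := sum_coords' p
    rw [key, key, key] at this
    norm_num at this

/-- The Euler characteristic of a triangulated surface. -/
theorem euler_realization (h : X.IsCombinatorialSurface) : euler X.Realization =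
    X.faceCount 1 + X.faceCount 2 - 2 * X.faceCount 3 := by
  obtain ⟨e⟩ := flagGraph_represents h
  have h1 := ColoredGraph.euler_carrier h.flagGraph
  have h2 : Nat.card h.flagGraph.V = 6 * X.faceCount 3 := card_flag X
  rw [euler_congr e, Fin.sum_univ_three, card_comp_flagGraph, card_comp_flagGraph,
    card_comp_flagGraph, h2] at h1
  have : (euler X.Realization : ℚ) =
      ((X.faceCount 1 + X.faceCount 2 - 2 * X.faceCount 3 : ℤ) : ℚ) := by
    rw [h1]
    push_cast
    norm_num
    ring
  exact_mod_cast this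

end

end AbstractSimplicialComplex

namespace AbstractSimplicialComplex

section
variable {V : Type} [DecidableEq V] {X : AbstractSimplicialComplex V}

/-- The faces at a vertex, by the cycle of the vertices of its link. -/
theorem IsClosedSurface.exists_cycle (hX : X.IsClosedSurface) (x : V) :
    ∃ m : ℕ, 3 ≤ m ∧ ∃ f : ZMod m → V, Function.Injective f ∧
      (∀ y z, X.IsTriangle x y z ↔
        ∃ i, (y = f i ∧ z = f (i + 1)) ∨ (y = f (i + 1) ∧ z = f i)) ∧
      ∀ s ∈ X.faces, x ∈ s → ∃ i, s ⊆ {x, f i, f (i + 1)} := by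
  obtain ⟨m, hm, f, hf, hL⟩ := hX x
  have : Fact (1 < m) := ⟨by omega⟩
  have hne : ∀ i, f i ≠ f (i + 1) := fun i e => by simpa using hf e
  refine ⟨m, hm, f, hf, fun y z => ⟨?_, ?_⟩, fun s hs hx => ?_⟩
  · rintro ⟨h1, h2, h3, h4⟩
    have hmem : ({y, z} : Finset V) ∈ X.linkFaces x := ⟨⟨y, by simp⟩, by simp [h1, h2], h4⟩
    rcases (hL _).1 hmem with ⟨i, e⟩ | ⟨i, e⟩
    · have e1 : y = f i := by simpa using e.subset (Finset.mem_insert_self y _)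
      have e2 : z = f i := by simpa using e.subset (by simp : z ∈ ({y, z} : Finset V))
      exact absurd (e1.trans e2.symm) h3
    · have e1 : y = f i ∨ y = f (i + 1) := by simpa using e.subset (Finset.mem_insert_self y _)
      have e2 : z = f i ∨ z = f (i + 1) := by
        simpa using e.subset (by simp : z ∈ ({y, z} : Finset V))
      refine ⟨i, ?_⟩
      rcases e1 with rfl | rfl <;> rcases e2 with rfl | rfl
      · exact absurd rfl h3
      · exact Or.inl ⟨rfl, rfl⟩
      · exact Or.inr ⟨rfl, rfl⟩
      · exact absurd rfl h3
  · rintro ⟨i, hi⟩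
    obtain ⟨-, h2, h3⟩ := (hL {f i, f (i + 1)}).2 (Or.inr ⟨i, rfl⟩)
    simp only [Finset.mem_insert, Finset.mem_singleton, not_or] at h2
    have ht : X.IsTriangle x (f i) (f (i + 1)) := ⟨h2.1, h2.2, hne i, h3⟩
    rcases hi with ⟨rfl, rfl⟩ | ⟨rfl, rfl⟩
    · exact ht
    · exact ht.swap_right
  · by_cases hn : (s.erase x).Nonempty
    · have hmem : s.erase x ∈ X.linkFaces x :=
        ⟨hn, by simp, by rwa [Finset.insert_erase hx]⟩
      rw [← Finset.insert_erase hx]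
      rcases (hL _).1 hmem with ⟨i, e⟩ | ⟨i, e⟩
      · exact ⟨i, by rw [e]; exact Finset.insert_subset_insert x (by simp)⟩
      · exact ⟨i, by rw [e]⟩
    · rw [Finset.not_nonempty_iff_eq_empty] at hn
      refine ⟨0, ?_⟩
      rw [← Finset.insert_erase hx, hn]
      simp

/-- The triangles around a vertex, with one of them left out, are still connected to each other
across edges. -/
theorem IsClosedSurface.link_avoid (hX : X.IsClosedSurface) (σ : Finset V) (x : V)
    (F : V → V → Prop) (hsymm : ∀ y z, F y z → F z y)
    (hF : ∀ y z z', X.IsTriangle x y z → X.IsTriangle x y z' → ({x, y, z} : Finset V) ≠ σ →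
      ({x, y, z'} : Finset V) ≠ σ → F y z → F y z')
    {y z y' z' : V} (h : X.IsTriangle x y z) (h' : X.IsTriangle x y' z')
    (hσ : ({x, y, z} : Finset V) ≠ σ) (hσ' : ({x, y', z'} : Finset V) ≠ σ) (hyz : F y z) :
    F y' z' := by
  obtain ⟨m, hm, f, hf, hL, -⟩ := hX.exists_cycle x
  have : Fact (1 < m) := ⟨by omega⟩
  have : NeZero m := ⟨by omega⟩
  -- the triangles at `x`, in cyclic order; they are distinct because of `3 ≤ m`
  let T : ZMod m → Finset V := fun i => {x, f i, f (i + 1)}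
  have ht : ∀ i, X.IsTriangle x (f i) (f (i + 1)) := fun i => (hL _ _).2 ⟨i, Or.inl ⟨rfl, rfl⟩⟩
  have hT : ∀ i j, T i = T j → i = j := by
    intro i j e
    have e1 : f i = x ∨ f i = f j ∨ f i = f (j + 1) := by
      simpa [T] using e.subset (by simp [T] : f i ∈ T i)
    have e2 : f (i + 1) = x ∨ f (i + 1) = f j ∨ f (i + 1) = f (j + 1) := by
      simpa [T] using e.subset (by simp [T] : f (i + 1) ∈ T i)
    rcases (e1.resolve_left (ht i).1.symm) with e1 | e1
    · exact hf e1
    · rcases (e2.resolve_left (ht i).2.1.symm) with e2 | e2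
      · have e1 := hf e1
        have e2 := hf e2
        exfalso
        have h2 : ((2 : ℕ) : ZMod m) = 0 := by
          rw [e1] at e2
          push_cast
          linear_combination e2
        have := Nat.le_of_dvd (by norm_num) ((ZMod.natCast_eq_zero_iff 2 m).1 h2)
        omega
      · exact add_right_cancel (hf e2)
  -- at most one of the triangles is left out, so that all others are met by going on from `k + 1`
  obtain ⟨k, hk⟩ : ∃ k, ∀ i, i ≠ k → T i ≠ σ := by
    by_cases hk : ∃ k, T k = σ
    · obtain ⟨k, rfl⟩ := hk
      exact ⟨k, fun i hi e => hi (hT i k e)⟩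
    · exact ⟨0, fun i _ e => hk ⟨i, e⟩⟩
  let G : ZMod m → Prop := fun i => F (f i) (f (i + 1))
  have step : ∀ i, T i ≠ σ → T (i + 1) ≠ σ → (G i ↔ G (i + 1)) := by
    intro i h1 h2
    have h1' : ({x, f (i + 1), f i} : Finset V) ≠ σ := by rwa [Finset.pair_comm]
    exact ⟨fun g => hF _ _ _ (ht i).swap_right (ht (i + 1)) h1' h2 (hsymm _ _ g),
      fun g => hsymm _ _ (hF _ _ _ (ht (i + 1)) (ht i).swap_right h2 h1' g)⟩
  have walk : ∀ n : ℕ, n + 1 < m → (G (k + 1) ↔ G (k + 1 + n)) := by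
    intro n
    induction n with
    | zero => simp
    | succ n ih =>
      intro hn
      have hnk : ∀ r : ℕ, r + 1 < m → k + 1 + (r : ZMod m) ≠ k := by
        intro r hr e
        have h0 : ((r + 1 : ℕ) : ZMod m) = 0 := by
          push_cast
          linear_combination e
        have := Nat.le_of_dvd (by omega) ((ZMod.natCast_eq_zero_iff _ m).1 h0)
        omega
      rw [ih (by omega), step _ (hk _ (hnk n (by omega))) ?_]
      · push_cast
        rw [add_assoc]
      · have := hk _ (hnk (n + 1) hn)
        push_cast at this
        rwa [← add_assoc] at this
  have all : ∀ i, T i ≠ σ → (G i ↔ G (k + 1)) := by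
    intro i hi
    by_cases hik : i = k
    · subst hik
      exact step i hi (hk _ (by simp))
    · have hval : ((i - k - 1).val : ZMod m) = i - k - 1 := ZMod.natCast_zmod_val _
      have hlt : (i - k - 1).val + 1 < m := by
        refine lt_of_le_of_ne (ZMod.val_lt _) fun e => hik ?_
        have h0 : (((i - k - 1).val + 1 : ℕ) : ZMod m) = 0 := by rw [e, ZMod.natCast_self]
        push_cast at h0
        rw [hval] at h0
        linear_combination h0
      rw [walk _ hlt, hval]
      ring_nf
  have key : ∀ y z, X.IsTriangle x y z → ({x, y, z} : Finset V) ≠ σ → (F y z ↔ G (k + 1)) := by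
    intro y z h hσ
    obtain ⟨i, ⟨rfl, rfl⟩ | ⟨rfl, rfl⟩⟩ := (hL y z).1 h
    · exact all i hσ
    · rw [Finset.pair_comm] at hσ
      rw [← all i hσ]
      exact ⟨hsymm _ _, hsymm _ _⟩
  exact (key _ _ h' hσ').2 ((key _ _ h hσ).1 hyz)

/-- The polygonal circles in the links yield the properties of a combinatorial surface. -/
theorem IsClosedSurface.isCombinatorialSurface (hX : X.IsClosedSurface) :
    X.IsCombinatorialSurface where
  pure s hs := by
    obtain ⟨x, hx⟩ := (X.isRelLowerSet_faces hs).1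
    obtain ⟨m, hm, f, hf, hL, hsub⟩ := hX.exists_cycle x
    obtain ⟨i, hi⟩ := hsub s hs hx
    exact ⟨x, f i, f (i + 1), (hL _ _).2 ⟨i, Or.inl ⟨rfl, rfl⟩⟩, hi⟩
  two x y z h := by
    obtain ⟨m, hm, f, hf, hL, -⟩ := hX.exists_cycle x
    -- the two neighbors of a vertex on the circle are distinct, as `m` does not divide two
    have h2 : ∀ i : ZMod m, i + 1 ≠ i - 1 := by
      intro i e
      have h2 : ((2 : ℕ) : ZMod m) = 0 := by
        push_cast
        linear_combination e
      have := Nat.le_of_dvd (by norm_num) ((ZMod.natCast_eq_zero_iff 2 m).1 h2)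
      omega
    obtain ⟨i, rfl⟩ : ∃ i, y = f i := by
      obtain ⟨i, h | h⟩ := (hL y z).1 h
      · exact ⟨i, h.1⟩
      · exact ⟨i + 1, h.1⟩
    have hall : ∀ w, X.IsTriangle x (f i) w ↔ w = f (i + 1) ∨ w = f (i - 1) := by
      intro w
      rw [hL]
      constructor
      · rintro ⟨j, ⟨e1, e2⟩ | ⟨e1, e2⟩⟩
        · obtain rfl := hf e1
          exact Or.inl e2
        · obtain rfl := hf e1
          rw [add_sub_cancel_right]
          exact Or.inr e2
      · rintro (rfl | rfl)
        · exact ⟨i, Or.inl ⟨rfl, rfl⟩⟩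
        · exact ⟨i - 1, Or.inr ⟨by rw [sub_add_cancel], rfl⟩⟩
    have hne : f (i + 1) ≠ f (i - 1) := fun e => h2 i (hf e)
    rcases (hall z).1 h with rfl | rfl
    · exact ⟨f (i - 1), hne.symm, (hall _).2 (Or.inr rfl), fun w hw => (hall w).1 hw⟩
    · exact ⟨f (i + 1), hne, (hall _).2 (Or.inl rfl), fun w hw => ((hall w).1 hw).symm⟩
  link x F hsymm hF y z y' z' h h' :=
    hX.link_avoid ∅ x F hsymm (fun y z z' h h' _ _ => hF y z z' h h') h h'
      (Finset.insert_ne_empty _ _) (Finset.insert_ne_empty _ _)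

/-- Every face other than a given triangle lies in a triangle other than the given one. -/
theorem IsCombinatorialSurface.exists_triangle_ne (h : X.IsCombinatorialSurface)
    {s σ : Finset V} (hs : s ∈ X.faces) (hsσ : s ≠ σ) :
    ∃ x y z, X.IsTriangle x y z ∧ s ⊆ {x, y, z} ∧ ({x, y, z} : Finset V) ≠ σ := by
  obtain ⟨x, y, z, ht, hsub⟩ := h.pure s hs
  by_cases hσ : ({x, y, z} : Finset V) = σ
  · have key : ∀ x y z, X.IsTriangle x y z → ({x, y, z} : Finset V) = σ → s ⊆ {x, y, z} → z ∉ s →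
        ∃ x y z, X.IsTriangle x y z ∧ s ⊆ {x, y, z} ∧ ({x, y, z} : Finset V) ≠ σ := by
      intro x y z ht hσ hsub hz
      obtain ⟨w, hw, htw, -⟩ := h.two x y z ht
      refine ⟨x, y, w, htw, fun v hv => ?_, fun e => ?_⟩
      · have hvz : v ≠ z := fun e => hz (e ▸ hv)
        have := hsub hv
        simp only [Finset.mem_insert, Finset.mem_singleton] at this ⊢
        tauto
      · have hmem : w ∈ ({x, y, z} : Finset V) := by rw [hσ, ← e]; simp
        simp only [Finset.mem_insert, Finset.mem_singleton] at hmem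
        exact hmem.elim htw.2.1.symm fun e => e.elim htw.2.2.1.symm hw
    by_cases hz : z ∈ s
    · by_cases hy : y ∈ s
      · have hx : x ∉ s := fun hx => hsσ (hσ ▸ Finset.Subset.antisymm hsub (by
          simp [Finset.insert_subset_iff, hx, hy, hz]))
        have e : ({y, z, x} : Finset V) = {x, y, z} := by ext v; simp; tauto
        exact key y z x ht.swap_left.swap_right (e.trans hσ) (e ▸ hsub) hx
      · have e : ({x, z, y} : Finset V) = {x, y, z} := by ext v; simp; tauto
        exact key x z y ht.swap_right (e.trans hσ) (e ▸ hsub) hy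
    · exact key x y z ht hσ hsub hz
  · exact ⟨x, y, z, ht, hsub, hσ⟩

end

end AbstractSimplicialComplex

/-! ### The Euler characteristic of a connected sum -/

namespace AbstractSimplicialComplex

section
variable {V W U : Type}

/-- `Z` is the connected sum of `X` and `Y` along the triangles `σ` and `τ`, with the inclusions
`a` and `b` of the two pieces. -/
structure IsGluing (X : AbstractSimplicialComplex V) (Y : AbstractSimplicialComplex W)
    (Z : AbstractSimplicialComplex U) (a : V ↪ U) (b : W ↪ U) (σ : Finset V) (τ : Finset W) :
    Prop where
  memX : σ ∈ X.faces
  cardX : σ.card = 3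
  memY : τ ∈ Y.faces
  cardY : τ.card = 3
  map_eq : σ.map a = τ.map b
  range : Set.range a ∩ Set.range b = ↑(σ.map a)
  faces : ∀ u : Finset U, u ∈ Z.faces ↔
    (∃ s ∈ X.faces, s ≠ σ ∧ u = s.map a) ∨ (∃ t ∈ Y.faces, t ≠ τ ∧ u = t.map b)

variable {X : AbstractSimplicialComplex V} {Y : AbstractSimplicialComplex W}
  {Z : AbstractSimplicialComplex U} {a : V ↪ U} {b : W ↪ U} {σ : Finset V} {τ : Finset W}

namespace IsGluing

theorem symm (h : IsGluing X Y Z a b σ τ) : IsGluing Y X Z b a τ σ where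
  memX := h.memY
  cardX := h.cardY
  memY := h.memX
  cardY := h.cardX
  map_eq := h.map_eq.symm
  range := by rw [inter_comm, h.range, h.map_eq]
  faces u := by rw [h.faces, or_comm]

theorem mem_of_eq (h : IsGluing X Y Z a b σ τ) {x : V} {x' : W} (e : a x = b x') : x ∈ σ := by
  have : a x ∈ Set.range a ∩ Set.range b := ⟨⟨x, rfl⟩, ⟨x', e.symm⟩⟩
  rw [h.range] at this
  simpa using this

theorem exists_eq (h : IsGluing X Y Z a b σ τ) {x : V} (hx : x ∈ σ) : ∃ x' ∈ τ, b x' = a x := by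
  have : a x ∈ σ.map a := Finset.mem_map_of_mem a hx
  rw [h.map_eq] at this
  simpa using this

/-- The faces with `n` vertices of a connected sum. -/
theorem setOf_faces_eq (h : IsGluing X Y Z a b σ τ) (n : ℕ) :
    {u | u ∈ Z.faces ∧ u.card = n} =
      Finset.map a '' ({s | s ∈ X.faces ∧ s.card = n} \ {σ}) ∪
      Finset.map b '' ({t | t ∈ Y.faces ∧ t.card = n} \ {τ}) := by
  ext u
  simp only [mem_ofPred_eq, h.faces, mem_union, mem_image, mem_sdiff, mem_singleton_iff]
  constructor
  · rintro ⟨⟨s, hs, hσ, rfl⟩ | ⟨s, hs, hσ, rfl⟩, hc⟩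
    · exact Or.inl ⟨s, ⟨⟨hs, by simpa using hc⟩, hσ⟩, rfl⟩
    · exact Or.inr ⟨s, ⟨⟨hs, by simpa using hc⟩, hσ⟩, rfl⟩
  · rintro (⟨s, ⟨⟨hs, rfl⟩, hσ⟩, rfl⟩ | ⟨s, ⟨⟨hs, rfl⟩, hσ⟩, rfl⟩)
    · exact ⟨Or.inl ⟨s, hs, hσ, rfl⟩, by simp⟩
    · exact ⟨Or.inr ⟨s, hs, hσ, rfl⟩, by simp⟩

theorem map_subset_of_eq (h : IsGluing X Y Z a b σ τ) {s : Finset V} {t : Finset W}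
    (e : s.map a = t.map b) : s ⊆ σ := by
  intro x hx
  have : a x ∈ t.map b := e ▸ Finset.mem_map_of_mem a hx
  obtain ⟨y, -, hy⟩ := Finset.mem_map.1 this
  exact h.mem_of_eq hy.symm

section
variable [Finite V] [Finite W]

/-- The two triangles that are left out have no image in common with the others. -/
theorem faceCount_three (h : IsGluing X Y Z a b σ τ) :
    Z.faceCount 3 + 2 = X.faceCount 3 + Y.faceCount 3 := by
  have hdisj : Disjoint (Finset.map a '' ({s | s ∈ X.faces ∧ s.card = 3} \ {σ}))
      (Finset.map b '' ({t | t ∈ Y.faces ∧ t.card = 3} \ {τ})) := by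
    rw [Set.disjoint_left]
    rintro _ ⟨s, ⟨⟨hs, hc⟩, hσ⟩, rfl⟩ ⟨t, -, e⟩
    exact hσ (Finset.eq_of_subset_of_card_le (h.map_subset_of_eq e.symm) (by rw [hc, h.cardX]))
  rw [faceCount, h.setOf_faces_eq, ncard_union_eq hdisj (toFinite _) (toFinite _),
    ncard_image_of_injective _ (Finset.map_injective a),
    ncard_image_of_injective _ (Finset.map_injective b), faceCount, faceCount,
    ← ncard_sdiff_singleton_add_one (s := {s | s ∈ X.faces ∧ s.card = 3}) ⟨h.memX, h.cardX⟩,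
    ← ncard_sdiff_singleton_add_one (s := {s | s ∈ Y.faces ∧ s.card = 3}) ⟨h.memY, h.cardY⟩]
  ring

/-- The vertices and the edges of the common boundary triangle are counted twice. -/
theorem faceCount_of_lt (h : IsGluing X Y Z a b σ τ) {n : ℕ} (hn : n ≠ 0) (hn3 : n ≠ 3) :
    Z.faceCount n + Nat.choose 3 n = X.faceCount n + Y.faceCount n := by
  have hX : {s | s ∈ X.faces ∧ s.card = n} \ {σ} = {s | s ∈ X.faces ∧ s.card = n} :=
    sdiff_singleton_eq_self fun hs => hn3 (hs.2.symm.trans h.cardX)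
  have hY : {s | s ∈ Y.faces ∧ s.card = n} \ {τ} = {s | s ∈ Y.faces ∧ s.card = n} :=
    sdiff_singleton_eq_self fun hs => hn3 (hs.2.symm.trans h.cardY)
  have hinter : Finset.map a '' {s | s ∈ X.faces ∧ s.card = n} ∩
      Finset.map b '' {t | t ∈ Y.faces ∧ t.card = n} = Finset.map a '' ↑(σ.powersetCard n) := by
    ext u
    constructor
    · rintro ⟨⟨s, ⟨hs, hc⟩, rfl⟩, t, -, e⟩
      exact ⟨s, Finset.mem_coe.2 (Finset.mem_powersetCard.2 ⟨h.map_subset_of_eq e.symm, hc⟩), rfl⟩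
    · rintro ⟨s, hs, rfl⟩
      obtain ⟨hs, hc⟩ := Finset.mem_powersetCard.1 (Finset.mem_coe.1 hs)
      have hne : s.Nonempty := Finset.card_ne_zero.1 (hc ▸ hn)
      refine ⟨⟨s, ⟨(X.isRelLowerSet_faces h.memX).2 hs hne, hc⟩, rfl⟩, ?_⟩
      have hsub : s.map a ⊆ τ.map b := h.map_eq ▸ Finset.map_subset_map.2 hs
      obtain ⟨t, ht, e⟩ := Finset.subset_map_iff.1 hsub
      have htc : t.card = n := by
        rw [← hc, ← Finset.card_map a, e, Finset.card_map]
      exact ⟨t, ⟨(Y.isRelLowerSet_faces h.memY).2 ht (Finset.card_ne_zero.1 (htc ▸ hn)), htc⟩,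
        e.symm⟩
  rw [faceCount, h.setOf_faces_eq, hX, hY]
  have := ncard_union_add_ncard_inter (Finset.map a '' {s | s ∈ X.faces ∧ s.card = n})
    (Finset.map b '' {t | t ∈ Y.faces ∧ t.card = n})
  rwa [hinter, ncard_image_of_injective _ (Finset.map_injective a),
    ncard_image_of_injective _ (Finset.map_injective b),
    ncard_image_of_injective _ (Finset.map_injective a), ncard_coe_finset,
    Finset.card_powersetCard, h.cardX] at this

end

end IsGluing

variable [DecidableEq V] [DecidableEq W] [DecidableEq U]

theorem map_triple (a : V ↪ U) (x y z : V) :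
    ({x, y, z} : Finset V).map a = {a x, a y, a z} := by
  simp [Finset.map_insert]

/-- A triangle of the part of a connected sum that comes from one of the summands. -/
def IsTriangleOf (X : AbstractSimplicialComplex V) (a : V ↪ U) (σ : Finset V) (p q r : U) : Prop :=
  ∃ x y z, a x = p ∧ a y = q ∧ a z = r ∧ X.IsTriangle x y z ∧ ({x, y, z} : Finset V) ≠ σ

theorem exists_isTriangleOf {s : Finset V} (hs : s ∈ X.faces) (hσ : s ≠ σ) {p q r : U}
    (h1 : p ≠ q) (h2 : p ≠ r) (h3 : q ≠ r) (e : {p, q, r} = s.map a) :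
    IsTriangleOf X a σ p q r := by
  have hp : p ∈ s.map a := e ▸ by simp
  have hq : q ∈ s.map a := e ▸ by simp
  have hr : r ∈ s.map a := e ▸ by simp
  obtain ⟨x, -, rfl⟩ := Finset.mem_map.1 hp
  obtain ⟨y, -, rfl⟩ := Finset.mem_map.1 hq
  obtain ⟨z, -, rfl⟩ := Finset.mem_map.1 hr
  rw [← map_triple] at e
  obtain rfl := Finset.map_injective a e
  exact ⟨x, y, z, rfl, rfl, rfl, ⟨fun e => h1 (e ▸ rfl), fun e => h2 (e ▸ rfl),
    fun e => h3 (e ▸ rfl), hs⟩, hσ⟩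

theorem exists_third {x y : V} (hσ : σ ∈ X.faces) (hc : σ.card = 3) (hx : x ∈ σ) (hy : y ∈ σ)
    (hxy : x ≠ y) : ∃ z, X.IsTriangle x y z ∧ {x, y, z} = σ := by
  have hy' : y ∈ σ.erase x := Finset.mem_erase.2 ⟨hxy.symm, hy⟩
  have hcard : ((σ.erase x).erase y).card = 1 := by
    rw [Finset.card_erase_of_mem hy', Finset.card_erase_of_mem hx, hc]
  obtain ⟨z, hz⟩ := Finset.card_eq_one.1 hcard
  have hzm : z ∈ (σ.erase x).erase y := hz ▸ Finset.mem_singleton_self z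
  have e : ({x, y, z} : Finset V) = σ := by
    rw [← hz, Finset.insert_erase hy', Finset.insert_erase hx]
  refine ⟨z, ⟨hxy, ?_, ?_, e ▸ hσ⟩, e⟩
  · rintro rfl
    simp at hzm
  · rintro rfl
    simp at hzm

theorem eq_of_triple_eq {x y z w : V} (h1 : x ≠ z) (h2 : y ≠ z)
    (e : ({x, y, z} : Finset V) = {x, y, w}) : z = w := by
  have : z ∈ ({x, y, w} : Finset V) := e ▸ by simp
  simp only [Finset.mem_insert, Finset.mem_singleton] at this
  exact (this.resolve_left h1.symm).resolve_left h2.symm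

namespace IsGluing

theorem isTriangle_iff (h : IsGluing X Y Z a b σ τ) (p q r : U) :
    Z.IsTriangle p q r ↔ IsTriangleOf X a σ p q r ∨ IsTriangleOf Y b τ p q r := by
  constructor
  · rintro ⟨h1, h2, h3, h4⟩
    exact ((h.faces _).1 h4).imp
      (fun ⟨s, hs, hsσ, e⟩ => exists_isTriangleOf hs hsσ h1 h2 h3 e)
      (fun ⟨s, hs, hsσ, e⟩ => exists_isTriangleOf hs hsσ h1 h2 h3 e)
  · rintro (⟨x, y, z, rfl, rfl, rfl, ht, hσ⟩ | ⟨x, y, z, rfl, rfl, rfl, ht, hσ⟩)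
    · exact ⟨a.injective.ne ht.1, a.injective.ne ht.2.1, a.injective.ne ht.2.2.1,
        (h.faces _).2 (Or.inl ⟨_, ht.2.2.2, hσ, (map_triple a x y z).symm⟩)⟩
    · exact ⟨b.injective.ne ht.1, b.injective.ne ht.2.1, b.injective.ne ht.2.2.1,
        (h.faces _).2 (Or.inr ⟨_, ht.2.2.2, hσ, (map_triple b x y z).symm⟩)⟩

/-- An edge of a connected sum that comes from a triangle of the first summand is on exactly one
other triangle. This is the other triangle of the summand, unless that one is left out; then it is
a triangle of the other summand. -/
theorem exists_other (h : IsGluing X Y Z a b σ τ) (hX : X.IsClosedSurface)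
    (hY : Y.IsClosedSurface) {p q r : U} (ht : IsTriangleOf X a σ p q r) :
    ∃ r', r' ≠ r ∧ Z.IsTriangle p q r' ∧ ∀ w, Z.IsTriangle p q w → w = r ∨ w = r' := by
  obtain ⟨x, y, z, rfl, rfl, rfl, ht, hσ⟩ := ht
  obtain ⟨w₀, hw₀, htw₀, huniq⟩ := hX.isCombinatorialSurface.two x y z ht
  -- if the other triangle of the first summand is left out, the edge is in the common boundary
  by_cases hw : ({x, y, w₀} : Finset V) = σ
  · have hx : x ∈ σ := hw ▸ by simp
    have hy : y ∈ σ := hw ▸ by simp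
    obtain ⟨x', hx', ex⟩ := h.exists_eq hx
    obtain ⟨y', hy', ey⟩ := h.exists_eq hy
    have hxy' : x' ≠ y' := by
      rintro rfl
      exact ht.1 (a.injective (ex.symm.trans ey))
    obtain ⟨z', ht', hτ⟩ := exists_third h.memY h.cardY hx' hy' hxy'
    obtain ⟨w', hw', htw', huniq'⟩ := hY.isCombinatorialSurface.two x' y' z' ht'
    have hτ' : ({x', y', w'} : Finset W) ≠ τ := fun e =>
      hw' (eq_of_triple_eq htw'.2.1 htw'.2.2.1 (e.trans hτ.symm))
    refine ⟨b w', fun e => ?_, ?_, fun w hwt => ?_⟩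
    · have hz : z ∈ σ := h.mem_of_eq e.symm
      rw [← hw] at hz
      simp only [Finset.mem_insert, Finset.mem_singleton] at hz
      exact hw₀ ((hz.resolve_left ht.2.1.symm).resolve_left ht.2.2.1.symm).symm
    · exact (h.isTriangle_iff _ _ _).2 (Or.inr ⟨x', y', w', ex, ey, rfl, htw', hτ'⟩)
    · rcases (h.isTriangle_iff _ _ _).1 hwt with ⟨x₁, y₁, z₁, e1, e2, rfl, ht₁, hσ₁⟩ |
        ⟨x₁, y₁, z₁, e1, e2, rfl, ht₁, hσ₁⟩
      · obtain rfl := a.injective e1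
        obtain rfl := a.injective e2
        rcases huniq _ ht₁ with rfl | rfl
        · exact Or.inl rfl
        · exact absurd hw hσ₁
      · obtain rfl := b.injective (e1.trans ex.symm)
        obtain rfl := b.injective (e2.trans ey.symm)
        rcases huniq' _ ht₁ with rfl | rfl
        · exact absurd hτ hσ₁
        · exact Or.inr rfl
  · refine ⟨a w₀, fun e => hw₀ (a.injective e), ?_, fun w hwt => ?_⟩
    · exact (h.isTriangle_iff _ _ _).2 (Or.inl ⟨x, y, w₀, rfl, rfl, rfl, htw₀, hw⟩)
    · rcases (h.isTriangle_iff _ _ _).1 hwt with ⟨x₁, y₁, z₁, e1, e2, rfl, ht₁, hσ₁⟩ |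
        ⟨x₁, y₁, z₁, e1, e2, rfl, ht₁, hσ₁⟩
      · obtain rfl := a.injective e1
        obtain rfl := a.injective e2
        exact (huniq _ ht₁).imp (congrArg a) (congrArg a)
      · obtain ⟨z₂, ht₂, e⟩ :=
          exists_third h.memX h.cardX (h.mem_of_eq e1.symm) (h.mem_of_eq e2.symm) ht.1
        rcases huniq _ ht₂ with rfl | rfl
        · exact absurd e hσ
        · exact absurd e hw

/-- The triangles at a vertex that come from the same summand are connected across edges. -/
theorem link_same (h : IsGluing X Y Z a b σ τ) (hX : X.IsClosedSurface) (p : U)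
    (F : U → U → Prop) (hsymm : ∀ q r, F q r → F r q)
    (hF : ∀ q r r', Z.IsTriangle p q r → Z.IsTriangle p q r' → F q r → F q r')
    {q r q' r' : U} (ht : IsTriangleOf X a σ p q r) (ht' : IsTriangleOf X a σ p q' r')
    (hqr : F q r) : F q' r' := by
  obtain ⟨x, y, z, rfl, rfl, rfl, ht, hσ⟩ := ht
  obtain ⟨x', y', z', e, rfl, rfl, ht', hσ'⟩ := ht'
  obtain rfl := a.injective e
  exact hX.link_avoid σ x' (fun y z => F (a y) (a z)) (fun _ _ => hsymm _ _)
    (fun y z z' h1 h2 n1 n2 => hF _ _ _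
      ((h.isTriangle_iff _ _ _).2 (Or.inl ⟨_, _, _, rfl, rfl, rfl, h1, n1⟩))
      ((h.isTriangle_iff _ _ _).2 (Or.inl ⟨_, _, _, rfl, rfl, rfl, h2, n2⟩))) ht ht' hσ hσ' hqr

/-- The triangles at a common vertex of the two summands are connected through a common edge. -/
theorem link_cross (h : IsGluing X Y Z a b σ τ) (hX : X.IsClosedSurface)
    (hY : Y.IsClosedSurface) (p : U) (F : U → U → Prop) (hsymm : ∀ q r, F q r → F r q)
    (hF : ∀ q r r', Z.IsTriangle p q r → Z.IsTriangle p q r' → F q r → F q r')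
    {q r q' r' : U} (ht : IsTriangleOf X a σ p q r) (ht' : IsTriangleOf Y b τ p q' r')
    (hqr : F q r) : F q' r' := by
  obtain ⟨x, _, _, ex, -⟩ := id ht
  obtain ⟨x', _, _, ex', -⟩ := id ht'
  have hx : x ∈ σ := h.mem_of_eq (ex.trans ex'.symm)
  have hx' : x' ∈ τ := h.symm.mem_of_eq (ex'.trans ex.symm)
  obtain ⟨y, hy, hyx⟩ : ∃ y ∈ σ, y ≠ x :=
    Finset.exists_mem_ne (by rw [h.cardX]; norm_num) x
  obtain ⟨y', hy', ey⟩ := h.exists_eq hy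
  have hyx' : y' ≠ x' := by
    rintro rfl
    exact hyx (a.injective (ey.symm.trans (ex'.trans ex.symm)))
  obtain ⟨z, htz, hz⟩ := exists_third h.memX h.cardX hx hy hyx.symm
  obtain ⟨z', htz', hz'⟩ := exists_third h.memY h.cardY hx' hy' hyx'.symm
  -- the two triangles over the edge `x y` of the common boundary, one in each summand
  obtain ⟨w, hw, htw, -⟩ := hX.isCombinatorialSurface.two _ _ _ htz
  obtain ⟨w', hw', htw', -⟩ := hY.isCombinatorialSurface.two _ _ _ htz'
  have h1 : IsTriangleOf X a σ p (a y) (a w) := ⟨x, y, w, ex, rfl, rfl, htw, fun e =>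
    hw (eq_of_triple_eq htw.2.1 htw.2.2.1 (e.trans hz.symm))⟩
  have h2 : IsTriangleOf Y b τ p (a y) (b w') := ⟨x', y', w', ex', ey, rfl, htw', fun e =>
    hw' (eq_of_triple_eq htw'.2.1 htw'.2.2.1 (e.trans hz'.symm))⟩
  exact h.symm.link_same hY p F hsymm hF h2 ht'
    (hF _ _ _ ((h.isTriangle_iff _ _ _).2 (Or.inl h1)) ((h.isTriangle_iff _ _ _).2 (Or.inr h2))
      (h.link_same hX p F hsymm hF ht h1 hqr))

theorem isCombinatorialSurface (h : IsGluing X Y Z a b σ τ) (hX : X.IsClosedSurface)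
    (hY : Y.IsClosedSurface) : Z.IsCombinatorialSurface where
  pure u hu := by
    rcases (h.faces u).1 hu with ⟨s, hs, hsσ, rfl⟩ | ⟨s, hs, hsσ, rfl⟩
    · obtain ⟨x, y, z, ht, hsub, hσ⟩ := hX.isCombinatorialSurface.exists_triangle_ne hs hsσ
      refine ⟨a x, a y, a z, (h.isTriangle_iff _ _ _).2 (Or.inl ⟨_, _, _, rfl, rfl, rfl, ht, hσ⟩),
        ?_⟩
      rw [← map_triple]
      exact Finset.map_subset_map.2 hsub
    · obtain ⟨x, y, z, ht, hsub, hσ⟩ := hY.isCombinatorialSurface.exists_triangle_ne hs hsσ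
      refine ⟨b x, b y, b z, (h.isTriangle_iff _ _ _).2 (Or.inr ⟨_, _, _, rfl, rfl, rfl, ht, hσ⟩),
        ?_⟩
      rw [← map_triple]
      exact Finset.map_subset_map.2 hsub
  two p q r ht := ((h.isTriangle_iff _ _ _).1 ht).elim (h.exists_other hX hY)
    (h.symm.exists_other hY hX)
  link p F hsymm hF q r q' r' ht ht' := by
    rcases (h.isTriangle_iff _ _ _).1 ht with ht | ht <;>
      rcases (h.isTriangle_iff _ _ _).1 ht' with ht' | ht'
    · exact h.link_same hX p F hsymm hF ht ht'
    · exact h.link_cross hX hY p F hsymm hF ht ht'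
    · exact h.symm.link_cross hY hX p F hsymm hF ht ht'
    · exact h.symm.link_same hY p F hsymm hF ht ht'

end IsGluing

end

end AbstractSimplicialComplex

/-- The common boundary has three vertices and three edges, and two triangles are removed. -/
theorem IsConnectedSum.euler_eq {A B K : Type} [TopologicalSpace A] [TopologicalSpace B]
    [TopologicalSpace K] (h : IsConnectedSum A B K) : euler K = euler A + euler B - 2 := by
  classical
  obtain ⟨V, W, U, _, _, _, _, _, X, Y, Z, hX, hY, ⟨eA⟩, ⟨eB⟩, ⟨a, b, σ, τ, h⟩, ⟨eK⟩⟩ := h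
  have hg : AbstractSimplicialComplex.IsGluing X Y Z a b σ τ :=
    ⟨h.1, h.2.1, h.2.2.1, h.2.2.2.1, h.2.2.2.2.1, h.2.2.2.2.2.1, h.2.2.2.2.2.2⟩
  rw [← euler_congr eA, ← euler_congr eB, ← euler_congr eK,
    AbstractSimplicialComplex.euler_realization (hg.isCombinatorialSurface hX hY),
    AbstractSimplicialComplex.euler_realization hX.isCombinatorialSurface,
    AbstractSimplicialComplex.euler_realization hY.isCombinatorialSurface]
  have h1 := hg.faceCount_of_lt (n := 1) (by norm_num) (by norm_num)
  have h2 := hg.faceCount_of_lt (n := 2) (by norm_num) (by norm_num)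
  have h3 := hg.faceCount_three
  simp only [Nat.choose] at h1 h2
  omega

/-! ### Gems of surfaces -/

theorem IsClosedConnectedSurface.exists_gem {K : Type} [TopologicalSpace K]
    (hK : IsClosedConnectedSurface K) : ∃ Γ : ColoredGraph 2, Γ.Represents K := by
  obtain ⟨-, V, _, _, X, hX, ⟨e⟩⟩ := hK
  obtain ⟨e'⟩ := AbstractSimplicialComplex.flagGraph_represents hX.isCombinatorialSurface
  exact ⟨_, ⟨e'.trans e⟩⟩

theorem IsConnectedSumPower.euler_eq {T : Type} [TopologicalSpace T] :
    ∀ (n : ℕ) {K : Type} [TopologicalSpace K], IsConnectedSumPower T (n + 1) K →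
      euler K = (n + 1) * euler T - 2 * n
  | 0, K, _, ⟨e⟩ => by rw [euler_congr e]; push_cast; ring
  | n + 1, K, _, ⟨A, _, hA, hK⟩ => by
    rw [hK.euler_eq, IsConnectedSumPower.euler_eq n hA]
    push_cast
    ring

end

theorem mainTheorem2 (K : Type) [TopologicalSpace K] (hK : IsClosedConnectedSurface K) :
    (∃ (Γ : ColoredGraph 2) (f : Fin 3 → ℕ), (∀ i, 3 ≤ f i) ∧
      Γ.IsSemiEquivelarGem K K f ∧ Γ.IsGenusMinimal K) ∧
    (Nonempty (K ≃ₜ TwoSphere) →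
      ∃ Γ : ColoredGraph 2, Γ.IsSemiEquivelarGem K K (fun _ => 4) ∧ Γ.IsGenusMinimal K) ∧
    (∀ n : ℕ, 1 ≤ n → IsConnectedSumPower Torus n K →
      ∃ Γ : ColoredGraph 2,
        Γ.IsSemiEquivelarGem K K (fun _ => 4 * n + 2) ∧ Γ.IsGenusMinimal K) ∧
    (∀ n : ℕ, 1 ≤ n → IsConnectedSumPower ProjectivePlane n K →
      ∃ Γ : ColoredGraph 2,
        Γ.IsSemiEquivelarGem K K (fun _ => 2 * n + 2) ∧ Γ.IsGenusMinimal K) := by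
  obtain ⟨n, hn, hn2, ⟨Γ, hΓ, hmin⟩, hcube⟩ :=
    ColoredGraph.exists_semiEquivelar hK hK.exists_gem
  refine ⟨?_, ?_, ?_, ?_⟩
  · rcases hn2.eq_or_lt with h2 | h3
    · obtain ⟨Γ', hΓ', hmin'⟩ := hcube h2.symm
      exact ⟨Γ', _, fun _ => by norm_num, hΓ', hmin'⟩
    · exact ⟨Γ, _, fun _ => h3, hΓ, hmin⟩
  · rintro ⟨e⟩
    obtain ⟨e'⟩ := ColoredGraph.cube_represents
    have hrep : ColoredGraph.cube.Represents K := ⟨e'.trans e.symm⟩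
    exact ⟨_, ColoredGraph.isSemiEquivelarGem_of_cycleLength hK hrep ColoredGraph.cube_cycleLength,
      hrep.isGenusMinimal⟩
  · rintro (_ | m) hm hsum
    · omega
    · have := hsum.euler_eq
      rw [ColoredGraph.euler_torus] at this
      obtain rfl : n = 4 * (m + 1) + 2 := by
        zify
        rw [hn, this]
        ring
      exact ⟨Γ, hΓ, hmin⟩
  · rintro (_ | m) hm hsum
    · omega
    · have := hsum.euler_eq
      rw [ColoredGraph.euler_projectivePlane] at this
      obtain rfl : n = 2 * (m + 1) + 2 := by
        zify
        rw [hn, this]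
        ring
      exact ⟨Γ, hΓ, hmin⟩
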